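/- **Theorem.** Let $n\ge 2$, $t_0\in\mathbb R$, $a_0,\dots,a_{n-1}\in\mathbb C$, and let $r_0,\dots,r_{n-1}:[t_0,\infty)\to\mathbb C$. Put $a_n=1$, $r_n=0$, $P(a;x)=\sum_{i=0}^n a_ix^i$ and $P(r(t);x)=\sum_{i=0}^{n-1}r_i(t)x^i$. Assume that the roots $\lambda,\lambda_1,\dots,\lambda_{n-1}$ of $P(a;x)$ have pairwise distinct real parts, and write $\gamma_j=\lambda_j-\lambda$, $\alpha_j=\Re\gamma_j$, $\Gamma_j=\prod_{k\ne j}(\gamma_j-\gamma_k)$. Write $P(r;\lambda)$ for the function $t\mapsto P(r(t);\lambda)$ and $\partial_x^kP(r;\lambda)$ for $t\mapsto\frac{\partial^k}{\partial x^k}P(r(t);x)\big|_{x=\lambda}$. Suppose $$P(r;\lambda)\in L^p[t_0,\infty),\qquad \partial_x^kP(r;\lambda)\in L^{p_k}[t_0,\infty)\quad (k=1,\dots,n-1),\qquad p,p_k\in(1,2].$$ Notation. For $\Re\omega\neq0$ let $g_\omega(t,s)=-\operatorname{sgn}(\Re\omega)e^{\omega(t-s)}$ if $\operatorname{sgn}(\Re\omega)(t-s)<0$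 and $g_\omega(t,s)=0$ otherwise, and put $$G_\omega[f](t)=\int_{t_0}^\infty g_\omega(t,s)f(s)\,ds,\qquad I^{T}_\omega[f](t)=\int_{T}^\infty |g_\omega(t,s)f(s)|\,ds .$$ Let $B_i$ be the complete Bell polynomials: $B_0=1$, $B_{i+1}(x_1,\dots,x_{i+1})=\sum_{j=0}^i\binom ij B_{i-j}(x_1,\dots,x_{i-j})\,x_{j+1}$. For a function $z$ put $Z=(z,z',\dots,z^{(n-2)})$ and $$\mathcal L(t,z)=\sum_{k=1}^{n-1}\frac1{k!}\,\partial_x^kP(r;\lambda)(t)\,z^{(k-1)}(t),$$ $$\mathcal F(t,Z)=\sum_{i=2}^n\sum_{j=0}^{n-i}\binom{i+j}{j}\big(a_{i+j}+r_{i+j}(t)\big)\lambda^j\Big(B_i(z,z',\dots,z^{(i-1)})-z^{(i-1)}\Big)(t)$$ (the last bracket does not involve $z^{(i-1)}$). Conclusion. There exists a solution $y$ on $[t_0,\infty)$ of $$y^{(n)}(t)+\sum_{i=0}^{n-1}(a_i+r_i(t))\,y^{(i)}(t)=0$$ (that is, $y\in C^{n-1}$, $y^{(n-1)}$ is locally absolutely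 continuous, and the equation holds almost everywhere) such that $$\lim_{t\to\infty}\frac{y^{(i)}(t)}{y(t)}=\lambda^i,\qquad i=1,\dots,n-1.$$ Furthermore there is $T\ge t_0$ such that $y$ has no zero on $[T,\infty)$ and, with $z=y'/y-\lambda$ on $[T,\infty)$, the functions $\mathcal L(\cdot,z)$ and $\mathcal F(\cdot,Z)$ are integrable on $[T,\infty)$, and for all $t\ge t_0$ $$y(t)=(1+\varepsilon(t))\,e^{\lambda(t-t_0)}\exp\Big(-\sum_{j=1}^{n-1}\frac{1}{\Gamma_j\gamma_j}G_{\gamma_j}[P(r;\lambda)](t)+(-1)^n\prod_{k=1}^{n-1}(\lambda_k-\lambda)^{-1}\int_{t_0}^tP(r;\lambda)(s)\,ds\Big),$$ where, as $t\to\infty$, $$\varepsilon(t)=O\Big(\sum_{j=1}^{n-1}I^{T}_{\alpha_j}\big[\mathcal L(\cdot,z)+\mathcal F(\cdot,Z)\big](t)+\int_t^\infty\big[|\mathcal L(s,z(s))|+|\mathcal F(s,Z(s))|\big]\,ds\Big).$$ -/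

import Mathlib

namespace PoincarePerron

open MeasureTheory Set

noncomputable section

/-- The characteristic polynomial `P(a; x) = x ^ n + ∑_{i < n} a_i x ^ i`; its coefficients are
`a_0, …, a_{n-1}` together with `a_n = 1`. -/
def charPoly {n : ℕ} (a : Fin n → ℂ) : Polynomial ℂ :=
  Polynomial.X ^ n + ∑ i : Fin n, Polynomial.C (a i) * Polynomial.X ^ (i : ℕ)

/-- The polynomial `P(r(t); x) = ∑_{i < n} r_i(t) x ^ i` in `x`, for fixed `t`
(so that `r_n = 0`). -/
def pertPoly {n : ℕ} (r : Fin n → ℝ → ℂ) (t : ℝ) : Polynomial ℂ :=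
  ∑ i : Fin n, Polynomial.C (r i t) * Polynomial.X ^ (i : ℕ)

/-- The function `t ↦ (∂ ^ k / ∂ x ^ k) P(r(t); x)` at `x = lam`. For `k = 0` it is
`P(r; lam)`. -/
def pertDeriv {n : ℕ} (r : Fin n → ℝ → ℂ) (lam : ℂ) (k : ℕ) (t : ℝ) : ℂ :=
  (Polynomial.derivative^[k] (pertPoly r t)).eval lam

/-- `y` is a solution on `[t₀, ∞)` of `y^(n) + ∑_{i < n} (a_i + r_i(t)) y^(i) = 0`, in the sense
of Carathéodory (the `r_i` are only locally integrable): `y` is of class `C^(n-1)` on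
`[t₀, ∞)`, `y^(n-1)` is locally absolutely continuous there, and the equation holds
almost everywhere. -/
structure IsSolution {n : ℕ} (t₀ : ℝ) (a : Fin n → ℂ) (r : Fin n → ℝ → ℂ) (y : ℝ → ℂ) :
    Prop where
  contDiffOn : ContDiffOn ℝ ((n - 1 : ℕ) : WithTop ℕ∞) y (Ici t₀)
  absCont : ∀ b, t₀ ≤ b →
    AbsolutelyContinuousOnInterval (iteratedDerivWithin (n - 1) y (Ici t₀)) t₀ b
  equation : ∀ᵐ t ∂(volume.restrict (Ici t₀)),
    HasDerivAt (iteratedDerivWithin (n - 1) y (Ici t₀))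
      (-∑ i : Fin n, (a i + r i t) * iteratedDerivWithin (i : ℕ) y (Ici t₀) t) t

/-- The scalar Green function `g_ω(t, s)`. -/
def greenFun (ω : ℂ) (t s : ℝ) : ℂ :=
  if Real.sign ω.re * (t - s) < 0 then
    -((Real.sign ω.re : ℝ) : ℂ) * Complex.exp (ω * ((t - s : ℝ) : ℂ))
  else 0

/-- `G_ω[f](t) = ∫_{t₀}^∞ g_ω(t, s) f(s) ds`. -/
def greenG (t₀ : ℝ) (ω : ℂ) (f : ℝ → ℂ) (t : ℝ) : ℂ :=
  ∫ s in Ici t₀, greenFun ω t s * f s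

/-- `I_ω[f](t) = ∫_{t₀}^∞ |g_ω(t, s) f(s)| ds`. -/
def greenI (t₀ : ℝ) (ω : ℂ) (f : ℝ → ℂ) (t : ℝ) : ℝ :=
  ∫ s in Ici t₀, ‖greenFun ω t s * f s‖

/-- `Γ_j = ∏_{k ≠ j} (γ_j - γ_k)`. -/
def Gam {m : ℕ} (γ : Fin m → ℂ) (j : Fin m) : ℂ :=
  ∏ k ∈ Finset.univ.erase j, (γ j - γ k)

/-- Complete Bell polynomials `B_i(x_1, …, x_i)`, by the recursion
`B_0 = 1`, `B_{i+1} = ∑_{j ≤ i} (i choose j) B_{i-j} x_{j+1}`.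
The variable `x_{j+1}` is `x j` here. -/
def completeBell (x : ℕ → ℂ) : ℕ → ℂ
  | 0 => 1
  | i + 1 => ∑ j : Fin (i + 1), (i.choose j : ℂ) * completeBell x (i - j) * x j
termination_by i => i

/-- The derivatives `k ↦ z^(k)(t)` of a function `z` on `[T, ∞)`. -/
def jet (T : ℝ) (z : ℝ → ℂ) (t : ℝ) (k : ℕ) : ℂ :=
  iteratedDerivWithin k z (Ici T) t

/-- `ℒ(t, z) = ∑_{k=1}^{n-1} (1 / k!) (∂ ^ k / ∂ x ^ k) P(r(t); lam) z^(k-1)`, where `x k` stands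
for `z^(k)`. -/
def linPart {n : ℕ} (r : Fin n → ℝ → ℂ) (lam : ℂ) (t : ℝ) (x : ℕ → ℂ) : ℂ :=
  ∑ k ∈ Finset.Icc 1 (n - 1), (1 / (Nat.factorial k : ℂ)) * pertDeriv r lam k t * x (k - 1)

/-- `ℱ(t, z, …, z^(n-2)) = ∑_{i=2}^n ∑_{j=0}^{n-i} (i+j choose j) (a_{i+j} + r_{i+j}(t)) lam ^ j
(B_i(z, z', …, z^(i-1)) - z^(i-1))`, where `x k` stands for `z^(k)`, `a_n = 1` and `r_n = 0`.
(`B_i - z^(i-1)` does not contain `z^(i-1)`, so the value of `x (n - 1)` is irrelevant.) -/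
def nonlinPart {n : ℕ} (a : Fin n → ℂ) (r : Fin n → ℝ → ℂ) (lam : ℂ) (t : ℝ) (x : ℕ → ℂ) : ℂ :=
  ∑ i ∈ Finset.Icc 2 n, ∑ j ∈ Finset.range (n - i + 1),
    ((i + j).choose j : ℂ) * ((charPoly a).coeff (i + j) + (pertPoly r t).coeff (i + j)) *
      lam ^ j * (completeBell x i - x (i - 1))

end

end PoincarePerron

open PoincarePerron MeasureTheory Set Filter Topology Asymptotics

namespace PoincarePerron

/-! Write `y = exp ∫ (λ + z)`. Then `y^(i) / y = ∑_m (i choose m) λ^(i-m) B_m(z, z', …)`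
(`shiftBell`), and expanding the polynomials at `λ` turns the equation for `y` into `∏ (d/dt - γ_j)
z = -(f + ℒ + ℱ)` with `f = P(r; λ)` (`sum_coeff_mul_shiftBell_eq`). By partial fractions `z = -∑
u_j / Γ_j`, where the modes solve `u_j' = γ_j u_j + f + H` and `H = ℒ + ℱ` is a function of the
modes alone. As `Re γ_j ≠ 0`, decaying modes are obtained from `u_j = G_{γ_j}[f] + G_{γ_j}[H]`, with
`f` acting from `t₀` and `H` from a large `T`.

The hypotheses in `L^p`, `1 < p ≤ 2`, enter only through one integrable weight `w > 0` such that
every coefficient `c` satisfies `|c| ≤ η + w / η` for all `η ∈ (0, 1]` (`SplitBound`,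
`exists_weight`). If `E` is the average of `w` against `exp (-2b|t - s|)` and `e = √E`, then `G[f] =
O(e)`, `e → 0`, and both `e²` and `|c| e` are integrable. In the norm weighted by `e` the equations
for the modes are a contraction for large `T` (`exists_modes`). Hence `u_j = O(e)`, the linear term
is `O(|c| e)`, the nonlinear one `O((1 + |c|) e²)`, and both are integrable.

Since `z → 0` together with `z', …, z^(n-2)`, the quotients `y^(i) / y` tend to `λ^i`. Dividing the
equations of the modes by `Γ_j γ_j` and summing integrates `z` explicitly (`exponent_eq_integral`).
The part coming from `f` is the stated exponent. The part coming from `H` is a bounded `v`, and `ε =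
exp v - 1` on `[T, ∞)`. Finally `y` is continued from `T` back to `t₀` by solving the linear system
there (`exists_isSolution_extension`). -/

/-! ### Absolute continuity and Carathéodory solutions. -/

/-- The primitive of an integrable complex function is absolutely continuous. -/
theorem absolutelyContinuousOnInterval_integral {f : ℝ → ℂ} {a b c : ℝ}
    (h : IntervalIntegrable f volume a b) (hc : c ∈ uIcc a b) :
    AbsolutelyContinuousOnInterval (fun x ↦ ∫ v in c..x, f v) a b := by
  -- The real case is applied to `‖f‖`, whose primitive has larger increments.
  have h1 := h.norm.absolutelyContinuousOnInterval_intervalIntegral hc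
  unfold AbsolutelyContinuousOnInterval at h1 ⊢
  refine squeeze_zero' ?_ ?_ h1
  · filter_upwards with E
    exact Finset.sum_nonneg fun _ _ ↦ dist_nonneg
  · have : ∀ᶠ E : ℕ × (ℕ → ℝ × ℝ) in
        AbsolutelyContinuousOnInterval.totalLengthFilter ⊓
          𝓟 (AbsolutelyContinuousOnInterval.disjWithin a b),
        E ∈ AbsolutelyContinuousOnInterval.disjWithin a b :=
      eventually_inf_principal.mpr (by simp)
    filter_upwards [this] with E hE
    refine Finset.sum_le_sum fun i hi ↦ ?_
    obtain ⟨hx, hy⟩ := hE.1 i hi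
    have hint : ∀ {p q : ℝ}, p ∈ uIcc a b → q ∈ uIcc a b → IntervalIntegrable f volume p q :=
      fun hp hq ↦ h.mono_set (uIcc_subset_uIcc hp hq)
    rw [dist_eq_norm, dist_eq_norm,
      intervalIntegral.integral_interval_sub_left (hint hc hx) (hint hc hy),
      intervalIntegral.integral_interval_sub_left (hint hc hx).norm (hint hc hy).norm]
    exact intervalIntegral.norm_integral_le_abs_integral_norm

/-- The fundamental theorem of calculus for absolutely continuous functions. -/
theorem eq_add_integral_of_absolutelyContinuous {u v : ℝ → ℂ} {a b : ℝ}
    (hu : AbsolutelyContinuousOnInterval u a b) (hv : IntervalIntegrable v volume a b)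
    (hd : ∀ᵐ x, x ∈ uIcc a b → HasDerivAt u (v x) x) :
    u b = u a + ∫ s in a..b, v s := by
  have h1 := absolutelyContinuousOnInterval_integral hv (left_mem_uIcc (a := a) (b := b))
  have h2 := hu.sub h1
  have h3 : ∀ᵐ x, x ∈ uIcc a b →
      HasDerivAt (u - fun x ↦ ∫ s in a..x, v s) 0 x := by
    filter_upwards [hd, hv.ae_hasDerivAt_integral] with x hx1 hx2 hx
    simpa using (hx1 hx).sub (hx2 hx a left_mem_uIcc)
  obtain ⟨C, hC⟩ := h2.const_of_ae_hasDerivAt_zero h3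
  have ha := hC a left_mem_uIcc
  have hb := hC b right_mem_uIcc
  simp only [Pi.sub_apply, intervalIntegral.integral_same, sub_zero] at ha hb
  rw [ha, ← hb]; ring

theorem AbsolutelyContinuousOnInterval.congr' {f g : ℝ → ℂ} {a b : ℝ}
    (hf : AbsolutelyContinuousOnInterval f a b) (h : EqOn f g (uIcc a b)) :
    AbsolutelyContinuousOnInterval g a b := by
  unfold AbsolutelyContinuousOnInterval at hf ⊢
  refine hf.congr' ?_
  have : ∀ᶠ E : ℕ × (ℕ → ℝ × ℝ) in
      AbsolutelyContinuousOnInterval.totalLengthFilter ⊓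
        𝓟 (AbsolutelyContinuousOnInterval.disjWithin a b),
      E ∈ AbsolutelyContinuousOnInterval.disjWithin a b :=
    eventually_inf_principal.mpr (by simp)
  filter_upwards [this] with E hE
  refine Finset.sum_congr rfl fun i hi ↦ ?_
  rw [h (hE.1 i hi).1, h (hE.1 i hi).2]

theorem absolutelyContinuousOnInterval_of_eq_integral {u v : ℝ → ℂ} {a b c : ℝ}
    (hc : c ∈ uIcc a b) (hv : IntervalIntegrable v volume a b)
    (h : ∀ t ∈ uIcc a b, u t = u c + ∫ s in c..t, v s) :
    AbsolutelyContinuousOnInterval u a b := by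
  have h0 : AbsolutelyContinuousOnInterval (fun _ ↦ u c : ℝ → ℂ) a b :=
    (contDiff_const (n := 1)).contDiffOn.absolutelyContinuousOnInterval
  refine AbsolutelyContinuousOnInterval.congr'
    (h0.add (absolutelyContinuousOnInterval_integral hv hc)) fun t ht ↦ ?_
  simp [h t ht]

theorem ae_hasDerivAt_of_eq_integral {u v : ℝ → ℂ} {t₀ c : ℝ} (hc : t₀ ≤ c)
    (hv : ∀ b, t₀ ≤ b → IntervalIntegrable v volume t₀ b)
    (h : ∀ t, t₀ ≤ t → u t = u c + ∫ s in c..t, v s) :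
    ∀ᵐ t ∂(volume.restrict (Ici t₀)), HasDerivAt u (v t) t := by
  rw [ae_restrict_iff' measurableSet_Ici]
  -- The half line is exhausted by countably many compact intervals, so the exceptional null sets
  -- may be united. The endpoint `t₀` is discarded below, as it has no two-sided neighbourhood in
  -- the half line.
  have h1 : ∀ᵐ t, ∀ k : ℕ, t ∈ uIcc t₀ (c + k) → ∀ d ∈ uIcc t₀ (c + k),
      HasDerivAt (fun x => ∫ s in d..x, v s) (v t) t := by
    rw [ae_all_iff]
    intro k
    exact (hv (c + k) (by have := k.cast_nonneg (α := ℝ); linarith)).ae_hasDerivAt_integral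
  have h2 : ∀ᵐ t : ℝ, t ≠ t₀ := by simp [ae_iff, measure_singleton]
  filter_upwards [h1, h2] with t ht hne hmem
  have hlt : t₀ < t := lt_of_le_of_ne hmem hne.symm
  obtain ⟨k, hk⟩ := exists_nat_ge (t - c)
  have hk0 := k.cast_nonneg (α := ℝ)
  have h3 := ht k (by rw [uIcc_of_le (by linarith)]; exact ⟨hmem, by linarith⟩) c
    (by rw [uIcc_of_le (by linarith)]; exact ⟨hc, by linarith⟩)
  refine (h3.const_add (u c)).congr_of_eventuallyEq ?_
  filter_upwards [Ioi_mem_nhds hlt] with x hx using h x (le_of_lt hx)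

theorem hasDerivWithinAt_of_eq_integral {u v : ℝ → ℂ} {t₀ c t : ℝ} (hc : t₀ ≤ c)
    (hv : ContinuousOn v (Ici t₀))
    (h : ∀ t, t₀ ≤ t → u t = u c + ∫ s in c..t, v s) (ht : t₀ ≤ t) :
    HasDerivWithinAt u (v t) (Ici t₀) t := by
  have hsub : uIcc c t ⊆ Ici t₀ := fun x hx ↦ (le_min hc ht).trans hx.1
  have hint : IntervalIntegrable v volume c t := (hv.mono hsub).intervalIntegrable
  -- Freezing `v` to the left of `t₀` makes it continuous on the whole line, so that the two-sided
  -- fundamental theorem applies.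
  have hVc : Continuous (fun x ↦ v (max x t₀)) :=
    hv.comp_continuous (by fun_prop) fun x ↦ mem_Ici.2 (le_max_right _ _)
  have h1 : HasDerivAt (fun x ↦ u c + ∫ s in c..x, v (max s t₀)) (v (max t t₀)) t :=
    (intervalIntegral.integral_hasDerivAt_right (hVc.intervalIntegrable _ _)
      (hVc.stronglyMeasurableAtFilter _ _) hVc.continuousAt).const_add _
  rw [max_eq_left ht] at h1
  refine h1.hasDerivWithinAt.congr_of_mem (fun x hx ↦ ?_) ht
  rw [h x hx]
  congr 1
  refine intervalIntegral.integral_congr fun s hs ↦ ?_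
  have : t₀ ≤ s := (le_min hc hx).trans hs.1
  simp [max_eq_left this]

theorem iteratedDerivWithin_eq_of_hasDerivWithinAt {Y : ℕ → ℝ → ℂ} {t₀ : ℝ} {m : ℕ}
    (h : ∀ k < m, ∀ t, t₀ ≤ t → HasDerivWithinAt (Y k) (Y (k + 1) t) (Ici t₀) t) :
    ∀ k ≤ m, EqOn (iteratedDerivWithin k (Y 0) (Ici t₀)) (Y k) (Ici t₀) := by
  intro k
  induction k with
  | zero => intro _ t _; simp
  | succ k ih =>
    intro hk t ht
    rw [iteratedDerivWithin_succ]
    have h1 : derivWithin (iteratedDerivWithin k (Y 0) (Ici t₀)) (Ici t₀) t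
        = derivWithin (Y k) (Ici t₀) t :=
      derivWithin_congr (ih (by omega)) (ih (by omega) ht)
    rw [h1]
    exact (h k (by omega) t ht).derivWithin (uniqueDiffOn_Ici t₀ t ht)

/-- A family satisfying the integrated first order system gives a Carathéodory solution. -/
theorem isSolution_of_integral_eq {n : ℕ} (hn : 1 ≤ n) {t₀ T : ℝ} (hT : t₀ ≤ T) {a : Fin n → ℂ}
    {r : Fin n → ℝ → ℂ} {Y : ℕ → ℝ → ℂ} (hc : ∀ i < n, ContinuousOn (Y i) (Ici t₀))
    (hi : ∀ i, i + 1 < n → ∀ t, t₀ ≤ t → Y i t = Y i T + ∫ s in T..t, Y (i + 1) s)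
    (hint : ∀ b, t₀ ≤ b →
      IntervalIntegrable (fun s ↦ -∑ i : Fin n, (a i + r i s) * Y i s) volume t₀ b)
    (hlast : ∀ t, t₀ ≤ t → Y (n - 1) t = Y (n - 1) T +
      ∫ s in T..t, -∑ i : Fin n, (a i + r i s) * Y i s) :
    IsSolution t₀ a r (Y 0) ∧
      ∀ k < n, EqOn (iteratedDerivWithin k (Y 0) (Ici t₀)) (Y k) (Ici t₀) := by
  have hd : ∀ k < n - 1, ∀ t, t₀ ≤ t → HasDerivWithinAt (Y k) (Y (k + 1) t) (Ici t₀) t :=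
    fun k hk t ht ↦ hasDerivWithinAt_of_eq_integral hT (hc (k + 1) (by omega))
      (hi k (by omega)) ht
  have he := iteratedDerivWithin_eq_of_hasDerivWithinAt hd
  refine ⟨⟨?_, ?_, ?_⟩, fun k hk ↦ he k (by omega)⟩
  · refine contDiffOn_of_continuousOn_differentiableOn_deriv ?_ ?_
    · intro m hm
      have hm' : m ≤ n - 1 := by exact_mod_cast hm
      exact (hc m (by omega)).congr (he m hm')
    · intro m hm
      have hm' : m < n - 1 := by exact_mod_cast hm
      exact DifferentiableOn.congr
        (fun t ht ↦ (hd m hm' t ht).differentiableWithinAt) (he m hm'.le)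
  · intro b hb
    have hM : t₀ ≤ max b T := hb.trans (le_max_left _ _)
    have h1 := absolutelyContinuousOnInterval_of_eq_integral
      (u := Y (n - 1)) (a := t₀) (b := max b T) (c := T)
      (by rw [uIcc_of_le hM]; exact ⟨hT, le_max_right _ _⟩) (hint _ hM)
      (fun t ht ↦ hlast t (by rw [uIcc_of_le hM] at ht; exact ht.1))
    refine AbsolutelyContinuousOnInterval.congr' (h1.mono ?_) fun t ht ↦ ?_
    · rw [uIcc_of_le hb, uIcc_of_le hM]
      exact Icc_subset_Icc_right (le_max_left _ _)
    · rw [uIcc_of_le hb] at ht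
      exact (he (n - 1) le_rfl ht.1).symm
  · have h1 := ae_hasDerivAt_of_eq_integral hT hint hlast
    have h2 : ∀ᵐ t ∂(volume.restrict (Ici t₀)), t ∈ Ioi t₀ := by
      rw [← restrict_Ioi_eq_restrict_Ici]
      exact ae_restrict_mem measurableSet_Ioi
    filter_upwards [h1, h2] with t ht hlt
    have h3 : (∑ i : Fin n, (a i + r i t) * iteratedDerivWithin (i : ℕ) (Y 0) (Ici t₀) t)
        = ∑ i : Fin n, (a i + r i t) * Y i t :=
      Finset.sum_congr rfl fun i _ ↦ by rw [he i (by omega) (mem_Ici.2 (le_of_lt hlt))]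
    rw [h3]
    refine ht.congr_of_eventuallyEq ?_
    filter_upwards [Ioi_mem_nhds hlt] with x hx using he (n - 1) le_rfl (mem_Ici.2 (le_of_lt hx))

/-! ### Fixed points, and linear systems on a compact interval. -/

/-- The contraction principle on a ball of bounded continuous functions, in coordinates. -/
theorem exists_fixedPoint_of_bounds {ι : Type*} [Fintype ι] {R : ℝ} (hR : 0 ≤ R)
    (Φ : (ι → ℝ → ℂ) → ι → ℝ → ℂ)
    (hcont : ∀ v : ι → ℝ → ℂ, (∀ i, Continuous (v i)) → (∀ i t, ‖v i t‖ ≤ R) →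
      ∀ i, Continuous (Φ v i))
    (hbound : ∀ v : ι → ℝ → ℂ, (∀ i, Continuous (v i)) → (∀ i t, ‖v i t‖ ≤ R) →
      ∀ i t, ‖Φ v i t‖ ≤ R)
    (hlip : ∀ v v' : ι → ℝ → ℂ, (∀ i, Continuous (v i)) → (∀ i t, ‖v i t‖ ≤ R) →
      (∀ i, Continuous (v' i)) → (∀ i t, ‖v' i t‖ ≤ R) → ∀ D : ℝ, 0 ≤ D →
      (∀ i t, ‖v i t - v' i t‖ ≤ D) → ∀ i t, ‖Φ v i t - Φ v' i t‖ ≤ D / 2) :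
    ∃ v : ι → ℝ → ℂ, (∀ i, Continuous (v i)) ∧ (∀ i t, ‖v i t‖ ≤ R) ∧ Φ v = v := by
  let X := Metric.closedBall (0 : BoundedContinuousFunction ℝ (ι → ℂ)) R
  have hX : IsClosed X := Metric.isClosed_closedBall
  have : CompleteSpace X := hX.completeSpace_coe
  have : Nonempty X := ⟨⟨0, by simpa [X] using hR⟩⟩
  let c : X → ι → ℝ → ℂ := fun v i t ↦ v.1 t i
  have hc : ∀ v i, Continuous (c v i) := fun v i ↦ (continuous_apply i).comp v.1.continuous
  have hb : ∀ v i t, ‖c v i t‖ ≤ R := by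
    intro v i t
    refine (norm_le_pi_norm (v.1 t) i).trans ((v.1.norm_coe_le_norm t).trans ?_)
    exact mem_closedBall_zero_iff.1 v.2
  let Ψ : X → X := fun v ↦ ⟨BoundedContinuousFunction.ofNormedAddCommGroup
    (fun t i ↦ Φ (c v) i t) (continuous_pi fun i ↦ hcont _ (hc v) (hb v) i) R
    (fun t ↦ (pi_norm_le_iff_of_nonneg hR).2 fun i ↦ hbound _ (hc v) (hb v) i t), by
      rw [mem_closedBall_zero_iff]
      exact BoundedContinuousFunction.norm_ofNormedAddCommGroup_le _ hR _⟩
  have hΨ : ContractingWith (1 / 2) Ψ := by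
    refine ⟨by rw [← NNReal.coe_lt_coe]; norm_num, LipschitzWith.of_dist_le_mul fun v v' ↦ ?_⟩
    rw [Subtype.dist_eq, Subtype.dist_eq, BoundedContinuousFunction.dist_le (by positivity)]
    intro t
    rw [dist_pi_le_iff (by positivity)]
    intro i
    rw [dist_eq_norm]
    refine (hlip _ _ (hc v) (hb v) (hc v') (hb v') (dist v.1 v'.1) dist_nonneg
      (fun i t ↦ ?_) i t).trans (le_of_eq ?_)
    · rw [← dist_eq_norm]
      exact (dist_le_pi_dist (v.1 t) (v'.1 t) i).trans
        (BoundedContinuousFunction.dist_coe_le_dist t)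
    · push_cast; ring
  let v := ContractingWith.fixedPoint Ψ hΨ
  have hv : Ψ v = v := hΨ.fixedPoint_isFixedPt
  refine ⟨c v, hc v, hb v, ?_⟩
  funext i t
  have := congrArg (fun w : X ↦ w.1 t i) hv
  exact this


/-- Dominated convergence splits `q` into a part bounded by `N` and an excess of small integral. The
exponential weight for the linear system absorbs the first and leaves the second small. -/
theorem exists_nat_integral_max_sub_le {q : ℝ → ℝ} (hq : Integrable q) (hq0 : ∀ s, 0 ≤ q s)
    {ε : ℝ} (hε : 0 < ε) : ∃ N : ℕ, 1 ≤ N ∧ ∫ s, max (q s - N) 0 ≤ ε := by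
  have h1 : Tendsto (fun N : ℕ ↦ ∫ s, max (q s - N) 0) atTop (𝓝 (∫ _ : ℝ, (0 : ℝ))) := by
    refine tendsto_integral_of_dominated_convergence q (fun N ↦ ?_) hq (fun N ↦ ?_) ?_
    · exact (hq.aestronglyMeasurable.sub aestronglyMeasurable_const).sup
        aestronglyMeasurable_const
    · refine Eventually.of_forall fun s ↦ ?_
      rw [Real.norm_of_nonneg (le_max_right _ _)]
      have := N.cast_nonneg (α := ℝ)
      exact max_le (by linarith) (hq0 s)
    · refine Eventually.of_forall fun s ↦ ?_
      refine tendsto_const_nhds.congr' ?_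
      obtain ⟨k, hk⟩ := exists_nat_ge (q s)
      filter_upwards [eventually_ge_atTop k] with N hN
      have : (k : ℝ) ≤ N := by exact_mod_cast hN
      rw [max_eq_right (by linarith)]
  rw [integral_zero] at h1
  obtain ⟨N, hN, hN'⟩ := ((h1.eventually_lt_const hε).and (eventually_ge_atTop 1)).exists
  exact ⟨N, hN', hN.le⟩

/-- Backward solvability of a linear Carathéodory system on a compact interval. -/
theorem exists_linear_system_solution {ι : Type*} [Fintype ι] {t₀ T : ℝ}
    (A : ι → ι → ℝ → ℂ) (hA : ∀ i j, IntegrableOn (A i j) (Icc t₀ T)) (b : ι → ℂ) :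
    ∃ X : ι → ℝ → ℂ, (∀ i, Continuous (X i)) ∧
      ∀ i, ∀ t ∈ Icc t₀ T, X i t = b i + ∫ s in T..t, ∑ j, A i j s * X j s := by
  classical
  set A' : ι → ι → ℝ → ℂ := fun i j ↦ (Icc t₀ T).indicator (A i j) with hA'
  have hA'i : ∀ i j, Integrable (A' i j) := fun i j ↦
    (integrable_indicator_iff measurableSet_Icc).2 (hA i j)
  set q : ℝ → ℝ := fun s ↦ ∑ i, ∑ j, ‖A' i j s‖ with hq
  have hqi : Integrable q := integrable_finsetSum _ fun i _ ↦
    integrable_finsetSum _ fun j _ ↦ (hA'i i j).norm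
  have hq0 : ∀ s, 0 ≤ q s := fun s ↦
    Finset.sum_nonneg fun i _ ↦ Finset.sum_nonneg fun j _ ↦ norm_nonneg _
  obtain ⟨N, hN1, hN⟩ := exists_nat_integral_max_sub_le hqi hq0 (ε := 1 / 4) (by norm_num)
  have hN1' : (1 : ℝ) ≤ N := by exact_mod_cast hN1
  -- Bielecki weight, growing to the left because the integration runs backward from `T`. The rate
  -- `4 * N` makes the part of `q` below `N` contribute at most `θ t / 4`; the excess, of integral
  -- at most `1 / 4`, contributes another `θ t / 4`. Dividing the unknown by `θ` thus gives the
  -- contraction factor `1 / 2` on the whole interval.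
  set θ : ℝ → ℝ := fun s ↦ Real.exp (4 * N * (T - s)) with hθ
  have hθc : Continuous θ := by fun_prop
  have hθ0 : ∀ s, 0 < θ s := fun s ↦ Real.exp_pos _
  have hθ1 : ∀ s ≤ T, 1 ≤ θ s := fun s hs ↦
    Real.one_le_exp (mul_nonneg (by linarith) (by linarith))
  have hp : Integrable (fun s ↦ max (q s - N) 0) := by
    refine hqi.mono' ((hqi.aestronglyMeasurable.sub aestronglyMeasurable_const).sup
        aestronglyMeasurable_const) (Eventually.of_forall fun s ↦ ?_)
    rw [Real.norm_of_nonneg (le_max_right _ _)]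
    exact max_le (by linarith) (hq0 s)
  have hkey : ∀ t ≤ T, ∫ s in t..T, q s * θ s ≤ θ t / 2 := by
    intro t ht
    have e1 : ∫ s in t..T, (N : ℝ) * θ s = (θ t - 1) / 4 := by
      have : ∀ s ∈ uIcc t T, HasDerivAt (fun s ↦ -(1 / 4) * θ s) (N * θ s) s := by
        intro s _
        have h1 : HasDerivAt (fun s : ℝ ↦ 4 * N * (T - s)) (4 * N * (-1)) s := by
          simpa using (((hasDerivAt_id s).const_sub T).const_mul (4 * (N : ℝ)))
        have h2 := (h1.exp.const_mul (-(1 / 4) : ℝ))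
        refine h2.congr_deriv ?_
        change -(1 / 4) * (θ s * (4 * N * (-1))) = N * θ s
        ring
      rw [intervalIntegral.integral_eq_sub_of_hasDerivAt this
        ((continuous_const.mul hθc).intervalIntegrable _ _)]
      simp [hθ]; ring
    have e2 : ∫ s in t..T, q s * θ s ≤
        ∫ s in t..T, ((N : ℝ) * θ s + θ t * max (q s - N) 0) := by
      refine intervalIntegral.integral_mono_on ht
        (hqi.intervalIntegrable.mul_continuousOn hθc.continuousOn)
        (((continuous_const.mul hθc).intervalIntegrable _ _).add
          (hp.intervalIntegrable.const_mul _)) fun s hs ↦ ?_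
      have h1 : θ s ≤ θ t := Real.exp_le_exp.2 (by
        have := hs.1; nlinarith)
      have h2 : q s ≤ N + max (q s - N) 0 := by linarith [le_max_left (q s - N) 0]
      calc q s * θ s ≤ (N + max (q s - N) 0) * θ s := by gcongr
        _ = N * θ s + θ s * max (q s - N) 0 := by ring
        _ ≤ _ := by gcongr
    have e3 : ∫ s in t..T, max (q s - N) 0 ≤ 1 / 4 := by
      refine le_trans ?_ hN
      rw [intervalIntegral.integral_of_le ht]
      exact setIntegral_le_integral hp (Eventually.of_forall fun s ↦ le_max_right _ _)
    have e4 : IntervalIntegrable (fun s ↦ (N : ℝ) * θ s) volume t T :=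
      (continuous_const.mul hθc).intervalIntegrable _ _
    rw [intervalIntegral.integral_add e4
      (hp.intervalIntegrable.const_mul _), e1, intervalIntegral.integral_const_mul] at e2
    nlinarith [hθ0 t]
  have hint : ∀ v : ι → ℝ → ℂ, (∀ i, Continuous (v i)) → ∀ i, Integrable
      (fun s ↦ ∑ j, A' i j s * (((θ s : ℝ) : ℂ) * v j s)) := by
    intro v hv i
    refine integrable_finsetSum _ fun j _ ↦ ?_
    have h1 : IntegrableOn (fun s ↦ A i j s * (((θ s : ℝ) : ℂ) * v j s)) (Icc t₀ T) :=
      (hA i j).mul_continuousOn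
        ((Complex.continuous_ofReal.comp hθc).mul (hv j)).continuousOn isCompact_Icc
    rw [← integrable_indicator_iff measurableSet_Icc] at h1
    refine h1.congr (Eventually.of_forall fun s ↦ ?_)
    by_cases hs : s ∈ Icc t₀ T <;> simp [hA', hs]
  have hest : ∀ v : ι → ℝ → ℂ, (∀ i, Continuous (v i)) → ∀ D : ℝ, 0 ≤ D →
      (∀ i t, ‖v i t‖ ≤ D) → ∀ i, ∀ t ≤ T,
      ‖∫ s in T..t, ∑ j, A' i j s * (((θ s : ℝ) : ℂ) * v j s)‖ ≤ θ t * (D / 2) := by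
    intro v hv D hD hvD i t ht
    rw [intervalIntegral.integral_symm, norm_neg]
    have h1 : ‖∫ s in t..T, ∑ j, A' i j s * (((θ s : ℝ) : ℂ) * v j s)‖ ≤
        ∫ s in t..T, D * (q s * θ s) := by
      refine intervalIntegral.norm_integral_le_of_norm_le ht
        (Eventually.of_forall fun s _ ↦ ?_)
        ((hqi.intervalIntegrable.mul_continuousOn hθc.continuousOn).const_mul D)
      refine (norm_sum_le _ _).trans ?_
      have h2 : ∀ j, ‖A' i j s * (((θ s : ℝ) : ℂ) * v j s)‖ ≤ ‖A' i j s‖ * (θ s * D) := by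
        intro j
        rw [norm_mul, norm_mul, Complex.norm_real, Real.norm_of_nonneg (hθ0 s).le]
        have := hvD j s
        have := (hθ0 s).le
        gcongr
      refine (Finset.sum_le_sum fun j _ ↦ h2 j).trans ?_
      rw [← Finset.sum_mul]
      have h3 : ∑ j, ‖A' i j s‖ ≤ q s :=
        Finset.single_le_sum (f := fun i ↦ ∑ j, ‖A' i j s‖)
          (fun i _ ↦ Finset.sum_nonneg fun j _ ↦ norm_nonneg _) (Finset.mem_univ i)
      calc (∑ j, ‖A' i j s‖) * (θ s * D) ≤ q s * (θ s * D) :=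
            mul_le_mul_of_nonneg_right h3 (mul_nonneg (hθ0 s).le hD)
        _ = D * (q s * θ s) := by ring
    refine h1.trans ?_
    rw [intervalIntegral.integral_const_mul]
    nlinarith [hkey t ht]
  -- The unknown is `v = X / θ`. Truncation at `min t T`, and the cut-off of the coefficients
  -- outside `[t₀, T]`, keep it bounded and continuous on all of `ℝ`.
  set Φ : (ι → ℝ → ℂ) → ι → ℝ → ℂ := fun v i t ↦
    ((θ (min t T) : ℝ) : ℂ)⁻¹ *
      (b i + ∫ s in T..min t T, ∑ j, A' i j s * (((θ s : ℝ) : ℂ) * v j s)) with hΦ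
  have hθn : ∀ t, ‖((θ t : ℝ) : ℂ)⁻¹‖ = (θ t)⁻¹ := fun t ↦ by
    rw [norm_inv, Complex.norm_real, Real.norm_of_nonneg (hθ0 t).le]
  -- Then `‖b i‖ ≤ R / 2`, while the integral term adds at most `R / 2` after division by `θ ≥ 1`.
  set R : ℝ := 2 * ∑ i, ‖b i‖ with hR
  have hR0 : 0 ≤ R := by positivity
  obtain ⟨v, hvc, hvR, hfix⟩ := exists_fixedPoint_of_bounds (R := R) hR0 Φ
    (by
      intro v hv _ i
      have h1 : Continuous fun t ↦ ∫ s in T..t, ∑ j, A' i j s * (((θ s : ℝ) : ℂ) * v j s) :=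
        intervalIntegral.continuous_primitive (fun _ _ ↦ (hint v hv i).intervalIntegrable) _
      refine Continuous.mul (Continuous.inv₀ ?_ fun t ↦ ?_) (continuous_const.add ?_)
      · exact Complex.continuous_ofReal.comp (hθc.comp (by fun_prop))
      · exact_mod_cast (hθ0 _).ne'
      · exact h1.comp (by fun_prop : Continuous fun t : ℝ ↦ min t T))
    (by
      intro v hv hvR i t
      have h1 := hest v hv R hR0 hvR i (min t T) (min_le_right _ _)
      have h2 := hθ1 (min t T) (min_le_right _ _)
      have h3 : ‖b i‖ ≤ R / 2 := by
        rw [hR]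
        have := Finset.single_le_sum (f := fun i ↦ ‖b i‖) (fun i _ ↦ norm_nonneg _)
          (Finset.mem_univ i)
        linarith
      simp only [hΦ, norm_mul, hθn]
      rw [inv_mul_le_iff₀ (hθ0 _)]
      refine (norm_add_le _ _).trans ?_
      nlinarith)
    (by
      intro v v' hv _ hv' _ D hD hvv i t
      have h1 := hest (fun i t ↦ v i t - v' i t) (fun i ↦ (hv i).sub (hv' i)) D hD hvv i
        (min t T) (min_le_right _ _)
      have h2 : Φ v i t - Φ v' i t = ((θ (min t T) : ℝ) : ℂ)⁻¹ *
          ∫ s in T..min t T, ∑ j, A' i j s * (((θ s : ℝ) : ℂ) * (v j s - v' j s)) := by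
        simp only [hΦ]
        rw [← mul_sub, add_sub_add_left_eq_sub, ← intervalIntegral.integral_sub
          (hint v hv i).intervalIntegrable (hint v' hv' i).intervalIntegrable]
        congr 2
        funext s
        rw [← Finset.sum_sub_distrib]
        exact Finset.sum_congr rfl fun j _ ↦ by ring
      rw [h2, norm_mul, hθn, inv_mul_le_iff₀ (hθ0 _)]
      exact h1)
  refine ⟨fun i t ↦ ((θ t : ℝ) : ℂ) * v i t,
    fun i ↦ (Complex.continuous_ofReal.comp hθc).mul (hvc i), fun i t ht ↦ ?_⟩
  have h1 : v i t = Φ v i t := by rw [hfix]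
  have hne : ((θ t : ℝ) : ℂ) ≠ 0 := by exact_mod_cast (hθ0 t).ne'
  simp only [hΦ, min_eq_left ht.2] at h1
  change ((θ t : ℝ) : ℂ) * v i t = _
  rw [h1, mul_inv_cancel_left₀ hne]
  congr 1
  refine intervalIntegral.integral_congr fun s hs ↦ ?_
  rw [uIcc_of_ge ht.2] at hs
  have : s ∈ Icc t₀ T := ⟨ht.1.trans hs.1, hs.2⟩
  simp [hA', this]


/-! ### Lagrange identities for the partial fractions. -/

-- The sum is the top coefficient of the Lagrange interpolant of `X ^ k` at the nodes `γ_j`. It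
-- makes the forcing term drop out of the derivatives of `z` up to order `m - 1` and enter the one
-- of order `m` with coefficient `-1`.
open Polynomial in
theorem sum_pow_div_Gam {m : ℕ} {γ : Fin m → ℂ} (hγ : Function.Injective γ) {k : ℕ} (hk : k < m) :
    ∑ j, γ j ^ k / Gam γ j = if k + 1 = m then 1 else 0 := by
  have h := Lagrange.coeff_eq_sum (s := Finset.univ) (v := γ) hγ.injOn
    (P := (X ^ k : ℂ[X])) (by rw [degree_X_pow]; simpa using hk)
  simp only [eval_pow, eval_X, coeff_X_pow, Finset.card_univ, Fintype.card_fin] at h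
  rw [show (∑ j, γ j ^ k / Gam γ j) = ∑ i, γ i ^ k / ∏ j ∈ Finset.univ.erase i, (γ i - γ j)
    from rfl, ← h]
  exact if_congr (by omega) rfl rfl

/-- The interpolant of the constant `1`, evaluated at `0`. This is the coefficient of `∫ P(r; λ)` in
the exponent of `y`. -/
theorem sum_inv_Gam_mul {m : ℕ} (hm : 1 ≤ m) {γ : Fin m → ℂ} (hγ : Function.Injective γ)
    (h0 : ∀ j, γ j ≠ 0) :
    ∑ j, 1 / (Gam γ j * γ j) = (-1) ^ (m + 1) * ∏ k, (γ k)⁻¹ := by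
  have : Nonempty (Fin m) := ⟨⟨0, hm⟩⟩
  have h := Lagrange.eval_interpolate_not_at_node (s := Finset.univ) (v := γ)
    (x := 0) 1 fun i _ ↦ (h0 i).symm
  rw [Lagrange.interpolate_one hγ.injOn Finset.univ_nonempty, Polynomial.eval_one,
    Lagrange.eval_nodal] at h
  have h1 : ∀ j, Lagrange.nodalWeight Finset.univ γ j * (0 - γ j)⁻¹ * (1 : Fin m → ℂ) j =
      -(1 / (Gam γ j * γ j)) := by
    intro j
    rw [Lagrange.nodalWeight, Finset.prod_inv_distrib, Gam, Pi.one_apply, zero_sub, inv_neg,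
      one_div, mul_inv]
    ring
  rw [Finset.sum_congr rfl fun j _ ↦ h1 j, Finset.sum_neg_distrib] at h
  simp only [zero_sub] at h
  rw [Finset.prod_neg] at h
  simp only [Finset.card_univ, Fintype.card_fin] at h
  have h2 : (∏ k, γ k) ≠ 0 := Finset.prod_ne_zero_iff.2 fun j _ ↦ h0 j
  rw [Finset.prod_inv_distrib, ← div_eq_mul_inv, eq_div_iff h2]
  have h3 : ((-1 : ℂ) ^ m) * (-1) ^ m = 1 := by rw [← mul_pow]; simp
  linear_combination (-1) ^ m * h - (∏ k, γ k) * (∑ j, 1 / (Gam γ j * γ j)) * h3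

/-! ### Bell polynomials: algebra, derivatives, limits, Lipschitz bounds. -/

/-- `∑_m (i choose m) lam ^ (i - m) B_m(x)`, which is `y^(i) / y` when `y' / y = lam + x₀`. -/
noncomputable def shiftBell (lam : ℂ) (x : ℕ → ℂ) (i : ℕ) : ℂ :=
  ∑ m ∈ Finset.range (i + 1), (i.choose m : ℂ) * (completeBell x m * lam ^ (i - m))

theorem completeBell_zero (x : ℕ → ℂ) : completeBell x 0 = 1 := by rw [completeBell]

theorem completeBell_succ (x : ℕ → ℂ) (i : ℕ) : completeBell x (i + 1) =
    ∑ j ∈ Finset.range (i + 1), (i.choose j : ℂ) * (x j * completeBell x (i - j)) := by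
  rw [completeBell, Finset.sum_range]
  exact Finset.sum_congr rfl fun j _ ↦ by ring

theorem completeBell_congr {x x' : ℕ → ℂ} {i : ℕ} (h : ∀ k < i, x k = x' k) :
    completeBell x i = completeBell x' i := by
  induction i using Nat.strong_induction_on with
  | _ i ih =>
    cases i with
    | zero => simp [completeBell_zero]
    | succ i =>
      rw [completeBell_succ, completeBell_succ]
      refine Finset.sum_congr rfl fun j hj ↦ ?_
      have hj' := Finset.mem_range.1 hj
      rw [h j hj', ih (i - j) (by omega) fun k hk ↦ h k (by omega)]

/-- In every remaining term the Bell factor has index `i - j ≥ 1` and so vanishes at zero: the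
difference is at least quadratic, and free of `x i`. -/
theorem completeBell_succ_sub (x : ℕ → ℂ) (i : ℕ) : completeBell x (i + 1) - x i =
    ∑ j ∈ Finset.range i, (i.choose j : ℂ) * (x j * completeBell x (i - j)) := by
  rw [completeBell_succ, Finset.sum_range_succ]
  simp [completeBell_zero]

theorem shiftBell_zero (lam : ℂ) (x : ℕ → ℂ) : shiftBell lam x 0 = 1 := by
  simp [shiftBell, completeBell_zero]

theorem shiftBell_succ (lam : ℂ) (x : ℕ → ℂ) (i : ℕ) :
    shiftBell lam x (i + 1) = lam * shiftBell lam x i +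
      ∑ m ∈ Finset.range (i + 1), (i.choose m : ℂ) * (completeBell x (m + 1) * lam ^ (i - m)) := by
  have h := Finset.sum_choose_succ_mul (fun m k ↦ completeBell x m * lam ^ k) i
  rw [shiftBell, h, shiftBell, Finset.mul_sum]
  congr 1
  · refine Finset.sum_congr rfl fun m hm ↦ ?_
    have := Finset.mem_range.1 hm
    rw [show i + 1 - m = i - m + 1 by omega, pow_succ]; ring

/-- Behind it is `B_i(z, z', …) = e^{-∫z} (e^{∫z})^(i)`, which differentiates to `B_{i+1} - z B_i`.
The proof works from the recursion and Pascal's rule. -/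
theorem hasDerivAt_completeBell {x : ℕ → ℝ → ℂ} {t : ℝ} {i : ℕ}
    (h : ∀ k < i, HasDerivAt (x k) (x (k + 1) t) t) :
    HasDerivAt (fun s ↦ completeBell (fun k ↦ x k s) i)
      (completeBell (fun k ↦ x k t) (i + 1) - x 0 t * completeBell (fun k ↦ x k t) i) t := by
  induction i using Nat.strong_induction_on with
  | _ i ih =>
    cases i with
    | zero =>
      simp only [completeBell_zero, completeBell_succ]
      simpa [completeBell_zero] using hasDerivAt_const t (1 : ℂ)
    | succ i =>
      have h1 : HasDerivAt (fun s ↦ completeBell (fun k ↦ x k s) (i + 1))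
          (∑ j ∈ Finset.range (i + 1), (i.choose j : ℂ) *
            (x (j + 1) t * completeBell (fun k ↦ x k t) (i - j) +
              x j t * (completeBell (fun k ↦ x k t) (i - j + 1) -
                x 0 t * completeBell (fun k ↦ x k t) (i - j)))) t := by
        simp only [completeBell_succ _ i]
        refine HasDerivAt.fun_sum fun j hj ↦ ?_
        have hj' := Finset.mem_range.1 hj
        exact ((h j hj').mul (ih (i - j) (by omega) fun k hk ↦ h k (by omega))).const_mul _
      refine h1.congr_deriv ?_
      have h2 := Finset.sum_choose_succ_mul
        (fun j k ↦ x j t * completeBell (fun k ↦ x k t) k) i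
      rw [completeBell_succ _ (i + 1), h2, completeBell_succ _ i, Finset.mul_sum,
        ← Finset.sum_add_distrib, ← Finset.sum_sub_distrib]
      refine Finset.sum_congr rfl fun j hj ↦ ?_
      have := Finset.mem_range.1 hj
      rw [show i + 1 - j = i - j + 1 by omega]
      ring

/-- The subtracted term is the one cancelled by the factor `exp ∫ (λ + z)`: the product of this
factor with `shiftBell i` has as derivative its product with `shiftBell (i + 1)`. -/
theorem hasDerivAt_shiftBell {lam : ℂ} {x : ℕ → ℝ → ℂ} {t : ℝ} {i : ℕ}
    (h : ∀ k < i, HasDerivAt (x k) (x (k + 1) t) t) :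
    HasDerivAt (fun s ↦ shiftBell lam (fun k ↦ x k s) i)
      (shiftBell lam (fun k ↦ x k t) (i + 1) -
        (lam + x 0 t) * shiftBell lam (fun k ↦ x k t) i) t := by
  have h1 : HasDerivAt (fun s ↦ shiftBell lam (fun k ↦ x k s) i)
      (∑ m ∈ Finset.range (i + 1), (i.choose m : ℂ) *
        ((completeBell (fun k ↦ x k t) (m + 1) - x 0 t * completeBell (fun k ↦ x k t) m) *
          lam ^ (i - m))) t := by
    refine HasDerivAt.fun_sum fun m hm ↦ ?_
    have := Finset.mem_range.1 hm
    exact ((hasDerivAt_completeBell fun k hk ↦ h k (by omega)).mul_const _).const_mul _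
  refine h1.congr_deriv ?_
  rw [shiftBell_succ, add_mul, add_sub_add_left_eq_sub, shiftBell, Finset.mul_sum,
    ← Finset.sum_sub_distrib]
  exact Finset.sum_congr rfl fun m _ ↦ by ring

theorem AbsolutelyContinuousOnInterval.sum' {ι : Type*} (s : Finset ι) {f : ι → ℝ → ℂ} {a b : ℝ}
    (h : ∀ i ∈ s, AbsolutelyContinuousOnInterval (f i) a b) :
    AbsolutelyContinuousOnInterval (fun t ↦ ∑ i ∈ s, f i t) a b := by
  classical
  induction s using Finset.induction_on with
  | empty =>
    simpa using (contDiff_const (n := 1) (c := (0 : ℂ))).contDiffOn.absolutelyContinuousOnInterval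
  | insert i s hi ih =>
    simp only [Finset.sum_insert hi]
    exact (h i (Finset.mem_insert_self _ _)).fun_add
      (ih fun j hj ↦ h j (Finset.mem_insert_of_mem hj))

theorem absolutelyContinuous_completeBell {x : ℕ → ℝ → ℂ} {a b : ℝ} {i : ℕ}
    (h : ∀ k < i, AbsolutelyContinuousOnInterval (x k) a b) :
    AbsolutelyContinuousOnInterval (fun s ↦ completeBell (fun k ↦ x k s) i) a b := by
  induction i using Nat.strong_induction_on with
  | _ i ih =>
    cases i with
    | zero =>
      simp only [completeBell_zero]
      exact (contDiff_const (n := 1)).contDiffOn.absolutelyContinuousOnInterval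
    | succ i =>
      simp only [completeBell_succ _ i]
      refine AbsolutelyContinuousOnInterval.sum' _ fun j hj ↦ ?_
      have hj' := Finset.mem_range.1 hj
      have h1 := ih (i - j) (by omega) fun k hk ↦ h k (by omega)
      have h2 := ((h j hj').fun_smul h1).const_smul (i.choose j : ℂ)
      simpa only [smul_eq_mul] using h2

theorem absolutelyContinuous_shiftBell {lam : ℂ} {x : ℕ → ℝ → ℂ} {a b : ℝ} {i : ℕ}
    (h : ∀ k < i, AbsolutelyContinuousOnInterval (x k) a b) :
    AbsolutelyContinuousOnInterval (fun s ↦ shiftBell lam (fun k ↦ x k s) i) a b := by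
  refine AbsolutelyContinuousOnInterval.sum' _ fun m hm ↦ ?_
  have := Finset.mem_range.1 hm
  have h0 := absolutelyContinuous_completeBell (x := x) (i := m) (a := a) (b := b)
    fun k hk ↦ h k (by omega)
  have h1 := h0.const_smul ((i.choose m : ℂ) * lam ^ (i - m))
  refine AbsolutelyContinuousOnInterval.congr' h1 fun t _ ↦ ?_
  simp only [smul_eq_mul]; ring

/-- The filter is arbitrary because the statement serves continuity, continuity within `[T, ∞)` and
the limit at infinity. -/
theorem tendsto_completeBell {α : Type*} {l : Filter α} {x : ℕ → α → ℂ} {x₀ : ℕ → ℂ} {i : ℕ}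
    (h : ∀ k < i, Tendsto (x k) l (𝓝 (x₀ k))) :
    Tendsto (fun t ↦ completeBell (fun k ↦ x k t) i) l (𝓝 (completeBell x₀ i)) := by
  induction i using Nat.strong_induction_on with
  | _ i ih =>
    cases i with
    | zero => simpa only [completeBell_zero] using tendsto_const_nhds
    | succ i =>
      simp only [completeBell_succ _ i]
      refine tendsto_finsetSum _ fun j hj ↦ ?_
      have hj' := Finset.mem_range.1 hj
      exact ((h j hj').mul
        (ih (i - j) (by omega) fun k hk ↦ h k (by omega))).const_mul _

theorem tendsto_shiftBell {α : Type*} {l : Filter α} {lam : ℂ} {x : ℕ → α → ℂ} {x₀ : ℕ → ℂ}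
    {i : ℕ} (h : ∀ k < i, Tendsto (x k) l (𝓝 (x₀ k))) :
    Tendsto (fun t ↦ shiftBell lam (fun k ↦ x k t) i) l (𝓝 (shiftBell lam x₀ i)) := by
  refine tendsto_finsetSum _ fun m hm ↦ ?_
  have := Finset.mem_range.1 hm
  exact ((tendsto_completeBell fun k hk ↦ h k (by omega)).mul_const _).const_mul _

theorem completeBell_const_zero {k : ℕ} (hk : k ≠ 0) : completeBell (fun _ ↦ 0) k = 0 := by
  obtain ⟨k, rfl⟩ := Nat.exists_eq_succ_of_ne_zero hk
  rw [Nat.succ_eq_add_one, completeBell_succ]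
  simp

theorem shiftBell_const_zero (lam : ℂ) (i : ℕ) : shiftBell lam (fun _ ↦ 0) i = lam ^ i := by
  rw [shiftBell, Finset.sum_eq_single 0]
  · simp [completeBell_zero]
  · intro m _ hm
    rw [completeBell_const_zero hm]; simp
  · simp

theorem shiftBell_one (lam : ℂ) (x : ℕ → ℂ) : shiftBell lam x 1 = lam + x 0 := by
  have h := shiftBell_succ lam x 0
  simpa [shiftBell_zero, completeBell_succ, completeBell_zero] using h

theorem exists_completeBell_lipschitz (N : ℕ) : ∃ C : ℝ, 1 ≤ C ∧ ∀ i ≤ N, ∀ (x x' : ℕ → ℂ) (d : ℝ),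
    (∀ k < i, ‖x k‖ ≤ 1) → (∀ k < i, ‖x' k‖ ≤ 1) → (∀ k < i, ‖x k - x' k‖ ≤ d) → 0 ≤ d →
    ‖completeBell x i‖ ≤ C ∧ ‖completeBell x i - completeBell x' i‖ ≤ C * d := by
  induction N with
  | zero =>
    refine ⟨1, le_rfl, fun i hi x x' d _ _ _ hd ↦ ?_⟩
    obtain rfl : i = 0 := by omega
    simpa [completeBell_zero] using hd
  | succ N ih =>
    obtain ⟨C, hC1, hC⟩ := ih
    set S : ℝ := ∑ j ∈ Finset.range (N + 1), (N.choose j : ℝ) with hS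
    have hS0 : 0 ≤ S := Finset.sum_nonneg fun j _ ↦ by positivity
    refine ⟨C + 2 * S * C, by nlinarith [mul_nonneg hS0 (by linarith : (0 : ℝ) ≤ C)],
      fun i hi x x' d hx hx' hxx hd ↦ ?_⟩
    have hSC : 0 ≤ S * C := mul_nonneg hS0 (by linarith)
    rcases Nat.lt_or_ge N i with hiN | hiN
    · obtain rfl : i = N + 1 := by omega
      rw [completeBell_succ, completeBell_succ, ← Finset.sum_sub_distrib]
      have hb := fun j (hj : j ∈ Finset.range (N + 1)) ↦
        hC (N - j) (by omega) x x' d (fun k hk ↦ hx k (by omega)) (fun k hk ↦ hx' k (by omega))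
          (fun k hk ↦ hxx k (by omega)) hd
      constructor
      · calc _ ≤ ∑ j ∈ Finset.range (N + 1), (N.choose j : ℝ) * C := by
              refine norm_sum_le_of_le _ fun j hj ↦ ?_
              have := Finset.mem_range.1 hj
              rw [norm_mul, norm_mul, Complex.norm_natCast]
              refine mul_le_mul_of_nonneg_left ?_ (by positivity)
              calc _ ≤ 1 * C := mul_le_mul (hx j this) (hb j hj).1 (norm_nonneg _) zero_le_one
                _ = C := one_mul C
          _ = S * C := by rw [← Finset.sum_mul]
          _ ≤ _ := by nlinarith
      · calc _ ≤ ∑ j ∈ Finset.range (N + 1), (N.choose j : ℝ) * (2 * C * d) := by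
              refine norm_sum_le_of_le _ fun j hj ↦ ?_
              have := Finset.mem_range.1 hj
              rw [← mul_sub, norm_mul, Complex.norm_natCast]
              refine mul_le_mul_of_nonneg_left ?_ (by positivity)
              have h1 : x j * completeBell x (N - j) - x' j * completeBell x' (N - j) =
                  (x j - x' j) * completeBell x (N - j) +
                    x' j * (completeBell x (N - j) - completeBell x' (N - j)) := by ring
              rw [h1]
              refine (norm_add_le _ _).trans ?_
              rw [norm_mul, norm_mul]
              have e1 := mul_le_mul (hxx j this) (hb j hj).1 (norm_nonneg _) hd
              have e2 := mul_le_mul (hx' j this) (hb j hj).2 (norm_nonneg _) zero_le_one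
              linarith
          _ = S * (2 * C * d) := by rw [← Finset.sum_mul]
          _ ≤ _ := by nlinarith [mul_nonneg (by linarith : (0 : ℝ) ≤ C) hd]
    · obtain ⟨h1, h2⟩ := hC i hiN x x' d hx hx' hxx hd
      exact ⟨by nlinarith, by nlinarith [mul_nonneg hSC hd]⟩

/-- Both factors of each summand `x j * B_{i-j}` are `O(μ)`. Changing one factor at a time costs `d`
and leaves the other, whence the gain `μ` that makes the nonlinear term contractive for small data.
-/
theorem exists_completeBell_sub_lipschitz (N : ℕ) : ∃ C : ℝ, 1 ≤ C ∧ ∀ i < N,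
    ∀ (x x' : ℕ → ℂ) (μ d : ℝ), μ ≤ 1 →
    (∀ k < i, ‖x k‖ ≤ μ) → (∀ k < i, ‖x' k‖ ≤ μ) → (∀ k < i, ‖x k - x' k‖ ≤ d) → 0 ≤ d → 0 ≤ μ →
    ‖(completeBell x (i + 1) - x i) - (completeBell x' (i + 1) - x' i)‖ ≤ C * (μ * d) := by
  obtain ⟨C, hC1, hC⟩ := exists_completeBell_lipschitz N
  set S : ℝ := ∑ i ∈ Finset.range N, ∑ j ∈ Finset.range i, (i.choose j : ℝ) with hS
  have hS0 : 0 ≤ S := Finset.sum_nonneg fun i _ ↦ Finset.sum_nonneg fun j _ ↦ by positivity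
  refine ⟨1 + S * (2 * C), by nlinarith [mul_nonneg hS0 (by linarith : (0 : ℝ) ≤ C)],
    fun i hi x x' μ d hμ hx hx' hxx hd hμ0 ↦ ?_⟩
  rw [completeBell_succ_sub, completeBell_succ_sub, ← Finset.sum_sub_distrib]
  have hb := fun j (hj : j ∈ Finset.range i) ↦
    hC (i - j) (by omega) x x' d (fun k hk ↦ (hx k (by omega)).trans hμ)
      (fun k hk ↦ (hx' k (by omega)).trans hμ) (fun k hk ↦ hxx k (by omega)) hd
  -- Smallness of the Bell factor is its Lipschitz bound against the zero jet, with `d = μ`.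
  have hb0 : ∀ j ∈ Finset.range i, ‖completeBell x (i - j)‖ ≤ C * μ := by
    intro j hj
    have h1 := (hC (i - j) (by omega) x (fun _ ↦ 0) μ (fun k hk ↦ (hx k (by omega)).trans hμ)
      (fun k hk ↦ by simp) (fun k hk ↦ by simpa using hx k (by omega)) hμ0).2
    rwa [completeBell_const_zero (by have := Finset.mem_range.1 hj; omega), sub_zero] at h1
  calc _ ≤ ∑ j ∈ Finset.range i, (i.choose j : ℝ) * (2 * C * (μ * d)) := by
        refine norm_sum_le_of_le _ fun j hj ↦ ?_
        have := Finset.mem_range.1 hj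
        rw [← mul_sub, norm_mul, Complex.norm_natCast]
        refine mul_le_mul_of_nonneg_left ?_ (by positivity)
        have h1 : x j * completeBell x (i - j) - x' j * completeBell x' (i - j) =
            (x j - x' j) * completeBell x (i - j) +
              x' j * (completeBell x (i - j) - completeBell x' (i - j)) := by ring
        rw [h1]
        refine (norm_add_le _ _).trans ?_
        rw [norm_mul, norm_mul]
        have e1 := mul_le_mul (hxx j this) (hb0 j hj) (norm_nonneg _) hd
        have e2 := mul_le_mul (hx' j this) (hb j hj).2 (norm_nonneg _) hμ0
        linarith
    _ = (∑ j ∈ Finset.range i, (i.choose j : ℝ)) * (2 * C * (μ * d)) := by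
        rw [← Finset.sum_mul]
    _ ≤ S * (2 * C * (μ * d)) := by
        refine mul_le_mul_of_nonneg_right ?_
          (mul_nonneg (by linarith) (mul_nonneg hμ0 hd))
        exact Finset.single_le_sum (f := fun i ↦ ∑ j ∈ Finset.range i, (i.choose j : ℝ))
          (fun i _ ↦ Finset.sum_nonneg fun j _ ↦ by positivity) (Finset.mem_range.2 hi)
    _ ≤ _ := by nlinarith [mul_nonneg hμ0 hd]


/-! ### Expansion at `λ` and the equation for `z`. -/

open Polynomial in
theorem taylor_coeff_eq_sum {p : ℂ[X]} {n : ℕ} (hp : p.natDegree ≤ n) (lam : ℂ) (m : ℕ) :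
    (taylor lam p).coeff m =
      ∑ i ∈ Finset.range (n + 1), p.coeff i * ((i.choose m : ℂ) * lam ^ (i - m)) := by
  rw [taylor_coeff, hasseDeriv_apply, sum_over_range' _ (by simp) (n + 1) (by omega),
    eval_finsetSum]
  refine Finset.sum_congr rfl fun i _ ↦ ?_
  rw [eval_monomial]; ring

/-- Exchange of the two sums: conjugating a differential operator by `e^{λt}` shifts its symbol by
`λ`. -/
theorem sum_coeff_mul_shiftBell {p : Polynomial ℂ} {n : ℕ} (hp : p.natDegree ≤ n) (lam : ℂ)
    (x : ℕ → ℂ) : ∑ i ∈ Finset.range (n + 1), p.coeff i * shiftBell lam x i =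
      ∑ m ∈ Finset.range (n + 1), (p.taylor lam).coeff m * completeBell x m := by
  have h1 : ∀ i ∈ Finset.range (n + 1), shiftBell lam x i =
      ∑ m ∈ Finset.range (n + 1), (i.choose m : ℂ) * (completeBell x m * lam ^ (i - m)) := by
    intro i hi
    have := Finset.mem_range.1 hi
    refine Finset.sum_subset (Finset.range_mono (by omega)) fun m _ hm ↦ ?_
    have hm' : i < m := by
      by_contra h
      exact hm (Finset.mem_range.2 (by omega))
    rw [Nat.choose_eq_zero_of_lt hm']
    simp
  rw [Finset.sum_congr rfl fun i hi ↦ by rw [h1 i hi]]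
  simp only [taylor_coeff_eq_sum hp, Finset.mul_sum, Finset.sum_mul]
  rw [Finset.sum_comm]
  exact Finset.sum_congr rfl fun m _ ↦ Finset.sum_congr rfl fun i _ ↦ by ring

open Polynomial in
theorem pertPoly_coeff {n : ℕ} (r : Fin n → ℝ → ℂ) (t : ℝ) (k : ℕ) :
    (pertPoly r t).coeff k = if h : k < n then r ⟨k, h⟩ t else 0 := by
  simp only [pertPoly, finsetSum_coeff, coeff_C_mul, coeff_X_pow]
  split_ifs with h
  · rw [Finset.sum_eq_single ⟨k, h⟩]
    · simp
    · intro b _ hb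
      rw [if_neg fun hk ↦ hb (Fin.ext hk.symm), mul_zero]
    · simp
  · refine Finset.sum_eq_zero fun i _ ↦ ?_
    rw [if_neg (by omega), mul_zero]

open Polynomial in
theorem charPoly_coeff {n : ℕ} (a : Fin n → ℂ) (k : ℕ) (hk : k ≤ n) :
    (charPoly a).coeff k = if h : k < n then a ⟨k, h⟩ else 1 := by
  have h1 := pertPoly_coeff (fun i _ ↦ a i) 0 k
  rw [charPoly, coeff_add]
  rw [pertPoly] at h1
  rw [h1, coeff_X_pow]
  split_ifs <;> first | omega | simp

open Polynomial in
theorem natDegree_pertPoly_le {n : ℕ} (r : Fin n → ℝ → ℂ) (t : ℝ) :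
    (pertPoly r t).natDegree ≤ n :=
  natDegree_sum_le_of_forall_le _ _ fun i _ ↦
    (natDegree_C_mul_X_pow_le _ _).trans i.2.le

open Polynomial in
theorem natDegree_charPoly_le {n : ℕ} (a : Fin n → ℂ) : (charPoly a).natDegree ≤ n :=
  natDegree_add_le_of_degree_le (natDegree_X_pow_le n)
    (natDegree_pertPoly_le (fun i _ ↦ a i) 0)

theorem taylor_pertPoly_coeff {n : ℕ} (r : Fin n → ℝ → ℂ) (lam : ℂ) (t : ℝ) (k : ℕ) :
    ((pertPoly r t).taylor lam).coeff k = 1 / (k.factorial : ℂ) * pertDeriv r lam k t := by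
  rw [Polynomial.taylor_coeff, pertDeriv, ← Polynomial.factorial_smul_hasseDeriv]
  have : (k.factorial : ℂ) ≠ 0 := by exact_mod_cast k.factorial_ne_zero
  have h : (k.factorial • Polynomial.hasseDeriv (R := ℂ) k) (pertPoly r t) =
      k.factorial • Polynomial.hasseDeriv k (pertPoly r t) := rfl
  rw [h, Polynomial.eval_smul, nsmul_eq_mul]
  field_simp

/-- The perturbation has degree below `n`. With this harmless index available, all sums over Taylor
coefficients can run up to `n`. -/
theorem pertDeriv_self {n : ℕ} (r : Fin n → ℝ → ℂ) (lam : ℂ) (t : ℝ) :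
    pertDeriv r lam n t = 0 := by
  have h := taylor_pertPoly_coeff r lam t n
  have hn : (n.factorial : ℂ) ≠ 0 := by exact_mod_cast n.factorial_ne_zero
  have h1 : ((pertPoly r t).taylor lam).coeff n = 0 := by
    rw [taylor_coeff_eq_sum (natDegree_pertPoly_le r t), Finset.sum_range_succ,
      pertPoly_coeff r t n, dif_neg (lt_irrefl n), zero_mul, add_zero]
    refine Finset.sum_eq_zero fun i hi ↦ ?_
    rw [Nat.choose_eq_zero_of_lt (Finset.mem_range.1 hi)]; simp
  rw [h1] at h
  field_simp at h
  simpa using h.symm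

/-- Taylor shift back by `-λ`. It transfers to the `r_i` the local integrability known for the
derivatives at `λ`. -/
theorem coeff_eq_sum_pertDeriv {n : ℕ} (r : Fin n → ℝ → ℂ) (lam : ℂ) (t : ℝ) (i : Fin n) :
    r i t = ∑ k ∈ Finset.range (n + 1),
      pertDeriv r lam k t * (1 / (k.factorial : ℂ) * ((k.choose i : ℂ) * (-lam) ^ (k - i))) := by
  have h1 := pertPoly_coeff r t i
  rw [dif_pos i.2] at h1
  rw [show r i t = (pertPoly r t).coeff i from h1.symm]
  have h2 : (pertPoly r t) = ((pertPoly r t).taylor lam).taylor (-lam) := by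
    rw [Polynomial.taylor_taylor]; simp
  conv_lhs => rw [h2]
  rw [taylor_coeff_eq_sum (n := n) (by
    rw [Polynomial.natDegree_taylor]; exact natDegree_pertPoly_le r t)]
  refine Finset.sum_congr rfl fun k _ ↦ ?_
  rw [taylor_pertPoly_coeff]; ring

/-- The inner sum over `j` is the `i`-th Taylor coefficient at `λ` of `P(a; ·) + P(r; ·)`. -/
theorem nonlinPart_eq {n : ℕ} (a : Fin n → ℂ) (r : Fin n → ℝ → ℂ) (lam : ℂ) (t : ℝ)
    (x : ℕ → ℂ) : nonlinPart a r lam t x = ∑ i ∈ Finset.Icc 2 n,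
      (((charPoly a).taylor lam).coeff i + 1 / (i.factorial : ℂ) * pertDeriv r lam i t) *
        (completeBell x i - x (i - 1)) := by
  refine Finset.sum_congr rfl fun i hi ↦ ?_
  have hin := (Finset.mem_Icc.1 hi).2
  rw [← taylor_pertPoly_coeff, taylor_coeff_eq_sum (natDegree_charPoly_le a),
    taylor_coeff_eq_sum (natDegree_pertPoly_le r t), ← Finset.sum_add_distrib, Finset.sum_mul]
  have h1 : ∑ k ∈ Finset.range (n + 1), ((charPoly a).coeff k * ((k.choose i : ℂ) * lam ^ (k - i)) +
      (pertPoly r t).coeff k * ((k.choose i : ℂ) * lam ^ (k - i))) *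
        (completeBell x i - x (i - 1)) =
      ∑ k ∈ Finset.Ico i (n + 1),
      ((charPoly a).coeff k * ((k.choose i : ℂ) * lam ^ (k - i)) +
      (pertPoly r t).coeff k * ((k.choose i : ℂ) * lam ^ (k - i))) *
        (completeBell x i - x (i - 1)) := by
    symm
    refine Finset.sum_subset (fun k hk ↦ ?_) fun k _ hk ↦ ?_
    · exact Finset.mem_range.2 (Finset.mem_Ico.1 hk).2
    · have : k < i := by
        by_contra h
        simp_all
      rw [Nat.choose_eq_zero_of_lt this]; simp
  rw [h1, Finset.sum_Ico_eq_sum_range, show n + 1 - i = n - i + 1 by omega]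
  refine Finset.sum_congr rfl fun j _ ↦ ?_
  rw [Nat.choose_symm_add, Nat.add_sub_cancel_left]; ring

open Polynomial in
theorem taylor_charPoly {n : ℕ} {a : Fin n → ℂ} {lam : ℂ} {lams : Fin (n - 1) → ℂ}
    (hroots : charPoly a = (X - C lam) * ∏ j, (X - C (lams j))) :
    (charPoly a).taylor lam = X * ∏ j, (X - C (lams j - lam)) := by
  rw [hroots]
  rw [taylor_mul]
  have h : ∀ c : ℂ, taylor lam (X - C c) = X - C (c - lam) := by
    intro c; rw [map_sub, taylor_X, taylor_C, C_sub]; ring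
  rw [h, sub_self, C_0, sub_zero]
  congr 1
  have := map_prod (taylorAlgHom lam : ℂ[X] →ₐ[ℂ] ℂ[X]) (fun j ↦ X - C (lams j)) Finset.univ
  simp only [taylorAlgHom_apply] at this
  rw [this]
  exact Finset.prod_congr rfl fun j _ ↦ h _

/-- The derivatives of `z = -∑ u_j / Γ_j` expressed through the `u_j`. -/
noncomputable def modeJet {m : ℕ} (γ : Fin m → ℂ) (u : Fin m → ℂ) (k : ℕ) : ℂ :=
  -∑ j, γ j ^ k / Gam γ j * u j

-- Each `γ_j` is a root of `∏ (X - γ_k)`, so the constant-coefficient operator annihilates every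
-- mode separately.
open Polynomial in
theorem sum_taylor_coeff_mul_modeJet {n : ℕ} (hn : 1 ≤ n) {a : Fin n → ℂ} {lam : ℂ}
    {lams : Fin (n - 1) → ℂ} (hroots : charPoly a = (X - C lam) * ∏ j, (X - C (lams j)))
    (u : Fin (n - 1) → ℂ) :
    ∑ m ∈ Finset.range n, ((charPoly a).taylor lam).coeff (m + 1) *
      modeJet (fun j ↦ lams j - lam) u m = 0 := by
  rw [taylor_charPoly hroots]
  set γ := fun j ↦ lams j - lam
  have h1 : ∀ j, ∑ m ∈ Finset.range n, (∏ j, (X - C (γ j))).coeff m * γ j ^ m = 0 := by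
    intro j
    have h2 : (∏ j, (X - C (γ j))).eval (γ j) = 0 := by
      rw [eval_prod]
      exact Finset.prod_eq_zero (Finset.mem_univ j) (by simp)
    rw [eval_eq_sum_range' (n := n)] at h2
    · exact h2
    · rw [natDegree_finsetProd_X_sub_C_eq_card]
      simp only [Finset.card_univ, Fintype.card_fin]; omega
  simp only [coeff_X_mul, modeJet, mul_neg, Finset.mul_sum, Finset.sum_neg_distrib]
  rw [Finset.sum_comm, neg_eq_zero]
  refine Finset.sum_eq_zero fun j _ ↦ ?_
  calc _ = (∑ m ∈ Finset.range n, (∏ j, (X - C (γ j))).coeff m * γ j ^ m) * (u j / Gam γ j) := by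
        rw [Finset.sum_mul]
        exact Finset.sum_congr rfl fun m _ ↦ by ring
    _ = 0 := by rw [h1, zero_mul]

open Polynomial in
theorem taylor_charPoly_coeff_self {n : ℕ} (hn : 1 ≤ n) {a : Fin n → ℂ} {lam : ℂ}
    {lams : Fin (n - 1) → ℂ} (hroots : charPoly a = (X - C lam) * ∏ j, (X - C (lams j))) :
    ((charPoly a).taylor lam).coeff n = 1 := by
  rw [taylor_charPoly hroots]
  obtain ⟨m, rfl⟩ : ∃ m, n = m + 1 := ⟨n - 1, by omega⟩
  rw [coeff_X_mul]
  have h := natDegree_finsetProd_X_sub_C_eq_card (Finset.univ : Finset (Fin (m + 1 - 1)))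
    (fun j ↦ lams j - lam)
  simp only [Finset.card_univ, Fintype.card_fin] at h
  have h2 := monic_prod_of_monic (Finset.univ : Finset (Fin (m + 1 - 1)))
    (fun j ↦ X - C (lams j - lam)) fun j _ ↦ monic_X_sub_C _
  rw [Monic, leadingCoeff, h] at h2
  exact h2

/-- The equation for `y`, divided by `y`, in terms of `z = y' / y - lam`. -/
theorem sum_coeff_mul_shiftBell_eq {n : ℕ} (hn : 2 ≤ n) {a : Fin n → ℂ} {r : Fin n → ℝ → ℂ}
    {lam : ℂ} {lams : Fin (n - 1) → ℂ} (hroots : charPoly a =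
      (Polynomial.X - Polynomial.C lam) * ∏ j, (Polynomial.X - Polynomial.C (lams j)))
    (t : ℝ) (x : ℕ → ℂ) :
    ∑ i : Fin n, (a i + r i t) * shiftBell lam x i + shiftBell lam x n =
      pertDeriv r lam 0 t + (∑ m ∈ Finset.range n, ((charPoly a).taylor lam).coeff (m + 1) * x m) +
        linPart r lam t x + nonlinPart a r lam t x := by
  have hL : ∑ i : Fin n, (a i + r i t) * shiftBell lam x i + shiftBell lam x n =
      ∑ i ∈ Finset.range (n + 1), (charPoly a).coeff i * shiftBell lam x i +
      ∑ i ∈ Finset.range (n + 1), (pertPoly r t).coeff i * shiftBell lam x i := by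
    rw [← Finset.sum_add_distrib, Finset.sum_range_succ, charPoly_coeff a n le_rfl,
      pertPoly_coeff, dif_neg (lt_irrefl n), dif_neg (lt_irrefl n), one_mul, zero_mul, add_zero,
      Finset.sum_range]
    congr 1
    refine Finset.sum_congr rfl fun i _ ↦ ?_
    rw [charPoly_coeff a i i.2.le, pertPoly_coeff, dif_pos i.2, dif_pos i.2]; ring
  rw [hL, sum_coeff_mul_shiftBell (natDegree_charPoly_le a),
    sum_coeff_mul_shiftBell (natDegree_pertPoly_le r t), nonlinPart_eq, linPart,
    Finset.sum_range_succ', Finset.sum_range_succ']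
  simp only [taylor_pertPoly_coeff, completeBell_zero, mul_one]
  have h0 : ((charPoly a).taylor lam).coeff 0 = 0 := by
    rw [taylor_charPoly hroots, Polynomial.coeff_X_mul_zero]
  -- All sums are brought to `range n`. The terms added for this vanish: `B_1 - x_0 = 0` in the
  -- nonlinear sum, and the `n`-th derivative of `P(r; ·)` is zero in the linear one.
  have hI : ∀ f : ℕ → ℂ, ∑ i ∈ Finset.Icc 2 n, f i = ∑ m ∈ Finset.range n, f (m + 1) - f 1 := by
    intro f
    rw [Finset.range_eq_Ico, Finset.sum_Ico_add' f 0 n 1, Finset.sum_eq_sum_Ico_succ_bot (by omega)]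
    simp only [zero_add, add_sub_cancel_left]
    congr 1
  have hI' : ∀ f : ℕ → ℂ, ∑ i ∈ Finset.Icc 1 (n - 1), f i =
      ∑ m ∈ Finset.range n, f (m + 1) - f n := by
    intro f
    rw [Finset.range_eq_Ico, Finset.sum_Ico_add' f 0 n 1, Finset.sum_Ico_succ_top (by omega)]
    simp only [zero_add, add_sub_cancel_right]
    congr 1
  rw [hI, hI', h0, pertDeriv_self]
  have h1 : completeBell x 1 = x 0 := by
    have := completeBell_succ_sub x 0
    simpa [sub_eq_zero] using this
  simp only [h1, Nat.add_sub_cancel, Nat.sub_self, sub_self, mul_zero, zero_mul, sub_zero,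
    Nat.factorial_zero, Nat.cast_one, div_one, one_mul, add_zero, add_mul, mul_sub,
    Finset.sum_add_distrib, Finset.sum_sub_distrib]
  ring

/-! ### Lipschitz bounds for the linear and nonlinear parts. -/

/-- The sum of the moduli of the perturbation coefficients. -/
noncomputable def pertSum {n : ℕ} (r : Fin n → ℝ → ℂ) (lam : ℂ) (t : ℝ) : ℝ :=
  ∑ k ∈ Finset.range (n + 1), ‖pertDeriv r lam k t‖

theorem pertSum_nonneg {n : ℕ} (r : Fin n → ℝ → ℂ) (lam : ℂ) (t : ℝ) : 0 ≤ pertSum r lam t :=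
  Finset.sum_nonneg fun _ _ ↦ norm_nonneg _

theorem norm_factorial_inv_mul_le (k : ℕ) (c : ℂ) : ‖1 / (k.factorial : ℂ) * c‖ ≤ ‖c‖ := by
  have h1 : (1 : ℝ) ≤ k.factorial := by exact_mod_cast k.factorial_pos
  rw [norm_mul, norm_div, norm_one, Complex.norm_natCast]
  exact mul_le_of_le_one_left (norm_nonneg _) (div_le_one_of_le₀ h1 (by linarith))

theorem norm_linPart_sub_le {n : ℕ} (hn : 2 ≤ n) (r : Fin n → ℝ → ℂ) (lam : ℂ) (t : ℝ)
    {x x' : ℕ → ℂ} {d : ℝ} (hd : ∀ k < n - 1, ‖x k - x' k‖ ≤ d) :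
    ‖linPart r lam t x - linPart r lam t x'‖ ≤ pertSum r lam t * d := by
  have hd0 : 0 ≤ d := (norm_nonneg _).trans (hd 0 (by omega))
  rw [linPart, linPart, ← Finset.sum_sub_distrib]
  calc _ ≤ ∑ k ∈ Finset.Icc 1 (n - 1), ‖pertDeriv r lam k t‖ * d := by
        refine norm_sum_le_of_le _ fun k hk ↦ ?_
        have := Finset.mem_Icc.1 hk
        rw [← mul_sub, norm_mul]
        exact mul_le_mul (norm_factorial_inv_mul_le _ _) (hd _ (by omega)) (norm_nonneg _)
          (norm_nonneg _)
    _ ≤ _ := by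
        rw [← Finset.sum_mul]
        refine mul_le_mul_of_nonneg_right ?_ hd0
        refine Finset.sum_le_sum_of_subset_of_nonneg (fun k hk ↦ ?_) fun _ _ _ ↦ norm_nonneg _
        have := Finset.mem_Icc.1 hk
        exact Finset.mem_range.2 (by omega)

theorem exists_nonlinPart_lipschitz {n : ℕ} (a : Fin n → ℂ) (r : Fin n → ℝ → ℂ) (lam : ℂ) :
    ∃ C : ℝ, 0 ≤ C ∧ ∀ (t : ℝ) (x x' : ℕ → ℂ) (μ d : ℝ), 0 ≤ μ → μ ≤ 1 → 0 ≤ d →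
      (∀ k < n - 1, ‖x k‖ ≤ μ) → (∀ k < n - 1, ‖x' k‖ ≤ μ) → (∀ k < n - 1, ‖x k - x' k‖ ≤ d) →
      ‖nonlinPart a r lam t x - nonlinPart a r lam t x'‖ ≤ C * (1 + pertSum r lam t) * (μ * d) := by
  obtain ⟨C, hC1, hC⟩ := exists_completeBell_sub_lipschitz n
  set A : ℝ := ∑ i ∈ Finset.Icc 2 n, ‖((charPoly a).taylor lam).coeff i‖ with hA
  have hA0 : 0 ≤ A := Finset.sum_nonneg fun _ _ ↦ norm_nonneg _
  refine ⟨(A + 1) * C, by nlinarith, fun t x x' μ d hμ0 hμ hd hx hx' hxx ↦ ?_⟩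
  rw [nonlinPart_eq, nonlinPart_eq, ← Finset.sum_sub_distrib]
  have hμd : 0 ≤ C * (μ * d) := mul_nonneg (by linarith) (mul_nonneg hμ0 hd)
  have hS := pertSum_nonneg r lam t
  calc _ ≤ ∑ i ∈ Finset.Icc 2 n, (‖((charPoly a).taylor lam).coeff i‖ + ‖pertDeriv r lam i t‖) *
        (C * (μ * d)) := by
        refine norm_sum_le_of_le _ fun i hi ↦ ?_
        have hi' := Finset.mem_Icc.1 hi
        rw [← mul_sub, norm_mul]
        refine mul_le_mul ((norm_add_le _ _).trans
          (add_le_add le_rfl (norm_factorial_inv_mul_le _ _))) ?_ (norm_nonneg _) (by positivity)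
        have := hC (i - 1) (by omega) x x' μ d hμ (fun k hk ↦ hx k (by omega))
          (fun k hk ↦ hx' k (by omega)) (fun k hk ↦ hxx k (by omega)) hd hμ0
        rwa [show i - 1 + 1 = i by omega] at this
    _ ≤ (A + pertSum r lam t) * (C * (μ * d)) := by
        rw [← Finset.sum_mul, Finset.sum_add_distrib]
        refine mul_le_mul_of_nonneg_right (add_le_add le_rfl ?_) hμd
        refine Finset.sum_le_sum_of_subset_of_nonneg (fun k hk ↦ ?_) fun _ _ _ ↦ norm_nonneg _
        have := Finset.mem_Icc.1 hk
        exact Finset.mem_range.2 (by omega)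
    _ ≤ ((A + 1) * (1 + pertSum r lam t)) * (C * (μ * d)) :=
        mul_le_mul_of_nonneg_right (by nlinarith) hμd
    _ = _ := by ring

theorem linPart_zero {n : ℕ} (r : Fin n → ℝ → ℂ) (lam : ℂ) (t : ℝ) :
    linPart r lam t (fun _ ↦ 0) = 0 := by simp [linPart]

theorem nonlinPart_zero {n : ℕ} (a : Fin n → ℂ) (r : Fin n → ℝ → ℂ) (lam : ℂ) (t : ℝ) :
    nonlinPart a r lam t (fun _ ↦ 0) = 0 := by
  rw [nonlinPart_eq]
  refine Finset.sum_eq_zero fun i hi ↦ ?_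
  have hi' := Finset.mem_Icc.1 hi
  obtain ⟨j, rfl⟩ : ∃ j, i = j + 1 := ⟨i - 1, by omega⟩
  rw [completeBell_succ]
  simp

theorem linPart_congr {n : ℕ} (r : Fin n → ℝ → ℂ) (lam : ℂ) (t : ℝ) {x x' : ℕ → ℂ}
    (h : ∀ k < n - 1, x k = x' k) : linPart r lam t x = linPart r lam t x' :=
  Finset.sum_congr rfl fun k hk ↦ by
    have := Finset.mem_Icc.1 hk
    rw [h (k - 1) (by omega)]

/-- The jet matters only up to order `n - 2`. Hence the forcing term is a function of the modes, and
no circularity arises from `z^(n-1)`, which contains the forcing. -/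
theorem nonlinPart_congr {n : ℕ} (a : Fin n → ℂ) (r : Fin n → ℝ → ℂ) (lam : ℂ) (t : ℝ)
    {x x' : ℕ → ℂ} (h : ∀ k < n - 1, x k = x' k) :
    nonlinPart a r lam t x = nonlinPart a r lam t x' := by
  rw [nonlinPart_eq, nonlinPart_eq]
  refine Finset.sum_congr rfl fun i hi ↦ ?_
  have hi' := Finset.mem_Icc.1 hi
  obtain ⟨j, rfl⟩ : ∃ j, i = j + 1 := ⟨i - 1, by omega⟩
  rw [Nat.add_sub_cancel, completeBell_succ_sub, completeBell_succ_sub]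
  congr 1
  refine Finset.sum_congr rfl fun l hl ↦ ?_
  have := Finset.mem_range.1 hl
  rw [h l (by omega), completeBell_congr fun k hk ↦ h k (by omega)]


/-! ### The scalar Green function -/

theorem greenFun_of_neg {ω : ℂ} (h : ω.re < 0) (t s : ℝ) :
    greenFun ω t s = if s < t then Complex.exp (ω * ((t - s : ℝ) : ℂ)) else 0 := by
  simp [greenFun, Real.sign_of_neg h]

theorem greenFun_of_pos {ω : ℂ} (h : 0 < ω.re) (t s : ℝ) :
    greenFun ω t s = if t < s then -Complex.exp (ω * ((t - s : ℝ) : ℂ)) else 0 := by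
  simp [greenFun, Real.sign_of_pos h]

theorem norm_greenFun_le {ω : ℂ} {β : ℝ} (hω : ω.re ≠ 0) (hβ : β ≤ |ω.re|) (t s : ℝ) :
    ‖greenFun ω t s‖ ≤ Real.exp (-β * |t - s|) := by
  have h0 : β * |t - s| ≤ |ω.re| * |t - s| := by gcongr
  rcases lt_or_gt_of_ne hω with h | h
  · rw [greenFun_of_neg h]
    split_ifs with hs
    · rw [Complex.norm_exp, Complex.re_mul_ofReal]
      rw [abs_of_neg h, abs_of_pos (sub_pos.2 hs)] at h0
      rw [abs_of_pos (sub_pos.2 hs)]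
      exact Real.exp_le_exp.2 (by linarith)
    · simpa using (Real.exp_pos _).le
  · rw [greenFun_of_pos h]
    split_ifs with hs
    · rw [norm_neg, Complex.norm_exp, Complex.re_mul_ofReal]
      rw [abs_of_pos h, abs_of_neg (sub_neg.2 hs)] at h0
      rw [abs_of_neg (sub_neg.2 hs)]
      exact Real.exp_le_exp.2 (by linarith)
    · simpa using (Real.exp_pos _).le

theorem norm_greenFun_re (ω : ℂ) (t s : ℝ) :
    ‖greenFun ((ω.re : ℝ) : ℂ) t s‖ = ‖greenFun ω t s‖ := by
  rw [greenFun, greenFun, Complex.ofReal_re]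
  split_ifs
  · rw [norm_mul, norm_mul, Complex.norm_exp, Complex.norm_exp, Complex.re_mul_ofReal,
      Complex.re_mul_ofReal, Complex.ofReal_re]
  · rfl

theorem measurable_greenFun (ω : ℂ) (t : ℝ) : Measurable (greenFun ω t) := by
  refine Measurable.ite (measurableSet_lt (by fun_prop) (by fun_prop)) ?_ measurable_const
  fun_prop

theorem continuousAt_greenFun {ω : ℂ} (hω : ω.re ≠ 0) {t s : ℝ} (hs : s ≠ t) :
    ContinuousAt (fun t ↦ greenFun ω t s) t := by
  have hc : Continuous fun t : ℝ ↦ Complex.exp (ω * ((t - s : ℝ) : ℂ)) := by fun_prop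
  rcases lt_or_gt_of_ne hω with h | h <;> rcases lt_or_gt_of_ne hs with h' | h'
  · refine hc.continuousAt.congr ?_
    filter_upwards [Ioi_mem_nhds h'] with x hx
    rw [greenFun_of_neg h, if_pos (mem_Ioi.1 hx)]
  · refine (continuousAt_const (y := (0 : ℂ))).congr ?_
    filter_upwards [Iio_mem_nhds h'] with x hx
    rw [greenFun_of_neg h, if_neg (not_lt.2 (mem_Iio.1 hx).le)]
  · refine (continuousAt_const (y := (0 : ℂ))).congr ?_
    filter_upwards [Ioi_mem_nhds h'] with x hx
    rw [greenFun_of_pos h, if_neg (not_lt.2 (mem_Ioi.1 hx).le)]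
  · refine hc.neg.continuousAt.congr ?_
    filter_upwards [Iio_mem_nhds h'] with x hx
    rw [greenFun_of_pos h, if_pos (mem_Iio.1 hx)]
    rfl

/-- `f` may be integrated on `[T, ∞)` against a kernel decaying like `exp (-β |t - s|)`. -/
def ExpIntegrable (T β : ℝ) (f : ℝ → ℂ) : Prop :=
  AEStronglyMeasurable f (volume.restrict (Ici T)) ∧
    IntegrableOn (fun s ↦ Real.exp (-β * |s|) * ‖f s‖) (Ici T)

theorem ExpIntegrable.of_integrableOn {T β : ℝ} (hβ : 0 ≤ β) {f : ℝ → ℂ}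
    (h : IntegrableOn f (Ici T)) : ExpIntegrable T β f := by
  refine ⟨h.aestronglyMeasurable, h.norm.mono' ?_ (Eventually.of_forall fun s ↦ ?_)⟩
  · exact (by fun_prop : Continuous fun s : ℝ ↦ Real.exp (-β * |s|)).aestronglyMeasurable.mul
      h.aestronglyMeasurable.norm
  · rw [Real.norm_of_nonneg (by positivity)]
    refine mul_le_of_le_one_left (norm_nonneg _) (Real.exp_le_one_iff.2 ?_)
    nlinarith [abs_nonneg s]

/-- Triangle inequality; integrability against the kernel centred at `0` thus gives it at every `t`,
locally uniformly. -/
theorem exp_kernel_le {β : ℝ} (hβ : 0 ≤ β) (t s : ℝ) :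
    Real.exp (-β * |t - s|) ≤ Real.exp (β * |t|) * Real.exp (-β * |s|) := by
  rw [← Real.exp_add]
  refine Real.exp_le_exp.2 ?_
  have h1 : |s| ≤ |t| + |t - s| := by
    have := abs_sub_abs_le_abs_sub s t
    rw [abs_sub_comm] at this; linarith
  nlinarith

theorem ExpIntegrable.integrableOn_kernel {T β : ℝ} (hβ : 0 ≤ β) {f : ℝ → ℂ}
    (h : ExpIntegrable T β f) (t : ℝ) :
    IntegrableOn (fun s ↦ Real.exp (-β * |t - s|) * ‖f s‖) (Ici T) := by
  refine (h.2.const_mul (Real.exp (β * |t|))).mono' ?_ (Eventually.of_forall fun s ↦ ?_)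
  · exact (by fun_prop : Continuous fun s : ℝ ↦ Real.exp (-β * |t - s|)).aestronglyMeasurable.mul
      h.1.norm
  · rw [Real.norm_of_nonneg (by positivity), ← mul_assoc]
    exact mul_le_mul_of_nonneg_right (exp_kernel_le hβ t s) (norm_nonneg _)

theorem ExpIntegrable.integrableOn_Icc {T β : ℝ} (hβ : 0 ≤ β) {f : ℝ → ℂ}
    (h : ExpIntegrable T β f) (b : ℝ) : IntegrableOn f (Icc T b) := by
  have h1 : IntegrableOn (fun s ↦ Real.exp (-β * |s|) * ‖f s‖) (Icc T b) :=
    h.2.mono_set Icc_subset_Ici_self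
  refine (h1.const_mul (Real.exp (β * (|T| + |b|)))).mono'
    (h.1.mono_measure (Measure.restrict_mono Icc_subset_Ici_self le_rfl)) ?_
  filter_upwards [ae_restrict_mem measurableSet_Icc] with s hs
  rw [← mul_assoc, ← Real.exp_add]
  refine le_mul_of_one_le_left (norm_nonneg _) (Real.one_le_exp ?_)
  have h2 : |s| ≤ |T| + |b| := by
    rw [abs_le]
    have := neg_abs_le T
    have := le_abs_self b
    have := abs_nonneg T
    have := abs_nonneg b
    exact ⟨by linarith [hs.1], by linarith [hs.2]⟩
  nlinarith

theorem ExpIntegrable.integrableOn_greenFun_mul {T β : ℝ} (hβ : 0 ≤ β) {f : ℝ → ℂ}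
    (h : ExpIntegrable T β f) {ω : ℂ} (hω : ω.re ≠ 0) (hβω : β ≤ |ω.re|) (t : ℝ) :
    IntegrableOn (fun s ↦ greenFun ω t s * f s) (Ici T) := by
  refine (h.integrableOn_kernel hβ t).mono'
    ((measurable_greenFun ω t).aestronglyMeasurable.mul h.1) (Eventually.of_forall fun s ↦ ?_)
  rw [norm_mul]
  exact mul_le_mul_of_nonneg_right (norm_greenFun_le hω hβω t s) (norm_nonneg _)

theorem norm_greenG_le {T β : ℝ} (hβ : 0 ≤ β) {f : ℝ → ℂ}
    (h : ExpIntegrable T β f) {ω : ℂ} (hω : ω.re ≠ 0) (hβω : β ≤ |ω.re|) (t : ℝ) :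
    ‖greenG T ω f t‖ ≤ ∫ s in Ici T, Real.exp (-β * |t - s|) * ‖f s‖ := by
  refine norm_integral_le_of_norm_le (h.integrableOn_kernel hβ t) (Eventually.of_forall fun s ↦ ?_)
  rw [norm_mul]
  exact mul_le_mul_of_nonneg_right (norm_greenFun_le hω hβω t s) (norm_nonneg _)

theorem norm_greenG_le_greenI (T : ℝ) (ω : ℂ) (f : ℝ → ℂ) (t : ℝ) :
    ‖greenG T ω f t‖ ≤ greenI T ((ω.re : ℝ) : ℂ) f t := by
  refine (norm_integral_le_integral_norm _).trans (le_of_eq ?_)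
  rw [greenI]
  congr 1
  funext s
  rw [norm_mul, norm_mul, norm_greenFun_re]

theorem greenI_nonneg (T : ℝ) (ω : ℂ) (f : ℝ → ℂ) (t : ℝ) : 0 ≤ greenI T ω f t :=
  integral_nonneg fun _ ↦ norm_nonneg _

theorem continuous_greenG {T β : ℝ} (hβ : 0 ≤ β) {f : ℝ → ℂ}
    (h : ExpIntegrable T β f) {ω : ℂ} (hω : ω.re ≠ 0) (hβω : β ≤ |ω.re|) :
    Continuous (greenG T ω f) := by
  rw [continuous_iff_continuousAt]
  intro t
  refine continuousAt_of_dominated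
    (bound := fun s ↦ Real.exp (β * (|t| + 1)) * (Real.exp (-β * |s|) * ‖f s‖)) ?_ ?_
    (h.2.const_mul _) ?_
  · exact Eventually.of_forall fun x ↦
      (measurable_greenFun ω x).aestronglyMeasurable.mul h.1
  · filter_upwards [Metric.ball_mem_nhds t one_pos] with x hx
    refine Eventually.of_forall fun s ↦ ?_
    rw [norm_mul, ← mul_assoc]
    refine mul_le_mul_of_nonneg_right ((norm_greenFun_le hω hβω x s).trans
      ((exp_kernel_le hβ x s).trans ?_)) (norm_nonneg _)
    refine mul_le_mul_of_nonneg_right (Real.exp_le_exp.2 ?_) (Real.exp_pos _).le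
    have h1 : |x| ≤ |t| + 1 := by
      have := abs_sub_abs_le_abs_sub x t
      rw [Metric.mem_ball, Real.dist_eq] at hx; linarith
    exact mul_le_mul_of_nonneg_left h1 hβ
  · have h1 : ∀ᵐ s ∂(volume.restrict (Ici T)), s ≠ t :=
      ae_restrict_of_ae (by simp [ae_iff, measure_singleton])
    filter_upwards [h1] with s hs
    exact (continuousAt_greenFun hω hs).mul continuousAt_const

/-- Variation of constants: `c = 0` if `Re ω < 0`, and `c = -∫_T^∞ e^{-ωs} f` if `Re ω > 0`. In this
form absolute continuity and the derivative almost everywhere are visible. -/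
theorem exists_greenG_eq {T β : ℝ} {f : ℝ → ℂ}
    (h : ExpIntegrable T β f) {ω : ℂ} (hω : ω.re ≠ 0) (hβω : β ≤ |ω.re|) :
    ∃ c : ℂ, ∀ t, T ≤ t → greenG T ω f t =
      Complex.exp (ω * t) * (c + ∫ s in T..t, Complex.exp (-ω * s) * f s) := by
  have hexp : ∀ t s : ℝ, Complex.exp (ω * ((t - s : ℝ) : ℂ)) =
      Complex.exp (ω * t) * Complex.exp (-ω * s) := by
    intro t s
    rw [← Complex.exp_add]; congr 1; push_cast; ring
  rcases lt_or_gt_of_ne hω with hneg | hpos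
  · refine ⟨0, fun t ht ↦ ?_⟩
    rw [zero_add, intervalIntegral.integral_of_le ht, ← integral_const_mul, greenG,
      ← integral_Ico_eq_integral_Ioc]
    have h1 : ∀ s, greenFun ω t s * f s = (Iio t).indicator
        (fun s ↦ Complex.exp (ω * t) * (Complex.exp (-ω * s) * f s)) s := by
      intro s
      rw [greenFun_of_neg hneg]
      by_cases hs : s < t
      · rw [if_pos hs, indicator_of_mem (mem_Iio.2 hs), hexp, mul_assoc]
      · rw [if_neg hs, indicator_of_notMem (by simpa using hs), zero_mul]
    simp only [h1]
    rw [setIntegral_indicator measurableSet_Iio, Ici_inter_Iio]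
  · have hint : IntegrableOn (fun s : ℝ ↦ Complex.exp (-ω * s) * f s) (Ici T) := by
      -- The constant pays for negative `s ∈ [T, 0)`, where `|e^{-ωs}|` is large but `|s| ≤ |T|`.
      refine (h.2.const_mul (Real.exp (2 * |ω.re| * |T|))).mono'
        ((by fun_prop : Continuous fun s : ℝ ↦
          Complex.exp (-ω * s)).aestronglyMeasurable.mul h.1) ?_
      filter_upwards [ae_restrict_mem measurableSet_Ici] with s hs
      rw [norm_mul, ← mul_assoc, ← Real.exp_add, Complex.norm_exp, Complex.re_mul_ofReal,
        Complex.neg_re]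
      refine mul_le_mul_of_nonneg_right (Real.exp_le_exp.2 ?_) (norm_nonneg _)
      rw [abs_of_pos hpos] at hβω ⊢
      have hs' : T ≤ s := hs
      rcases le_or_gt 0 s with h0 | h0
      · rw [abs_of_nonneg h0]
        nlinarith [mul_nonneg hpos.le (abs_nonneg T)]
      · have hT : |s| ≤ |T| := by
          rw [abs_of_neg h0, abs_of_neg (hs'.trans_lt h0)]; linarith
        rw [show -ω.re * s = ω.re * |s| by rw [abs_of_neg h0]; ring]
        nlinarith [abs_nonneg s, mul_le_mul_of_nonneg_left hT hpos.le]
    refine ⟨-∫ s in Ioi T, Complex.exp (-ω * s) * f s, fun t ht ↦ ?_⟩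
    have h1 : ∀ s, greenFun ω t s * f s = (Ioi t).indicator
        (fun s ↦ -Complex.exp (ω * t) * (Complex.exp (-ω * s) * f s)) s := by
      intro s
      rw [greenFun_of_pos hpos]
      by_cases hs : t < s
      · rw [if_pos hs, indicator_of_mem (mem_Ioi.2 hs), hexp]; ring
      · rw [if_neg hs, indicator_of_notMem (by simpa using hs), zero_mul]
    rw [greenG]
    simp only [h1]
    rw [setIntegral_indicator measurableSet_Ioi,
      inter_eq_self_of_subset_right (Ioi_subset_Ici ht), integral_const_mul]
    have h2 := intervalIntegral.integral_interval_add_Ioi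
      (hint.mono_set Ioi_subset_Ici_self) (hint.mono_set (Ioi_subset_Ici ht))
    rw [← h2]; ring

theorem greenG_eq_add_integral {T β : ℝ} (hβ : 0 ≤ β) {f : ℝ → ℂ}
    (h : ExpIntegrable T β f) {ω : ℂ} (hω : ω.re ≠ 0) (hβω : β ≤ |ω.re|) {t₁ t : ℝ}
    (h₁ : T ≤ t₁) (ht : t₁ ≤ t) : greenG T ω f t =
      greenG T ω f t₁ + ∫ s in t₁..t, (ω * greenG T ω f s + f s) := by
  obtain ⟨c, hc⟩ := exists_greenG_eq h hω hβω
  have hTt := h₁.trans ht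
  have hfi : IntervalIntegrable f volume T t :=
    (intervalIntegrable_iff_integrableOn_Icc_of_le hTt).2 (h.integrableOn_Icc hβ t)
  have hfe : IntervalIntegrable (fun s : ℝ ↦ Complex.exp (-ω * s) * f s) volume T t :=
    hfi.continuousOn_mul (by fun_prop)
  have hG := continuous_greenG hβ h hω hβω
  have hsub : uIcc t₁ t ⊆ uIcc T t := by
    rw [uIcc_of_le ht, uIcc_of_le hTt]; exact Icc_subset_Icc_left h₁
  have hE : ∀ s : ℝ, HasDerivAt (fun s : ℝ ↦ Complex.exp (ω * s)) (Complex.exp (ω * s) * ω) s := by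
    intro s
    have h1 : HasDerivAt (fun s : ℝ ↦ ω * (s : ℂ)) ω s := by
      simpa using (Complex.ofRealCLM.hasDerivAt (x := s)).const_mul ω
    exact h1.cexp
  have hac1 : AbsolutelyContinuousOnInterval (fun s : ℝ ↦ Complex.exp (ω * s)) T t := by
    refine ContDiffOn.absolutelyContinuousOnInterval (ContDiff.contDiffOn ?_)
    exact (contDiff_const.mul Complex.ofRealCLM.contDiff).cexp
  have hac0 : AbsolutelyContinuousOnInterval (fun _ : ℝ ↦ c) T t :=
    (contDiff_const (n := 1)).contDiffOn.absolutelyContinuousOnInterval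
  have hac2 := absolutelyContinuousOnInterval_integral hfe left_mem_uIcc
  have hac3 := hac1.fun_smul (hac0.fun_add hac2)
  have hac : AbsolutelyContinuousOnInterval (greenG T ω f) T t :=
    AbsolutelyContinuousOnInterval.congr' hac3 fun s hs ↦ by
      rw [uIcc_of_le hTt] at hs
      exact (hc s hs.1).symm
  refine eq_add_integral_of_absolutelyContinuous (hac.mono hsub)
    (((hG.const_mul ω).intervalIntegrable _ _).add (hfi.mono_set hsub)) ?_
  have hne : ∀ᵐ s : ℝ, s ≠ T := by simp [ae_iff, measure_singleton]
  filter_upwards [hfe.ae_hasDerivAt_integral, hne] with s hs hsT hmem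
  have hmem' := hsub hmem
  have h1 := (hE s).mul ((hs hmem' T left_mem_uIcc).const_add c)
  have hTs : T < s := by
    rw [uIcc_of_le hTt] at hmem'
    exact lt_of_le_of_ne hmem'.1 hsT.symm
  have h2 : HasDerivAt (greenG T ω f) _ s := h1.congr_of_eventuallyEq (by
    filter_upwards [Ioi_mem_nhds hTs] with x hx using hc x (mem_Ioi.1 hx).le)
  refine h2.congr_deriv ?_
  rw [hc s hTs.le]
  have h3 : Complex.exp (ω * s) * Complex.exp (-ω * s) = 1 := by
    rw [← Complex.exp_add]; simp
  linear_combination (f s) * h3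


/-! ### Exponential averages -/

theorem integrable_exp_neg_mul_abs {β : ℝ} (hβ : 0 < β) :
    Integrable (fun s : ℝ ↦ Real.exp (-β * |s|)) := by
  -- From `e^x ≥ 1 + x² / 2` and `(1 + 2 / β²)(1 + β² s² / 2) ≥ 1 + s²`.
  refine (integrable_inv_one_add_sq.const_mul (1 + 2 / β ^ 2)).mono'
    (by fun_prop : Continuous fun s : ℝ ↦ Real.exp (-β * |s|)).aestronglyMeasurable
    (Eventually.of_forall fun s ↦ ?_)
  rw [Real.norm_of_nonneg (Real.exp_pos _).le, neg_mul, Real.exp_neg, ← div_eq_mul_inv,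
    inv_eq_one_div, div_le_div_iff₀ (Real.exp_pos _) (by positivity), one_mul]
  have h1 := Real.quadratic_le_exp_of_nonneg (mul_nonneg hβ.le (abs_nonneg s))
  have h2 : 0 ≤ β * |s| := mul_nonneg hβ.le (abs_nonneg s)
  have h3 : 1 + β ^ 2 * s ^ 2 / 2 ≤ Real.exp (β * |s|) := by
    rw [mul_pow, sq_abs] at h1; linarith
  refine le_trans ?_ (mul_le_mul_of_nonneg_left h3 (by positivity))
  have h4 : (1 + 2 / β ^ 2) * (1 + β ^ 2 * s ^ 2 / 2) =
      1 + s ^ 2 + β ^ 2 * s ^ 2 / 2 + 2 / β ^ 2 := by field_simp; ring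
  rw [h4]
  have : 0 ≤ β ^ 2 * s ^ 2 / 2 := by positivity
  have : 0 ≤ 2 / β ^ 2 := by positivity
  linarith

theorem integrable_exp_neg_mul_abs_sub {β : ℝ} (hβ : 0 < β) (t : ℝ) :
    Integrable (fun s : ℝ ↦ Real.exp (-β * |t - s|)) :=
  (integrable_exp_neg_mul_abs hβ).comp_sub_left t

theorem integral_exp_neg_mul_abs_sub (β t : ℝ) :
    ∫ s, Real.exp (-β * |t - s|) = ∫ s, Real.exp (-β * |s|) :=
  integral_sub_left_eq_self (fun s ↦ Real.exp (-β * |s|)) volume t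

/-- The average of `w` against the kernel `exp (-β |t - s|)`. -/
noncomputable def expConv (β : ℝ) (w : ℝ → ℝ) (t : ℝ) : ℝ :=
  ∫ s, Real.exp (-β * |t - s|) * w s

theorem exp_kernel_le_one {β : ℝ} (hβ : 0 ≤ β) (x : ℝ) : Real.exp (-β * |x|) ≤ 1 :=
  Real.exp_le_one_iff.2 (by nlinarith [abs_nonneg x])

theorem aestronglyMeasurable_exp_kernel (β t : ℝ) (μ : Measure ℝ) :
    AEStronglyMeasurable (fun s : ℝ ↦ Real.exp (-β * |t - s|)) μ :=
  (by fun_prop : Continuous fun s : ℝ ↦ Real.exp (-β * |t - s|)).aestronglyMeasurable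

section expConv

variable {β : ℝ} {w : ℝ → ℝ}

theorem integrable_exp_kernel_mul (hβ : 0 ≤ β) {μ : Measure ℝ} (hw : Integrable w μ) (t : ℝ) :
    Integrable (fun s ↦ Real.exp (-β * |t - s|) * w s) μ := by
  refine hw.norm.mono' ((aestronglyMeasurable_exp_kernel β t μ).mul hw.aestronglyMeasurable)
    (Eventually.of_forall fun s ↦ ?_)
  rw [norm_mul, Real.norm_of_nonneg (Real.exp_pos _).le]
  exact mul_le_of_le_one_left (norm_nonneg _) (exp_kernel_le_one hβ _)

theorem continuous_expConv (hβ : 0 ≤ β) (hw : Integrable w) : Continuous (expConv β w) := by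
  refine continuous_of_dominated (bound := fun s ↦ ‖w s‖)
    (fun t ↦ (integrable_exp_kernel_mul hβ hw t).aestronglyMeasurable)
    (fun t ↦ Eventually.of_forall fun s ↦ ?_) hw.norm (Eventually.of_forall fun s ↦ by fun_prop)
  rw [norm_mul, Real.norm_of_nonneg (Real.exp_pos _).le]
  exact mul_le_of_le_one_left (norm_nonneg _) (exp_kernel_le_one hβ _)

theorem expConv_pos (hβ : 0 ≤ β) (hw : Integrable w) (h0 : ∀ s, 0 < w s) (t : ℝ) :
    0 < expConv β w t := by
  have h1 : ∀ s, 0 < Real.exp (-β * |t - s|) * w s := fun s ↦ mul_pos (Real.exp_pos _) (h0 s)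
  rw [expConv, integral_pos_iff_support_of_nonneg (fun s ↦ (h1 s).le)
    (integrable_exp_kernel_mul hβ hw t)]
  have : Function.support (fun s ↦ Real.exp (-β * |t - s|) * w s) = univ :=
    eq_univ_of_forall fun s ↦ (h1 s).ne'
  rw [this]; simp

theorem expConv_le (hβ : 0 ≤ β) (hw : Integrable w) (h0 : ∀ s, 0 ≤ w s) (t : ℝ) :
    expConv β w t ≤ ∫ s, w s :=
  integral_mono (integrable_exp_kernel_mul hβ hw t) hw fun s ↦
    mul_le_of_le_one_left (h0 s) (exp_kernel_le_one hβ _)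

theorem expConv_le_exp_mul (hβ : 0 ≤ β) (hw : Integrable w) (h0 : ∀ s, 0 ≤ w s) (t s : ℝ) :
    expConv β w s ≤ Real.exp (β * |t - s|) * expConv β w t := by
  rw [expConv, expConv, ← integral_const_mul]
  refine integral_mono (integrable_exp_kernel_mul hβ hw s)
    ((integrable_exp_kernel_mul hβ hw t).const_mul _) fun x ↦ ?_
  simp only
  rw [← mul_assoc, ← Real.exp_add]
  refine mul_le_mul_of_nonneg_right (Real.exp_le_exp.2 ?_) (h0 x)
  have := abs_sub_le t s x
  nlinarith

theorem integrable_expConv (hβ : 0 < β) (hw : Integrable w) : Integrable (expConv β w) := by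
  have h := hw.integrable_convolution (ContinuousLinearMap.mul ℝ ℝ)
    (integrable_exp_neg_mul_abs hβ)
  refine h.congr (Eventually.of_forall fun t ↦ ?_)
  simp only [convolution_def, expConv, ContinuousLinearMap.mul_apply']
  congr 1
  funext s
  ring

theorem tendsto_expConv (hβ : 0 < β) (hw : Integrable w) :
    Tendsto (expConv β w) atTop (𝓝 0) := by
  have h : Tendsto (expConv β w) atTop (𝓝 (∫ _ : ℝ, (0 : ℝ))) := by
    refine tendsto_integral_filter_of_dominated_convergence (fun s ↦ ‖w s‖)
      (Eventually.of_forall fun t ↦ (integrable_exp_kernel_mul hβ.le hw t).aestronglyMeasurable)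
      (Eventually.of_forall fun t ↦ Eventually.of_forall fun s ↦ ?_) hw.norm
      (Eventually.of_forall fun s ↦ ?_)
    · rw [norm_mul, Real.norm_of_nonneg (Real.exp_pos _).le]
      exact mul_le_of_le_one_left (norm_nonneg _) (exp_kernel_le_one hβ.le _)
    · have h1 : Tendsto (fun t : ℝ ↦ Real.exp (-β * |t - s|)) atTop (𝓝 0) := by
        refine Real.tendsto_exp_atBot.comp ?_
        refine Tendsto.const_mul_atTop_of_neg (by linarith) ?_
        exact tendsto_abs_atTop_atTop.comp (tendsto_atTop_add_const_right _ (-s) tendsto_id)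
      simpa using h1.mul_const (w s)
  simpa using h

end expConv

/-! ### The weight `w` and the majorant `√E`. -/

/-- `q` is dominated by `η + w / η` on `[t₀, ∞)` for every `η ∈ (0, 1]`; this holds for `q = |c|`
when `c` is in some `L^p` with `1 ≤ p ≤ 2` and `w = min |c| |c|²`. -/
def SplitBound (t₀ : ℝ) (w q : ℝ → ℝ) : Prop :=
  ∀ s, t₀ ≤ s → 0 ≤ q s ∧ ∀ η, 0 < η → η ≤ 1 → q s ≤ η + w s / η

/-- The square root halves the rate of variation, so a kernel of rate `2b` absorbs it and still
decays at rate `b`. -/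
theorem sqrt_expConv_le_exp_mul {b : ℝ} {w : ℝ → ℝ} (hb : 0 ≤ b) (hw : Integrable w)
    (h0 : ∀ s, 0 ≤ w s) (t s : ℝ) :
    √(expConv (2 * b) w s) ≤ Real.exp (b * |t - s|) * √(expConv (2 * b) w t) := by
  have h1 := Real.sqrt_le_sqrt (expConv_le_exp_mul (by linarith : (0 : ℝ) ≤ 2 * b) hw h0 t s)
  have h2 : Real.exp (2 * b * |t - s|) = Real.exp (b * |t - s|) ^ 2 := by
    rw [← Real.exp_nat_mul]; congr 1; push_cast; ring
  rwa [Real.sqrt_mul (Real.exp_pos _).le, h2, Real.sqrt_sq (Real.exp_pos _).le] at h1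

section majorant

variable {t₀ : ℝ} {w q : ℝ → ℝ}

theorem integrableOn_exp_kernel_mul_of_splitBound {β : ℝ} (hβ : 0 < β) (hw : Integrable w)
    (hq : SplitBound t₀ w q) (hm : AEStronglyMeasurable q (volume.restrict (Ici t₀))) (t : ℝ) :
    IntegrableOn (fun s ↦ Real.exp (-β * |t - s|) * q s) (Ici t₀) := by
  have h1 : Integrable (fun s ↦ Real.exp (-β * |t - s|) + Real.exp (-β * |t - s|) * w s) :=
    (integrable_exp_neg_mul_abs_sub hβ t).add (integrable_exp_kernel_mul hβ.le hw t)
  refine h1.integrableOn.mono' ((aestronglyMeasurable_exp_kernel β t _).mul hm) ?_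
  filter_upwards [ae_restrict_mem measurableSet_Ici] with s hs
  obtain ⟨h2, h3⟩ := hq s hs
  have := h3 1 one_pos le_rfl
  rw [Real.norm_of_nonneg (mul_nonneg (Real.exp_pos _).le h2), ← mul_one_add]
  exact mul_le_mul_of_nonneg_left (by simpa using this) (Real.exp_pos _).le

theorem integral_exp_kernel_mul_le {β : ℝ} (hβ : 0 < β) (hw : Integrable w)
    (hq : SplitBound t₀ w q) (hm : AEStronglyMeasurable q (volume.restrict (Ici t₀)))
    {T : ℝ} (hT : t₀ ≤ T) {η : ℝ} (hη : 0 < η) (hη1 : η ≤ 1) (t : ℝ) :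
    ∫ s in Ici T, Real.exp (-β * |t - s|) * q s ≤
      η * (∫ s, Real.exp (-β * |s|)) + (∫ s in Ici T, Real.exp (-β * |t - s|) * w s) / η := by
  have e1 := (integrable_exp_neg_mul_abs_sub hβ t)
  have e2 := integrable_exp_kernel_mul hβ.le hw t
  calc _ ≤ ∫ s in Ici T, (η * Real.exp (-β * |t - s|) + (Real.exp (-β * |t - s|) * w s) / η) := by
        refine setIntegral_mono_on
          ((integrableOn_exp_kernel_mul_of_splitBound hβ hw hq hm t).mono_set (Ici_subset_Ici.2 hT))
          ((e1.const_mul η).integrableOn.add (e2.div_const η).integrableOn) measurableSet_Ici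
          fun s hs ↦ ?_
        have h1 := (hq s (hT.trans hs)).2 η hη hη1
        calc _ ≤ Real.exp (-β * |t - s|) * (η + w s / η) :=
              mul_le_mul_of_nonneg_left h1 (Real.exp_pos _).le
          _ = _ := by ring
    _ = η * (∫ s in Ici T, Real.exp (-β * |t - s|)) +
          (∫ s in Ici T, Real.exp (-β * |t - s|) * w s) / η := by
        rw [integral_add (e1.const_mul η).integrableOn (e2.div_const η).integrableOn,
          integral_const_mul, integral_div]
    _ ≤ _ := by
        gcongr
        rw [← integral_exp_neg_mul_abs_sub β t]
        exact setIntegral_le_integral e1 (Eventually.of_forall fun s ↦ (Real.exp_pos _).le)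

theorem exists_integral_exp_kernel_le_sqrt {β : ℝ} (hβ : 0 < β) (hw : Integrable w)
    (h0 : ∀ s, 0 < w s) : ∃ C : ℝ, 0 ≤ C ∧ ∀ q : ℝ → ℝ, SplitBound t₀ w q →
      AEStronglyMeasurable q (volume.restrict (Ici t₀)) → ∀ t,
      ∫ s in Ici t₀, Real.exp (-β * |t - s|) * q s ≤ C * √(expConv β w t) := by
  set K := ∫ s : ℝ, Real.exp (-β * |s|) with hK
  have hK0 : 0 ≤ K := integral_nonneg fun s ↦ (Real.exp_pos _).le
  set W := √(1 + ∫ s, w s) with hW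
  have hw0 : 0 ≤ ∫ s, w s := integral_nonneg fun s ↦ (h0 s).le
  have hW1 : 1 ≤ W := by rw [hW]; exact Real.one_le_sqrt.2 (by linarith)
  refine ⟨K / W + W, by positivity, fun q hq hm t ↦ ?_⟩
  have hE := expConv_pos hβ.le hw h0 t
  have hE' := Real.sqrt_pos.2 hE
  have hle : √(expConv β w t) ≤ W :=
    Real.sqrt_le_sqrt ((expConv_le hβ.le hw (fun s ↦ (h0 s).le) t).trans (by linarith))
  -- Up to a constant this `η` balances `η` against `E(t) / η`. Division by `W` keeps it at most
  -- `1`, because `E ≤ ∫ w`.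
  have hη : 0 < √(expConv β w t) / W := by positivity
  refine (integral_exp_kernel_mul_le hβ hw hq hm le_rfl hη
    (div_le_one_of_le₀ hle (by positivity)) t).trans ?_
  have h1 : ∫ s in Ici t₀, Real.exp (-β * |t - s|) * w s ≤ expConv β w t :=
    setIntegral_le_integral (integrable_exp_kernel_mul hβ.le hw t)
      (Eventually.of_forall fun s ↦ mul_nonneg (Real.exp_pos _).le (h0 s).le)
  calc _ ≤ √(expConv β w t) / W * K + expConv β w t / (√(expConv β w t) / W) := by
        gcongr
    _ = _ := by
        nth_rewrite 2 [← Real.mul_self_sqrt hE.le]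
        field_simp

/-- A small `η` is fixed for the first term of the splitting, then `T` is taken so late that the
tail of `w` beats `1 / η`. As the kernel is at most `1`, this is uniform in `t`. -/
theorem exists_forall_integral_exp_kernel_le {β : ℝ} (hβ : 0 < β) (hw : Integrable w)
    (h0 : ∀ s, 0 ≤ w s) (hq : SplitBound t₀ w q)
    (hm : AEStronglyMeasurable q (volume.restrict (Ici t₀))) {ε : ℝ} (hε : 0 < ε) :
    ∃ T₀, ∀ T, T₀ ≤ T → t₀ ≤ T → ∀ t, ∫ s in Ici T, Real.exp (-β * |t - s|) * q s ≤ ε := by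
  set K := ∫ s : ℝ, Real.exp (-β * |s|) with hK
  have hK0 : 0 ≤ K := integral_nonneg fun s ↦ (Real.exp_pos _).le
  set η := min 1 (ε / (2 * (K + 1))) with hη
  have hη0 : 0 < η := lt_min one_pos (by positivity)
  have h1 : Tendsto (fun T ↦ ∫ s in Ici T, w s) atTop (𝓝 0) := by
    have h2 := intervalIntegral_tendsto_integral_Ioi 0 hw.integrableOn tendsto_id
    have h3 : (fun T ↦ ∫ s in Ici T, w s) =
        fun T ↦ (∫ s in Ioi 0, w s) - ∫ s in (0 : ℝ)..T, w s := by
      funext T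
      rw [integral_Ici_eq_integral_Ioi, ← intervalIntegral.integral_interval_add_Ioi
        (a := 0) (b := T) hw.integrableOn hw.integrableOn]
      ring
    rw [h3]
    simpa using h2.const_sub (∫ s in Ioi 0, w s)
  obtain ⟨T₀, hT₀⟩ := eventually_atTop.1 (h1.eventually_lt_const (by positivity : 0 < ε * η / 2))
  refine ⟨T₀, fun T hT hT' t ↦ ?_⟩
  refine (integral_exp_kernel_mul_le hβ hw hq hm hT' hη0 (min_le_left _ _) t).trans ?_
  have h2 : ∫ s in Ici T, Real.exp (-β * |t - s|) * w s ≤ ε * η / 2 := by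
    refine le_trans ?_ (hT₀ T hT).le
    exact setIntegral_mono (integrable_exp_kernel_mul hβ.le hw t).integrableOn hw.integrableOn
      fun s ↦ mul_le_of_le_one_left (h0 s) (exp_kernel_le_one hβ.le _)
  have h3 : η * K ≤ ε / 2 := by
    calc η * K ≤ ε / (2 * (K + 1)) * (K + 1) := by
          gcongr
          · exact min_le_right _ _
          · linarith
      _ = ε / 2 := by field_simp
  have h4 : (∫ s in Ici T, Real.exp (-β * |t - s|) * w s) / η ≤ ε / 2 := by
    rw [div_le_iff₀ hη0]; linarith
  linarith

/-- The parameter `η` may depend on `s`: `η = e s / M` gives `q e ≤ e² / M + M w`. -/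
theorem integrableOn_mul_of_splitBound (hw : Integrable w) {e : ℝ → ℝ} (he : Continuous e)
    (he0 : ∀ s, 0 < e s) {M : ℝ} (heM : ∀ s, e s ≤ M) (he2 : Integrable fun s ↦ e s ^ 2)
    (hq : SplitBound t₀ w q) (hm : AEStronglyMeasurable q (volume.restrict (Ici t₀))) :
    IntegrableOn (fun s ↦ q s * e s) (Ici t₀) := by
  have hM : 0 < M := (he0 0).trans_le (heM 0)
  refine ((he2.div_const M).add (hw.const_mul M)).integrableOn.mono'
    (hm.mul he.aestronglyMeasurable) ?_
  filter_upwards [ae_restrict_mem measurableSet_Ici] with s hs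
  obtain ⟨h2, h3⟩ := hq s hs
  have h4 := h3 (e s / M) (div_pos (he0 s) hM) (div_le_one_of_le₀ (heM s) hM.le)
  rw [Real.norm_of_nonneg (mul_nonneg h2 (he0 s).le)]
  calc q s * e s ≤ (e s / M + w s / (e s / M)) * e s :=
        mul_le_mul_of_nonneg_right h4 (he0 s).le
    _ = e s ^ 2 / M + M * w s := by
        have := (he0 s).ne'
        field_simp

theorem integrableOn_mul_sqrt_expConv {β : ℝ} (hβ : 0 < β) (hw : Integrable w)
    (h0 : ∀ s, 0 < w s) (hq : SplitBound t₀ w q)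
    (hm : AEStronglyMeasurable q (volume.restrict (Ici t₀))) :
    IntegrableOn (fun s ↦ q s * √(expConv β w s)) (Ici t₀) := by
  have hpos := expConv_pos hβ.le hw h0
  exact integrableOn_mul_of_splitBound hw (continuous_expConv hβ.le hw).sqrt
    (fun s ↦ Real.sqrt_pos.2 (hpos s))
    (fun s ↦ Real.sqrt_le_sqrt (expConv_le hβ.le hw (fun s ↦ (h0 s).le) s))
    ((integrable_expConv hβ hw).congr
      (Eventually.of_forall fun s ↦ (Real.sq_sqrt (hpos s).le).symm)) hq hm

/-- With `E` as the weight, this lets the majorant `e = √E` be treated by the same estimates as the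
coefficients. -/
theorem splitBound_sqrt {w : ℝ → ℝ} (h0 : ∀ s, 0 ≤ w s) : SplitBound t₀ w (fun s ↦ √(w s)) := by
  refine fun s _ ↦ ⟨Real.sqrt_nonneg _, fun η hη _ ↦ ?_⟩
  have h1 := Real.sq_sqrt (h0 s)
  rw [← sub_le_iff_le_add', le_div_iff₀ hη]
  nlinarith [sq_nonneg (√(w s) - η), Real.sqrt_nonneg (w s)]

theorem splitBound_min {c : ℝ → ℂ} {w : ℝ → ℝ}
    (h : ∀ s, t₀ ≤ s → min ‖c s‖ (‖c s‖ ^ 2) ≤ w s) : SplitBound t₀ w (fun s ↦ ‖c s‖) := by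
  refine fun s hs ↦ ⟨norm_nonneg _, fun η hη hη1 ↦ ?_⟩
  have h1 := h s hs
  have h0 := norm_nonneg (c s)
  rw [← sub_le_iff_le_add', le_div_iff₀ hη]
  rcases le_total ‖c s‖ (‖c s‖ ^ 2) with h2 | h2
  · rw [min_eq_left h2] at h1; nlinarith
  · rw [min_eq_right h2] at h1; nlinarith [sq_nonneg (‖c s‖ - η)]

/-- The minimum is at most `|c|^p`: where `|c| ≥ 1` because `p ≥ 1`, where `|c| ≤ 1` because `p ≤
2`. Different exponents are thereby reduced to a single `L¹` weight. -/
theorem integrable_min_of_memLp {c : ℝ → ℂ} {μ : Measure ℝ} {p : ENNReal} (hp : 1 < p ∧ p ≤ 2)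
    (hc : MemLp c p μ) : Integrable (fun s ↦ min ‖c s‖ (‖c s‖ ^ 2)) μ := by
  have hp0 : p ≠ 0 := (zero_lt_one.trans hp.1).ne'
  have hpt : p ≠ ⊤ := ne_top_of_le_ne_top (by simp) hp.2
  have h1 := hc.integrable_norm_rpow hp0 hpt
  have hp1 : 1 ≤ p.toReal := by
    rw [← ENNReal.toReal_one]; exact ENNReal.toReal_mono hpt hp.1.le
  have hp2 : p.toReal ≤ 2 := by
    have := ENNReal.toReal_mono (by simp) hp.2; simpa using this
  refine h1.mono' (hc.1.norm.inf (hc.1.norm.pow 2)) (Eventually.of_forall fun s ↦ ?_)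
  rw [Real.norm_of_nonneg (le_min (norm_nonneg _) (by positivity))]
  rcases le_total 1 ‖c s‖ with h2 | h2
  · refine (min_le_left _ _).trans ?_
    simpa using Real.rpow_le_rpow_of_exponent_le h2 hp1
  · refine (min_le_right _ _).trans ?_
    rcases eq_or_lt_of_le (norm_nonneg (c s)) with h3 | h3
    · rw [← h3, Real.zero_rpow (by linarith)]; simp
    · simpa using Real.rpow_le_rpow_of_exponent_ge h3 h2 hp2

end majorant


/-! ### The integral equations for the modes. -/

theorem SplitBound.expIntegrable {t₀ β : ℝ} {w : ℝ → ℝ} {f : ℝ → ℂ} (hβ : 0 < β)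
    (hw : Integrable w) (hf : SplitBound t₀ w fun s ↦ ‖f s‖)
    (hfm : AEStronglyMeasurable f (volume.restrict (Ici t₀))) : ExpIntegrable t₀ β f :=
  ⟨hfm, by simpa using integrableOn_exp_kernel_mul_of_splitBound hβ hw hf hfm.norm 0⟩

theorem greenG_sub {T β : ℝ} (hβ : 0 ≤ β) {f g : ℝ → ℂ} (hf : ExpIntegrable T β f)
    (hg : ExpIntegrable T β g) {ω : ℂ} (hω : ω.re ≠ 0) (hβω : β ≤ |ω.re|) (t : ℝ) :
    greenG T ω f t - greenG T ω g t = greenG T ω (fun s ↦ f s - g s) t := by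
  rw [greenG, greenG, greenG, ← integral_sub (hf.integrableOn_greenFun_mul hβ hω hβω t)
    (hg.integrableOn_greenFun_mul hβ hω hβω t)]
  simp only [mul_sub]

/-- Solvability of the integral equations for the modes, with a majorant. -/
theorem exists_modes {m : ℕ} {γ : Fin m → ℂ} {b : ℝ} (hb : 0 < b)
    (hγ : ∀ j, 2 * b ≤ |(γ j).re|) {t₀ : ℝ} {w q : ℝ → ℝ} {f : ℝ → ℂ} (hw : Integrable w)
    (h0 : ∀ s, 0 < w s) (hf : SplitBound t₀ w fun s ↦ ‖f s‖)
    (hfm : AEStronglyMeasurable f (volume.restrict (Ici t₀))) (hq : SplitBound t₀ w q)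
    (hqm : AEStronglyMeasurable q (volume.restrict (Ici t₀))) {h : ℝ → (Fin m → ℂ) → ℂ}
    {C μ₀ : ℝ} (hC : 0 ≤ C) (hμ₀ : 0 < μ₀)
    (hlip : ∀ s, t₀ ≤ s → ∀ (u u' : Fin m → ℂ) (μ d : ℝ), 0 ≤ μ → μ ≤ μ₀ → 0 ≤ d →
      (∀ j, ‖u j‖ ≤ μ) → (∀ j, ‖u' j‖ ≤ μ) → (∀ j, ‖u j - u' j‖ ≤ d) →
      ‖h s u - h s u'‖ ≤ C * (q s + μ) * d)
    (hzero : ∀ s, h s (fun _ ↦ 0) = 0)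
    (hmeas : ∀ u : Fin m → ℝ → ℂ, (∀ j, Continuous (u j)) →
      AEStronglyMeasurable (fun s ↦ h s fun j ↦ u j s) (volume.restrict (Ici t₀))) :
    ∃ T R : ℝ, t₀ ≤ T ∧ 0 ≤ R ∧ (∀ s, T ≤ s → R * √(expConv (2 * b) w s) ≤ μ₀) ∧
      ∃ u : Fin m → ℝ → ℂ, (∀ j, Continuous (u j)) ∧
        (∀ j t, ‖u j t‖ ≤ R * √(expConv (2 * b) w t)) ∧
        (∀ j t, u j t = greenG t₀ (γ j) f t + greenG T (γ j) (fun s ↦ h s fun i ↦ u i s) t) ∧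
        IntegrableOn (fun s ↦ h s fun i ↦ u i s) (Ici T) := by
  have hb2 : 0 < 2 * b := by linarith
  have h0' : ∀ s, 0 ≤ w s := fun s ↦ (h0 s).le
  have hγ0 : ∀ j, (γ j).re ≠ 0 := fun j hj ↦ by
    have := hγ j
    rw [hj, abs_zero] at this; linarith
  set e : ℝ → ℝ := fun s ↦ √(expConv (2 * b) w s) with he
  have hepos : ∀ s, 0 < e s := fun s ↦ Real.sqrt_pos.2 (expConv_pos hb2.le hw h0 s)
  have hec : Continuous e := (continuous_expConv hb2.le hw).sqrt
  have hE := integrable_expConv hb2 hw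
  have hE0 : ∀ s, 0 ≤ expConv (2 * b) w s := fun s ↦ (expConv_pos hb2.le hw h0 s).le
  have he2 : Integrable fun s ↦ e s ^ 2 :=
    hE.congr (Eventually.of_forall fun s ↦ (Real.sq_sqrt (hE0 s)).symm)
  have heT : Tendsto e atTop (𝓝 0) := by
    simpa using (tendsto_expConv hb2 hw).sqrt
  have hes : SplitBound t₀ (expConv (2 * b) w) e := splitBound_sqrt hE0
  have hfE := hf.expIntegrable hb2 hw hfm
  obtain ⟨C₁, hC₁, hC₁'⟩ := exists_integral_exp_kernel_le_sqrt (t₀ := t₀) hb2 hw h0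
  have hp : ∀ j t, ‖greenG t₀ (γ j) f t‖ ≤ C₁ * e t := fun j t ↦
    (norm_greenG_le hb2.le hfE (hγ0 j) (hγ j) t).trans (hC₁' _ hf hfm.norm t)
  -- The forcing `f` contributes at most `C₁ e = (R / 2) e`, and the perturbation will add at most
  -- the same.
  set R : ℝ := 2 * C₁ with hR
  have hR0 : 0 ≤ R := by positivity
  -- Beyond `T₁` the ball lies in the range `μ ≤ μ₀` of the Lipschitz hypothesis. Beyond `T₂` and
  -- `T₃` the kernel averages of `q` and of `R e` are each at most `1 / (4 (C + 1))`, which gives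
  -- contraction by `1 / 2`.
  obtain ⟨T₁, hT₁⟩ := eventually_atTop.1
    (heT.eventually_lt_const (by positivity : 0 < μ₀ / (R + 1)))
  obtain ⟨T₂, hT₂⟩ := exists_forall_integral_exp_kernel_le hb hw h0' hq hqm
    (by positivity : 0 < 1 / (4 * (C + 1)))
  obtain ⟨T₃, hT₃⟩ := exists_forall_integral_exp_kernel_le hb hE hE0 hes
    hec.aestronglyMeasurable (by positivity : 0 < 1 / (4 * (C + 1) * (R + 1)))
  obtain ⟨T, hT0, hT1, hT2, hT3⟩ : ∃ T, t₀ ≤ T ∧ T₁ ≤ T ∧ T₂ ≤ T ∧ T₃ ≤ T :=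
    ⟨max (max t₀ T₁) (max T₂ T₃), by simp, by simp, by simp, by simp⟩
  have hsub : Ici T ⊆ Ici t₀ := Ici_subset_Ici.2 hT0
  have hRe : ∀ s, T ≤ s → R * e s ≤ μ₀ := by
    intro s hs
    have := hT₁ s (hT1.trans hs)
    rw [lt_div_iff₀ (by positivity)] at this
    nlinarith [hepos s]
  have hqe : IntegrableOn (fun s ↦ (q s + R * e s) * e s) (Ici T) := by
    have h1 := (integrableOn_mul_sqrt_expConv hb2 hw h0 hq hqm).mono_set hsub
    refine (h1.add (he2.const_mul R).integrableOn).congr (Eventually.of_forall fun s ↦ ?_)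
    simp only [Pi.add_apply]; ring
  have hdiff : ∀ v v' : Fin m → ℝ → ℂ, (∀ i t, ‖v i t‖ ≤ R) → (∀ i t, ‖v' i t‖ ≤ R) →
      ∀ D : ℝ, 0 ≤ D → (∀ i t, ‖v i t - v' i t‖ ≤ D) → ∀ s, T ≤ s →
      ‖h s (fun i ↦ (e s : ℂ) * v i s) - h s (fun i ↦ (e s : ℂ) * v' i s)‖ ≤
        D * (C * ((q s + R * e s) * e s)) := by
    intro v v' hv hv' D hD hvv s hs
    have hb' : ∀ (x : ℂ) (r : ℝ), ‖x‖ ≤ r → ‖(e s : ℂ) * x‖ ≤ r * e s := by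
      intro x r hx
      rw [norm_mul, Complex.norm_real, Real.norm_of_nonneg (hepos s).le, mul_comm]
      exact mul_le_mul_of_nonneg_right hx (hepos s).le
    refine (hlip s (hT0.trans hs) _ _ (R * e s) (D * e s) (mul_nonneg hR0 (hepos s).le)
      (hRe s hs) (mul_nonneg hD (hepos s).le) (fun j ↦ hb' _ _ (hv j s))
      (fun j ↦ hb' _ _ (hv' j s)) fun j ↦ ?_).trans (le_of_eq (by ring))
    rw [← mul_sub]
    exact hb' _ _ (hvv j s)
  have hcont : ∀ v : Fin m → ℝ → ℂ, (∀ i, Continuous (v i)) →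
      ∀ i, Continuous fun s ↦ (e s : ℂ) * v i s := fun v hv i ↦
    (Complex.continuous_ofReal.comp hec).mul (hv i)
  have hint : ∀ v : Fin m → ℝ → ℂ, (∀ i, Continuous (v i)) → (∀ i t, ‖v i t‖ ≤ R) →
      IntegrableOn (fun s ↦ h s fun i ↦ (e s : ℂ) * v i s) (Ici T) := by
    intro v hv hvR
    refine ((hqe.const_mul C).const_mul R).mono'
      ((hmeas _ (hcont v hv)).mono_measure (Measure.restrict_mono hsub le_rfl)) ?_
    filter_upwards [ae_restrict_mem measurableSet_Ici] with s hs
    have := hdiff v (fun _ _ ↦ 0) hvR (fun _ _ ↦ by simpa using hR0) R hR0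
      (fun i t ↦ by simpa using hvR i t) s hs
    simpa [hzero] using this
  have hexp : ∀ v : Fin m → ℝ → ℂ, (∀ i, Continuous (v i)) → (∀ i t, ‖v i t‖ ≤ R) →
      ExpIntegrable T (2 * b) (fun s ↦ h s fun i ↦ (e s : ℂ) * v i s) := fun v hv hvR ↦
    ExpIntegrable.of_integrableOn hb2.le (hint v hv hvR)
  have hkey : ∀ v v' : Fin m → ℝ → ℂ, (∀ i, Continuous (v i)) → (∀ i t, ‖v i t‖ ≤ R) →
      (∀ i, Continuous (v' i)) → (∀ i t, ‖v' i t‖ ≤ R) → ∀ D : ℝ, 0 ≤ D →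
      (∀ i t, ‖v i t - v' i t‖ ≤ D) → ∀ j t,
      ‖greenG T (γ j) (fun s ↦ h s fun i ↦ (e s : ℂ) * v i s) t -
        greenG T (γ j) (fun s ↦ h s fun i ↦ (e s : ℂ) * v' i s) t‖ ≤ e t * (D / 2) := by
    intro v v' hv hvR hv' hvR' D hD hvv j t
    rw [greenG_sub hb2.le (hexp v hv hvR) (hexp v' hv' hvR') (hγ0 j) (hγ j)]
    have hI := ExpIntegrable.of_integrableOn hb2.le ((hint v hv hvR).sub (hint v' hv' hvR'))
    refine (norm_greenG_le hb2.le hI (hγ0 j) (hγ j) t).trans ?_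
    have hq1 := (integrableOn_exp_kernel_mul_of_splitBound hb hw hq hqm t).mono_set hsub
    have he1 : IntegrableOn (fun s ↦ Real.exp (-b * |t - s|) * e s) (Ici T) :=
      (integrableOn_exp_kernel_mul_of_splitBound hb hE hes hec.aestronglyMeasurable t).mono_set hsub
    calc _ ≤ ∫ s in Ici T, (D * C * e t) * (Real.exp (-b * |t - s|) * q s +
            R * (Real.exp (-b * |t - s|) * e s)) := by
          refine setIntegral_mono_on (hI.integrableOn_kernel hb2.le t)
            ((hq1.add (he1.const_mul R)).const_mul _) measurableSet_Ici fun s hs ↦ ?_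
          have h1 := hdiff v v' hvR hvR' D hD hvv s hs
          -- Half of the decay of the kernel is spent on replacing `e s` by `e t`.
          have h2 := sqrt_expConv_le_exp_mul hb.le hw h0' t s
          have h3 : 0 ≤ q s + R * e s :=
            add_nonneg (hq s (hT0.trans hs)).1 (mul_nonneg hR0 (hepos s).le)
          calc _ ≤ Real.exp (-(2 * b) * |t - s|) * (D * (C * ((q s + R * e s) * e s))) :=
                mul_le_mul_of_nonneg_left h1 (Real.exp_pos _).le
            _ ≤ Real.exp (-(2 * b) * |t - s|) *
                (D * (C * ((q s + R * e s) * (Real.exp (b * |t - s|) * e t)))) := by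
                gcongr
            _ = (Real.exp (-(2 * b) * |t - s|) * Real.exp (b * |t - s|)) *
                (D * C * e t * (q s + R * e s)) := by ring
            _ = Real.exp (-b * |t - s|) * (D * C * e t * (q s + R * e s)) := by
                rw [← Real.exp_add]; congr 2; ring
            _ = _ := by ring
      _ = (D * C * e t) * ((∫ s in Ici T, Real.exp (-b * |t - s|) * q s) +
            R * ∫ s in Ici T, Real.exp (-b * |t - s|) * e s) := by
          rw [integral_const_mul, integral_add hq1 (he1.const_mul R), integral_const_mul]
      _ ≤ (D * C * e t) * (1 / (4 * (C + 1)) + R * (1 / (4 * (C + 1) * (R + 1)))) := by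
          have := (hepos t).le
          gcongr
          · exact hT₂ T hT2 hT0 t
          · exact hT₃ T hT3 hT0 t
      _ = e t * D * ((C / (C + 1)) * (1 / 4) * (1 + R / (R + 1))) := by
          field_simp
      _ ≤ e t * D * (1 * (1 / 4) * (1 + 1)) := by
          have := (hepos t).le
          gcongr
          · exact div_le_one_of_le₀ (by linarith) (by linarith)
          · exact div_le_one_of_le₀ (by linarith) (by linarith)
      _ = _ := by ring
  -- The unknown is `v = u / e`. The forcing acts from `t₀`, as in the final formula; the
  -- perturbation acts only from `T`, where the estimates are small.
  set Φ : (Fin m → ℝ → ℂ) → Fin m → ℝ → ℂ := fun v j t ↦ ((e t : ℂ))⁻¹ *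
    (greenG t₀ (γ j) f t + greenG T (γ j) (fun s ↦ h s fun i ↦ (e s : ℂ) * v i s) t) with hΦ
  have hen : ∀ t, ‖((e t : ℂ))⁻¹‖ = (e t)⁻¹ := fun t ↦ by
    rw [norm_inv, Complex.norm_real, Real.norm_of_nonneg (hepos t).le]
  have hne : ∀ t, (e t : ℂ) ≠ 0 := fun t ↦ by exact_mod_cast (hepos t).ne'
  obtain ⟨v, hvc, hvR, hfix⟩ := exists_fixedPoint_of_bounds hR0 Φ
    (by
      intro v hv hvR j
      exact ((Complex.continuous_ofReal.comp hec).inv₀ hne).mul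
        ((continuous_greenG hb2.le hfE (hγ0 j) (hγ j)).add
          (continuous_greenG hb2.le (hexp v hv hvR) (hγ0 j) (hγ j))))
    (by
      intro v hv hvR j t
      have h1 := hkey v (fun _ _ ↦ 0) hv hvR (fun _ ↦ continuous_const)
        (fun _ _ ↦ by simpa using hR0) R hR0 (fun i t ↦ by simpa using hvR i t) j t
      have h2 : greenG T (γ j) (fun s ↦ h s fun i ↦ (e s : ℂ) * (0 : ℂ)) t = 0 := by
        simp [hzero, greenG]
      rw [h2, sub_zero] at h1
      simp only [hΦ, norm_mul, hen]
      rw [inv_mul_le_iff₀ (hepos t)]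
      refine (norm_add_le _ _).trans ((add_le_add (hp j t) h1).trans (le_of_eq ?_))
      rw [hR]; ring)
    (by
      intro v v' hv hvR hv' hvR' D hD hvv j t
      simp only [hΦ]
      rw [← mul_sub, add_sub_add_left_eq_sub, norm_mul, hen, inv_mul_le_iff₀ (hepos t)]
      exact hkey v v' hv hvR hv' hvR' D hD hvv j t)
  refine ⟨T, R, hT0, hR0, hRe, fun j t ↦ (e t : ℂ) * v j t, hcont v hvc, fun j t ↦ ?_,
    fun j t ↦ ?_, hint v hvc hvR⟩
  · rw [norm_mul, Complex.norm_real, Real.norm_of_nonneg (hepos t).le, mul_comm]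
    exact mul_le_mul_of_nonneg_right (hvR j t) (hepos t).le
  · have h1 : v j t = Φ v j t := by rw [hfix]
    change (e t : ℂ) * v j t = _
    rw [h1]
    simp only [hΦ]
    rw [mul_inv_cancel_left₀ (hne t)]


/-! ### The common weight, and the perturbation in terms of the modes. -/

theorem exists_weight {N : ℕ} {t₀ : ℝ} {c : ℕ → ℝ → ℂ} {p : ℕ → ENNReal}
    (hp : ∀ k ∈ Finset.range N, 1 < p k ∧ p k ≤ 2)
    (hc : ∀ k ∈ Finset.range N, MemLp (c k) (p k) (volume.restrict (Ici t₀))) :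
    ∃ w : ℝ → ℝ, Integrable w ∧ (∀ s, 0 < w s) ∧
      ∀ k ∈ Finset.range N, SplitBound t₀ w fun s ↦ ‖c k s‖ := by
  set g : ℝ → ℝ := fun s ↦ ∑ k ∈ Finset.range N, min ‖c k s‖ (‖c k s‖ ^ 2) with hg
  have hm0 : ∀ k s, 0 ≤ min ‖c k s‖ (‖c k s‖ ^ 2) := fun k s ↦
    le_min (norm_nonneg _) (by positivity)
  have hg0 : ∀ s, 0 ≤ g s := fun s ↦ Finset.sum_nonneg fun k _ ↦ hm0 k s
  have hgi : IntegrableOn g (Ici t₀) := integrable_finsetSum _ fun k hk ↦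
    integrable_min_of_memLp (hp k hk) (hc k hk)
  -- The summand `(1 + s²)⁻¹` makes `w` strictly positive, so that one can divide by the majorant.
  refine ⟨fun s ↦ (Ici t₀).indicator g s + (1 + s ^ 2)⁻¹,
    ((integrable_indicator_iff measurableSet_Ici).2 hgi).add integrable_inv_one_add_sq,
    fun s ↦ ?_, fun k hk ↦ splitBound_min fun s hs ↦ ?_⟩
  · have h1 : 0 ≤ (Ici t₀).indicator g s := indicator_nonneg (fun s _ ↦ hg0 s) s
    positivity
  · rw [indicator_of_mem (mem_Ici.2 hs)]
    have h1 := Finset.single_le_sum (f := fun k ↦ min ‖c k s‖ (‖c k s‖ ^ 2))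
      (fun k _ ↦ hm0 k s) hk
    have h2 : 0 ≤ (1 + s ^ 2)⁻¹ := by positivity
    exact h1.trans (by linarith)

/-- The bound `η + w / η` is stable under averages but not under sums; the lost factor `N` goes into
the Lipschitz constant. -/
theorem splitBound_average {N : ℕ} (hN : 0 < N) {t₀ : ℝ} {w : ℝ → ℝ} {c : ℕ → ℝ → ℝ}
    (h : ∀ k ∈ Finset.range N, SplitBound t₀ w (c k)) :
    SplitBound t₀ w fun s ↦ (∑ k ∈ Finset.range N, c k s) / N := by
  have hN' : (0 : ℝ) < N := by exact_mod_cast hN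
  refine fun s hs ↦ ⟨div_nonneg (Finset.sum_nonneg fun k hk ↦ (h k hk s hs).1) hN'.le,
    fun η hη hη1 ↦ ?_⟩
  rw [div_le_iff₀ hN']
  calc _ ≤ ∑ k ∈ Finset.range N, (η + w s / η) :=
        Finset.sum_le_sum fun k hk ↦ (h k hk s hs).2 η hη hη1
    _ = _ := by
        rw [Finset.sum_const, Finset.card_range, nsmul_eq_mul, mul_comm]

theorem modeJet_sub {m : ℕ} (γ : Fin m → ℂ) (u u' : Fin m → ℂ) (k : ℕ) :
    modeJet γ u k - modeJet γ u' k = modeJet γ (fun j ↦ u j - u' j) k := by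
  simp only [modeJet, mul_sub, Finset.sum_sub_distrib]; ring

theorem modeJet_zero {m : ℕ} (γ : Fin m → ℂ) : modeJet γ (fun _ ↦ 0) = fun _ ↦ 0 := by
  funext k; simp [modeJet]

theorem exists_norm_modeJet_le {m : ℕ} (γ : Fin m → ℂ) (N : ℕ) : ∃ M : ℝ, 1 ≤ M ∧
    ∀ (u : Fin m → ℂ) (μ : ℝ), 0 ≤ μ → (∀ j, ‖u j‖ ≤ μ) → ∀ k < N, ‖modeJet γ u k‖ ≤ M * μ := by
  have h0 : 0 ≤ ∑ k ∈ Finset.range N, ∑ j, ‖γ j ^ k / Gam γ j‖ :=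
    Finset.sum_nonneg fun _ _ ↦ Finset.sum_nonneg fun _ _ ↦ norm_nonneg _
  refine ⟨1 + ∑ k ∈ Finset.range N, ∑ j, ‖γ j ^ k / Gam γ j‖, by linarith,
    fun u μ hμ hu k hk ↦ ?_⟩
  rw [modeJet, norm_neg]
  calc _ ≤ ∑ j, ‖γ j ^ k / Gam γ j‖ * μ := by
        refine norm_sum_le_of_le _ fun j _ ↦ ?_
        rw [norm_mul]
        exact mul_le_mul_of_nonneg_left (hu j) (norm_nonneg _)
    _ = (∑ j, ‖γ j ^ k / Gam γ j‖) * μ := by rw [Finset.sum_mul]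
    _ ≤ _ := by
        refine mul_le_mul_of_nonneg_right ?_ hμ
        have := Finset.single_le_sum (f := fun k ↦ ∑ j, ‖γ j ^ k / Gam γ j‖)
          (fun k _ ↦ Finset.sum_nonneg fun _ _ ↦ norm_nonneg _) (Finset.mem_range.2 hk)
        linarith

theorem continuous_modeJet {m : ℕ} (γ : Fin m → ℂ) {u : Fin m → ℝ → ℂ}
    (hu : ∀ j, Continuous (u j)) (k : ℕ) : Continuous fun t ↦ modeJet γ (fun j ↦ u j t) k :=
  (continuous_finsetSum _ fun j _ ↦ continuous_const.mul (hu j)).neg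

section

variable {n : ℕ} {a : Fin n → ℂ} {r : Fin n → ℝ → ℂ} {lam : ℂ} {μ : Measure ℝ}

theorem aestronglyMeasurable_linPart
    (hm : ∀ k ∈ Finset.range (n + 1), AEStronglyMeasurable (pertDeriv r lam k) μ)
    {x : ℕ → ℝ → ℂ} (hx : ∀ k, Continuous (x k)) :
    AEStronglyMeasurable (fun s ↦ linPart r lam s fun k ↦ x k s) μ := by
  refine Finset.aestronglyMeasurable_fun_sum _ fun k hk ↦ ?_
  have hk' := Finset.mem_Icc.1 hk
  exact ((hm k (Finset.mem_range.2 (by omega))).const_mul _).mul (hx _).aestronglyMeasurable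

theorem aestronglyMeasurable_nonlinPart
    (hm : ∀ k ∈ Finset.range (n + 1), AEStronglyMeasurable (pertDeriv r lam k) μ)
    {x : ℕ → ℝ → ℂ} (hx : ∀ k, Continuous (x k)) :
    AEStronglyMeasurable (fun s ↦ nonlinPart a r lam s fun k ↦ x k s) μ := by
  simp only [nonlinPart_eq]
  refine Finset.aestronglyMeasurable_fun_sum _ fun k hk ↦ ?_
  have hk' := Finset.mem_Icc.1 hk
  have h1 : Continuous fun s ↦ completeBell (fun k ↦ x k s) k :=
    continuous_iff_continuousAt.2 fun s ↦ tendsto_completeBell fun k _ ↦ (hx k).continuousAt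
  exact (aestronglyMeasurable_const.add
    ((hm k (Finset.mem_range.2 (by omega))).const_mul _)).mul
    (h1.sub (hx _)).aestronglyMeasurable

theorem exists_perturbation_lipschitz (hn : 2 ≤ n) {m : ℕ} (γ : Fin m → ℂ) :
    ∃ C μ₀ : ℝ, 0 ≤ C ∧ 0 < μ₀ ∧ ∀ (s : ℝ) (u u' : Fin m → ℂ) (μ d : ℝ), 0 ≤ μ → μ ≤ μ₀ → 0 ≤ d →
      (∀ j, ‖u j‖ ≤ μ) → (∀ j, ‖u' j‖ ≤ μ) → (∀ j, ‖u j - u' j‖ ≤ d) →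
      ‖(linPart r lam s (modeJet γ u) + nonlinPart a r lam s (modeJet γ u)) -
        (linPart r lam s (modeJet γ u') + nonlinPart a r lam s (modeJet γ u'))‖ ≤
        C * (pertSum r lam s / ((n + 1 : ℕ) : ℝ) + μ) * d := by
  obtain ⟨M, hM1, hM⟩ := exists_norm_modeJet_le γ (n - 1)
  obtain ⟨C, hC0, hC⟩ := exists_nonlinPart_lipschitz a r lam
  have hM0 : 0 < M := by linarith
  -- The threshold `μ₀ = 1 / M` keeps the jet in the unit ball and allows `M μ ≤ 1` in the product
  -- of the coefficients with the quadratic part. The factor `n + 1` undoes the average.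
  refine ⟨((n + 1 : ℕ) : ℝ) * (M + C * M) + C * M ^ 2, 1 / M, by positivity, by positivity,
    fun s u u' μ d hμ0 hμ hd hu hu' huu ↦ ?_⟩
  have hMμ : M * μ ≤ 1 := by rw [le_div_iff₀ hM0] at hμ; linarith
  have hx := hM u μ hμ0 hu
  have hx' := hM u' μ hμ0 hu'
  have hxx : ∀ k < n - 1, ‖modeJet γ u k - modeJet γ u' k‖ ≤ M * d := fun k hk ↦ by
    rw [modeJet_sub]; exact hM _ d hd huu k hk
  have h1 := norm_linPart_sub_le hn r lam s hxx
  have h2 := hC s _ _ (M * μ) (M * d) (by positivity) hMμ (by positivity) hx hx' hxx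
  have hS := pertSum_nonneg r lam s
  set S := pertSum r lam s
  have hN : (0 : ℝ) < ((n + 1 : ℕ) : ℝ) := by positivity
  rw [add_sub_add_comm]
  refine (norm_add_le _ _).trans ((add_le_add h1 h2).trans ?_)
  have h3 : C * S * (M * μ) * (M * d) ≤ C * S * 1 * (M * d) := by gcongr
  have h4 : (((n + 1 : ℕ) : ℝ) * (M + C * M) + C * M ^ 2) * (S / ((n + 1 : ℕ) : ℝ) + μ) * d =
      (M + C * M) * S * d + C * M ^ 2 * (S / ((n + 1 : ℕ) : ℝ)) * d +
        ((n + 1 : ℕ) : ℝ) * (M + C * M) * μ * d + C * M ^ 2 * μ * d := by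
    field_simp
    ring
  rw [h4]
  have h5 : 0 ≤ C * M ^ 2 * (S / ((n + 1 : ℕ) : ℝ)) * d := by positivity
  have h6 : 0 ≤ ((n + 1 : ℕ) : ℝ) * (M + C * M) * μ * d := by positivity
  nlinarith

end


/-! ### From `z` to `y`, and continuation back to `t₀`. -/

/-- A solution of the first order system on `[T, ∞)` extends backward to `[t₀, ∞)`. -/
theorem exists_isSolution_extension {n : ℕ} (hn : 1 ≤ n) {t₀ T : ℝ} (hT : t₀ ≤ T) {a : Fin n → ℂ}
    {r : Fin n → ℝ → ℂ} (hr : ∀ i b, IntegrableOn (r i) (Icc t₀ b)) {Y : ℕ → ℝ → ℂ}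
    (hc : ∀ i < n, ContinuousOn (Y i) (Ici T))
    (hi : ∀ i < n, ∀ t, T ≤ t → Y i t = Y i T + ∫ s in T..t, Y (i + 1) s)
    (hlast : ∀ t, T ≤ t → Y n t = -∑ i : Fin n, (a i + r i t) * Y i t) :
    ∃ y : ℝ → ℂ, IsSolution t₀ a r y ∧
      ∀ k < n, ∀ t, T ≤ t → iteratedDerivWithin k y (Ici t₀) t = Y k t := by
  -- Companion matrix of the equation.
  set A : Fin n → Fin n → ℝ → ℂ := fun i j s ↦
    if (i : ℕ) + 1 < n then (if (j : ℕ) = i + 1 then 1 else 0) else -(a j + r j s) with hA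
  have hAi : ∀ i j, IntegrableOn (A i j) (Icc t₀ T) := by
    intro i j
    by_cases h : (i : ℕ) + 1 < n
    · simp only [hA, if_pos h]
      exact integrableOn_const (by simp)
    · simp only [hA, if_neg h]
      exact ((integrableOn_const (by simp)).add (hr j T)).neg
  obtain ⟨X, hXc, hX⟩ := exists_linear_system_solution A hAi (fun i ↦ Y i T)
  have hXT : ∀ i, X i T = Y i T := fun i ↦ by simpa using hX i T ⟨hT, le_rfl⟩
  -- The two pieces are glued at `T`; `max t T` is there because `Y i` is known to be continuous
  -- only on `[T, ∞)`.
  set Z : ℕ → ℝ → ℂ := fun i t ↦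
    if h : i < n then (if t ≤ T then X ⟨i, h⟩ t else Y i (max t T)) else 0 with hZ
  have hZc : ∀ i < n, Continuous (Z i) := by
    intro i h
    simp only [hZ, dif_pos h]
    refine Continuous.if_le (hXc _) ((hc i h).comp_continuous (by fun_prop)
      fun t ↦ mem_Ici.2 (le_max_right _ _)) continuous_id continuous_const fun t ht ↦ ?_
    rw [show t = T from ht, max_self, hXT]
  have hZY : ∀ i < n, ∀ t, T ≤ t → Z i t = Y i t := by
    intro i h t ht
    simp only [hZ, dif_pos h]
    split_ifs with h'
    · rw [le_antisymm h' ht, hXT]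
    · rw [max_eq_left ht]
  have hZX : ∀ (i : Fin n) (t), t ≤ T → Z i t = X i t := by
    intro i t ht
    simp [hZ, ht]
  have hXi : ∀ (i : Fin n), (i : ℕ) + 1 < n → ∀ s ≤ T, ∑ j, A i j s * X j s = Z (i + 1) s := by
    intro i h s hs
    simp only [hA, if_pos h]
    rw [Finset.sum_eq_single ⟨i + 1, h⟩]
    · simp [hZ, h, hs]
    · intro j _ hj
      rw [if_neg fun hj' ↦ hj (Fin.ext hj'), zero_mul]
    · simp
  have hXl : ∀ (i : Fin n), ¬ (i : ℕ) + 1 < n → ∀ s ≤ T, ∑ j, A i j s * X j s =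
      -∑ i : Fin n, (a i + r i s) * Z i s := by
    intro i h s hs
    simp only [hA, if_neg h, ← Finset.sum_neg_distrib, neg_mul]
    exact Finset.sum_congr rfl fun j _ ↦ by rw [hZX j s hs]
  have hint : ∀ b, t₀ ≤ b →
      IntervalIntegrable (fun s ↦ -∑ i : Fin n, (a i + r i s) * Z i s) volume t₀ b := by
    intro b hb
    rw [intervalIntegrable_iff_integrableOn_Icc_of_le hb]
    refine Integrable.neg (integrable_finsetSum _ fun i _ ↦ ?_)
    exact IntegrableOn.mul_continuousOn ((integrableOn_const (by simp)).add (hr i b))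
      (hZc i i.2).continuousOn isCompact_Icc
  have heq : ∀ i, ∀ h : i < n, ∀ g : ℝ → ℂ, (∀ s ≤ T, t₀ ≤ s → ∑ j, A ⟨i, h⟩ j s * X j s = g s) →
      (∀ s, T ≤ s → Y (i + 1) s = g s) → ∀ t, t₀ ≤ t → Z i t = Z i T + ∫ s in T..t, g s := by
    intro i h g hg1 hg2 t ht
    rw [hZY i h T le_rfl]
    rcases le_total t T with h' | h'
    · rw [show Z i t = X ⟨i, h⟩ t from hZX ⟨i, h⟩ t h', hX _ t ⟨ht, h'⟩]
      congr 1
      refine intervalIntegral.integral_congr fun s hs ↦ ?_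
      rw [uIcc_of_ge h'] at hs
      exact hg1 s hs.2 (ht.trans hs.1)
    · rw [hZY i h t h', hi i h t h']
      congr 1
      refine intervalIntegral.integral_congr fun s hs ↦ ?_
      rw [uIcc_of_le h'] at hs
      exact hg2 s hs.1
  obtain ⟨h1, h2⟩ := isSolution_of_integral_eq hn hT (a := a) (r := r) (Y := Z)
    (fun i h ↦ (hZc i h).continuousOn)
    (fun i h ↦ heq i (by omega) _ (fun s hs _ ↦ hXi ⟨i, by omega⟩ h s hs)
      fun s hs ↦ (hZY (i + 1) h s hs).symm) hint
    (heq (n - 1) (by omega) _ (fun s hs _ ↦ hXl ⟨n - 1, by omega⟩ (by simp; omega) s hs)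
      fun s hs ↦ by
        rw [show n - 1 + 1 = n by omega, hlast s hs]
        congr 1
        exact Finset.sum_congr rfl fun i _ ↦ by rw [hZY i i.2 s hs])
  exact ⟨Z 0, h1, fun k hk t ht ↦ (h2 k hk (hT.trans ht)).trans (hZY k hk t ht)⟩

/-- From the jet of `z` to the derivatives of `y = exp (∫ (lam + z))`. -/
theorem exp_mul_shiftBell_eq_integral {n : ℕ} (hn : 2 ≤ n) {t₀ T : ℝ} (hT : t₀ ≤ T)
    {a : Fin n → ℂ} {r : Fin n → ℝ → ℂ} (hr : ∀ i b, IntegrableOn (r i) (Icc t₀ b)) {lam : ℂ}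
    {x : ℕ → ℝ → ℂ} {Q : ℝ → ℂ} (hxc : ∀ k < n - 1, ContinuousOn (x k) (Ici T))
    (hxi : ∀ k < n - 1, ∀ b, T ≤ b → IntervalIntegrable (x (k + 1)) volume T b)
    (hx : ∀ k < n - 1, ∀ t, T ≤ t → x k t = x k T + ∫ s in T..t, x (k + 1) s)
    (hQ : ∀ t, T ≤ t → Q t = Q T + ∫ s in T..t, x 0 s)
    (heq : ∀ t, T ≤ t → ∑ i : Fin n, (a i + r i t) * shiftBell lam (fun k ↦ x k t) i +
      shiftBell lam (fun k ↦ x k t) n = 0)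
    {Y : ℕ → ℝ → ℂ} (hY : ∀ i t, Y i t =
      Complex.exp (lam * ((t - t₀ : ℝ) : ℂ) + Q t) * shiftBell lam (fun k ↦ x k t) i) :
    (∀ i < n, ContinuousOn (Y i) (Ici T)) ∧
    (∀ i < n, ∀ t, T ≤ t → Y i t = Y i T + ∫ s in T..t, Y (i + 1) s) ∧
    (∀ t, T ≤ t → Y n t = -∑ i : Fin n, (a i + r i t) * Y i t) := by
  set E : ℝ → ℂ := fun t ↦ Complex.exp (lam * ((t - t₀ : ℝ) : ℂ) + Q t) with hE
  obtain rfl : Y = fun i t ↦ E t * shiftBell lam (fun k ↦ x k t) i := by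
    funext i t; exact hY i t
  have hlin : ∀ t : ℝ, HasDerivAt (fun t : ℝ ↦ lam * ((t - t₀ : ℝ) : ℂ)) lam t := by
    intro t
    have h1 : HasDerivAt (fun t : ℝ ↦ ((t - t₀ : ℝ) : ℂ)) 1 t :=
      HasDerivAt.ofReal_comp (by simpa using (hasDerivAt_id t).sub_const t₀)
    simpa using h1.const_mul lam
  have hEd : ∀ t, T ≤ t → HasDerivWithinAt E (E t * (lam + x 0 t)) (Ici T) t := by
    intro t ht
    have h1 := hasDerivWithinAt_of_eq_integral le_rfl (hxc 0 (by omega)) hQ ht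
    exact ((hlin t).hasDerivWithinAt.add h1).cexp
  have hEc : ContinuousOn E (Ici T) := fun t ht ↦ (hEd t ht).continuousWithinAt
  have hE1 : ContDiffOn ℝ 1 E (Ici T) := by
    rw [contDiffOn_one_iff_derivWithin (uniqueDiffOn_Ici T)]
    refine ⟨fun t ht ↦ (hEd t ht).differentiableWithinAt, ?_⟩
    refine (hEc.mul ((continuousOn_const (c := lam)).add (hxc 0 (by omega)))).congr fun t ht ↦ ?_
    exact (hEd t ht).derivWithin (uniqueDiffOn_Ici T t ht)
  have hcont : ∀ i < n, ContinuousOn (fun t ↦ E t * shiftBell lam (fun k ↦ x k t) i) (Ici T) := by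
    intro i h
    exact hEc.mul fun t ht ↦ tendsto_shiftBell fun k hk ↦ hxc k (by omega) t ht
  have hlast : ∀ t, T ≤ t → E t * shiftBell lam (fun k ↦ x k t) n =
      -∑ i : Fin n, (a i + r i t) * (E t * shiftBell lam (fun k ↦ x k t) i) := by
    intro t ht
    have h1 := heq t ht
    have h2 : ∑ i : Fin n, (a i + r i t) * (E t * shiftBell lam (fun k ↦ x k t) i) =
        E t * ∑ i : Fin n, (a i + r i t) * shiftBell lam (fun k ↦ x k t) i := by
      rw [Finset.mul_sum]
      exact Finset.sum_congr rfl fun i _ ↦ by ring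
    rw [h2]
    linear_combination E t * h1
  refine ⟨hcont, fun i h t ht ↦ ?_, hlast⟩
  have huIcc : uIcc T t = Icc T t := uIcc_of_le ht
  have hsub : uIcc T t ⊆ Ici T := by rw [huIcc]; exact Icc_subset_Ici_self
  have hac : AbsolutelyContinuousOnInterval
      (fun t ↦ E t * shiftBell lam (fun k ↦ x k t) i) T t := by
    have h1 : AbsolutelyContinuousOnInterval E T t :=
      (hE1.mono hsub).absolutelyContinuousOnInterval
    have h2 : AbsolutelyContinuousOnInterval
        (fun t ↦ shiftBell lam (fun k ↦ x k t) i) T t :=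
      absolutelyContinuous_shiftBell fun k hk ↦
        absolutelyContinuousOnInterval_of_eq_integral left_mem_uIcc
          (hxi k (by omega) t ht) fun s hs ↦ hx k (by omega) s (hsub hs)
    exact h1.fun_smul h2
  have hint : IntervalIntegrable (fun t ↦ E t * shiftBell lam (fun k ↦ x k t) (i + 1))
      volume T t := by
    -- The top derivative need not be continuous; its integrability is read off from the equation.
    rcases Nat.lt_or_ge (i + 1) n with h' | h'
    · exact ((hcont (i + 1) h').mono hsub).intervalIntegrable
    · obtain rfl : n = i + 1 := by omega
      have h1 : IntervalIntegrable (fun t ↦ -∑ j : Fin (i + 1),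
          (a j + r j t) * (E t * shiftBell lam (fun k ↦ x k t) j)) volume T t := by
        rw [intervalIntegrable_iff_integrableOn_Icc_of_le ht]
        refine Integrable.neg (integrable_finsetSum _ fun j _ ↦ ?_)
        exact IntegrableOn.mul_continuousOn ((integrableOn_const (by simp)).add
          ((hr j t).mono_set (Icc_subset_Icc_left hT)))
          ((hcont j j.2).mono Icc_subset_Ici_self) isCompact_Icc
      refine h1.congr fun s hs ↦ ?_
      rw [uIoc_of_le ht] at hs
      exact (hlast s hs.1.le).symm
  refine eq_add_integral_of_absolutelyContinuous hac hint ?_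
  have h1 : ∀ᵐ s ∂(volume.restrict (Ici T)), ∀ k ∈ Finset.range (n - 1),
      HasDerivAt (x k) (x (k + 1) s) s := by
    rw [Filter.eventually_all_finset]
    intro k hk
    have hk' := Finset.mem_range.1 hk
    exact ae_hasDerivAt_of_eq_integral le_rfl (hxi k hk') (hx k hk')
  rw [ae_restrict_iff' measurableSet_Ici] at h1
  have h2 : ∀ᵐ s : ℝ, s ≠ T := by simp [ae_iff, measure_singleton]
  filter_upwards [h1, h2] with s hs hsT hmem
  have hTs : T < s := lt_of_le_of_ne (hsub hmem) hsT.symm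
  have h3 := (hEd s hTs.le).hasDerivAt (Ici_mem_nhds hTs)
  have h4 := hasDerivAt_shiftBell (lam := lam) (x := x) (t := s) (i := i)
    fun k hk ↦ hs (hsub hmem) k (Finset.mem_range.2 (by omega))
  refine (h3.mul h4).congr_deriv ?_
  ring

/-- The jet of `z`: the modes give `z, …, z^(n-2)`, and `z^(n-1)` involves the forcing term. -/
noncomputable def fullJet {m : ℕ} (γ : Fin m → ℂ) (u : Fin m → ℝ → ℂ) (g : ℝ → ℂ) (k : ℕ) (t : ℝ) :
    ℂ :=
  modeJet γ (fun j ↦ u j t) k - if k = m then g t else 0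

section fullJet

variable {m : ℕ} {γ : Fin m → ℂ} {u : Fin m → ℝ → ℂ} {g : ℝ → ℂ}

theorem fullJet_of_lt {k : ℕ} (hk : k < m) (t : ℝ) :
    fullJet γ u g k t = modeJet γ (fun j ↦ u j t) k := by
  rw [fullJet, if_neg hk.ne, sub_zero]

/-- By `sum_pow_div_Gam` the terms in `g` cancel for `k + 1 < m` and leave `-g` for `k + 1 = m`,
which is the correction built into `fullJet`. -/
theorem fullJet_eq_integral (hγ : Function.Injective γ) {T t : ℝ} (hu : ∀ j, Continuous (u j))
    (hg : IntervalIntegrable g volume T t)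
    (heq : ∀ j, u j t = u j T + ∫ s in T..t, (γ j * u j s + g s)) {k : ℕ} (hk : k < m) :
    fullJet γ u g k t = fullJet γ u g k T + ∫ s in T..t, fullJet γ u g (k + 1) s := by
  have hint : ∀ j, IntervalIntegrable (fun s ↦ γ j ^ k / Gam γ j * (γ j * u j s + g s))
      volume T t := fun j ↦
    ((((hu j).const_mul (γ j)).intervalIntegrable _ _).add hg).const_mul _
  rw [fullJet_of_lt hk, fullJet_of_lt hk, modeJet, modeJet]
  have h1 : ∑ j, γ j ^ k / Gam γ j * u j t = ∑ j, γ j ^ k / Gam γ j * u j T +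
      ∫ s in T..t, ∑ j, γ j ^ k / Gam γ j * (γ j * u j s + g s) := by
    rw [intervalIntegral.integral_finsetSum fun j _ ↦ hint j, ← Finset.sum_add_distrib]
    refine Finset.sum_congr rfl fun j _ ↦ ?_
    rw [intervalIntegral.integral_const_mul, heq j]; ring
  rw [h1, neg_add, ← intervalIntegral.integral_neg]
  congr 1
  refine intervalIntegral.integral_congr fun s _ ↦ ?_
  have h2 := sum_pow_div_Gam hγ hk
  simp only [fullJet, modeJet]
  have h3 : ∑ j, γ j ^ k / Gam γ j * (γ j * u j s + g s) =
      ∑ j, γ j ^ (k + 1) / Gam γ j * u j s + (∑ j, γ j ^ k / Gam γ j) * g s := by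
    rw [Finset.sum_mul, ← Finset.sum_add_distrib]
    exact Finset.sum_congr rfl fun j _ ↦ by ring
  rw [h3, h2]
  split_ifs <;> ring

theorem intervalIntegrable_fullJet {T t : ℝ} (hu : ∀ j, Continuous (u j))
    (hg : IntervalIntegrable g volume T t) (k : ℕ) :
    IntervalIntegrable (fullJet γ u g k) volume T t := by
  have h1 := (continuous_modeJet γ hu k).intervalIntegrable (μ := volume) T t
  by_cases h : k = m
  · have : fullJet γ u g k = fun t ↦ modeJet γ (fun j ↦ u j t) k - g t := by
      funext s; rw [fullJet, if_pos h]
    rw [this]; exact h1.sub hg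
  · have : fullJet γ u g k = fun t ↦ modeJet γ (fun j ↦ u j t) k := by
      funext s; rw [fullJet, if_neg h, sub_zero]
    rw [this]; exact h1

theorem jet_fullJet (hγ : Function.Injective γ) {T : ℝ} (hu : ∀ j, Continuous (u j))
    (hg : ∀ t, T ≤ t → IntervalIntegrable g volume T t)
    (heq : ∀ j t, T ≤ t → u j t = u j T + ∫ s in T..t, (γ j * u j s + g s)) {k : ℕ} (hk : k < m)
    {t : ℝ} (ht : T ≤ t) : jet T (fullJet γ u g 0) t k = fullJet γ u g k t := by
  refine iteratedDerivWithin_eq_of_hasDerivWithinAt (m := m - 1) (fun k hk s hs ↦ ?_) k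
    (by omega) (mem_Ici.2 ht)
  refine hasDerivWithinAt_of_eq_integral le_rfl ?_
    (fun t ht ↦ fullJet_eq_integral hγ hu (hg t ht) (fun j ↦ heq j t ht) (by omega)) hs
  exact (continuous_modeJet γ hu (k + 1)).continuousOn.congr fun s _ ↦
    fullJet_of_lt (by omega) s

end fullJet


/-! ### The equation for the jet, the exponent and its error. -/

theorem exists_pos_two_mul_le_abs_re {m : ℕ} (hm : 1 ≤ m) {γ : Fin m → ℂ}
    (h : ∀ j, (γ j).re ≠ 0) : ∃ b : ℝ, 0 < b ∧ ∀ j, 2 * b ≤ |(γ j).re| := by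
  have : Nonempty (Fin m) := ⟨⟨0, hm⟩⟩
  obtain ⟨j₀, _, hj₀⟩ := Finset.univ.exists_min_image (fun j ↦ |(γ j).re|) Finset.univ_nonempty
  exact ⟨|(γ j₀).re| / 2, by have := abs_pos.2 (h j₀); linarith,
    fun j ↦ by have := hj₀ j (Finset.mem_univ j); linarith⟩

/-- The jet equation, for a jet built from modes. -/
theorem sum_mul_shiftBell_fullJet {n : ℕ} (hn : 2 ≤ n) {a : Fin n → ℂ} {r : Fin n → ℝ → ℂ}
    {lam : ℂ} {lams : Fin (n - 1) → ℂ} (hroots : charPoly a =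
      (Polynomial.X - Polynomial.C lam) * ∏ j, (Polynomial.X - Polynomial.C (lams j)))
    {u : Fin (n - 1) → ℝ → ℂ} {g : ℝ → ℂ} {t : ℝ}
    (hg : g t = pertDeriv r lam 0 t +
      (linPart r lam t (modeJet (fun j ↦ lams j - lam) fun j ↦ u j t) +
        nonlinPart a r lam t (modeJet (fun j ↦ lams j - lam) fun j ↦ u j t))) :
    ∑ i : Fin n, (a i + r i t) *
        shiftBell lam (fun k ↦ fullJet (fun j ↦ lams j - lam) u g k t) i +
      shiftBell lam (fun k ↦ fullJet (fun j ↦ lams j - lam) u g k t) n = 0 := by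
  set γ := fun j ↦ lams j - lam
  have hlt : ∀ k < n - 1, fullJet γ u g k t = modeJet γ (fun j ↦ u j t) k :=
    fun k hk ↦ fullJet_of_lt hk t
  rw [sum_coeff_mul_shiftBell_eq hn hroots, linPart_congr r lam t hlt,
    nonlinPart_congr a r lam t hlt]
  -- The modes are annihilated, so only the forcing inside the top derivative survives, with leading
  -- coefficient `1`.
  have h1 : ∑ k ∈ Finset.range n, ((charPoly a).taylor lam).coeff (k + 1) * fullJet γ u g k t =
      -g t := by
    have h2 := sum_taylor_coeff_mul_modeJet (by omega) hroots fun j ↦ u j t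
    have h3 := taylor_charPoly_coeff_self (by omega) hroots
    simp only [fullJet, mul_sub, Finset.sum_sub_distrib]
    rw [h2, zero_sub, Finset.sum_eq_single (n - 1)]
    · rw [if_pos rfl, show n - 1 + 1 = n by omega, h3, one_mul]
    · intro k _ hk
      rw [if_neg hk, mul_zero]
    · intro h
      exact absurd (Finset.mem_range.2 (by omega)) h
  rw [h1, hg]; ring

theorem norm_exp_sub_one_le_mul {v : ℂ} {B : ℝ} (hv : ‖v‖ ≤ B) :
    ‖Complex.exp v - 1‖ ≤ Real.exp B * ‖v‖ := by
  have h := Complex.norm_exp_sub_sum_le_norm_mul_exp v 1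
  simp only [Finset.sum_range_one, pow_zero, Nat.factorial_zero, Nat.cast_one, div_one,
    pow_one] at h
  refine h.trans ?_
  rw [mul_comm]
  exact mul_le_mul_of_nonneg_right (Real.exp_le_exp.2 hv) (norm_nonneg _)

/-- The logarithm of `y e^{-lam (t - t₀)}` in terms of the modes. -/
theorem exponent_eq_integral {m : ℕ} (hm : 1 ≤ m) {γ : Fin m → ℂ} (hγ : Function.Injective γ)
    (hγ0 : ∀ j, γ j ≠ 0) {t₀ T t : ℝ} {u : Fin m → ℝ → ℂ} (hu : ∀ j, Continuous (u j))
    {f g : ℝ → ℂ} (hf : ∀ b c, t₀ ≤ b → t₀ ≤ c → IntervalIntegrable f volume b c)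
    (hg : IntegrableOn g (Ici T)) (hT : t₀ ≤ T) (ht : T ≤ t)
    (heq : ∀ j, u j t = u j T + ∫ s in T..t, (γ j * u j s + (f s + g s))) :
    (-∑ j, 1 / (Gam γ j * γ j) * u j t) + (-1) ^ (m + 1) * (∏ k, (γ k)⁻¹) *
        ((∫ s in t₀..t, f s) - ∫ s in Ioi t, g s) =
      ((-∑ j, 1 / (Gam γ j * γ j) * u j T) + (-1) ^ (m + 1) * (∏ k, (γ k)⁻¹) *
        ((∫ s in t₀..T, f s) - ∫ s in Ioi T, g s)) +
      ∫ s in T..t, modeJet γ (fun j ↦ u j s) 0 := by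
  have hfT := hf T t hT (hT.trans ht)
  have hgT : IntervalIntegrable g volume T t :=
    (intervalIntegrable_iff_integrableOn_Icc_of_le ht).2 (hg.mono_set Icc_subset_Ici_self)
  have h1 : (∫ s in t₀..t, f s) = (∫ s in t₀..T, f s) + ∫ s in T..t, f s :=
    (intervalIntegral.integral_add_adjacent_intervals (hf t₀ T le_rfl hT) hfT).symm
  have h2 : (∫ s in Ioi T, g s) = (∫ s in T..t, g s) + ∫ s in Ioi t, g s :=
    (intervalIntegral.integral_interval_add_Ioi (hg.mono_set Ioi_subset_Ici_self)
      (hg.mono_set (Ioi_subset_Ici ht))).symm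
  have h3 : ∀ j, u j t = u j T + (γ j * (∫ s in T..t, u j s) + ((∫ s in T..t, f s) +
      ∫ s in T..t, g s)) := by
    intro j
    rw [heq j, intervalIntegral.integral_add (((hu j).const_mul _).intervalIntegrable _ _)
      (hfT.add hgT), intervalIntegral.integral_const_mul, intervalIntegral.integral_add hfT hgT]
  have h4 : ∫ s in T..t, modeJet γ (fun j ↦ u j s) 0 =
      -∑ j, 1 / Gam γ j * ∫ s in T..t, u j s := by
    simp only [modeJet, pow_zero]
    rw [intervalIntegral.integral_neg, intervalIntegral.integral_finsetSum
      fun j _ ↦ ((hu j).const_mul _).intervalIntegrable _ _]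
    simp only [intervalIntegral.integral_const_mul]
  rw [h4, ← sum_inv_Gam_mul hm hγ hγ0, h1, h2]
  have h5 : ∑ j, 1 / (Gam γ j * γ j) * u j t = ∑ j, 1 / (Gam γ j * γ j) * u j T +
      ∑ j, 1 / Gam γ j * (∫ s in T..t, u j s) + (∑ j, 1 / (Gam γ j * γ j)) *
        ((∫ s in T..t, f s) + ∫ s in T..t, g s) := by
    rw [Finset.sum_mul, ← Finset.sum_add_distrib, ← Finset.sum_add_distrib]
    refine Finset.sum_congr rfl fun j _ ↦ ?_
    have h6 : 1 / (Gam γ j * γ j) * γ j = 1 / Gam γ j := by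
      have := hγ0 j
      rw [one_div, mul_inv, mul_assoc, inv_mul_cancel₀ this, mul_one, one_div]
    rw [h3 j]
    linear_combination (∫ s in T..t, u j s) * h6
  rw [h5]; ring

/-- The error exponent is bounded, and controlled by the Green integrals and the tail. -/
theorem exists_norm_error_exponent_le {m : ℕ} {γ : Fin m → ℂ} (hγ0 : ∀ j, (γ j).re ≠ 0)
    {T : ℝ} {l g : ℝ → ℂ} (hl : IntegrableOn l (Ici T)) (hg : IntegrableOn g (Ici T)) (κ : ℂ) :
    ∃ B K : ℝ, 0 ≤ K ∧ ∀ t, T ≤ t →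
      ‖(-∑ j, 1 / (Gam γ j * γ j) * greenG T (γ j) (fun s ↦ l s + g s) t) -
        κ * ∫ s in Ioi t, (l s + g s)‖ ≤ B ∧
      ‖(-∑ j, 1 / (Gam γ j * γ j) * greenG T (γ j) (fun s ↦ l s + g s) t) -
        κ * ∫ s in Ioi t, (l s + g s)‖ ≤
      K * ((∑ j, greenI T (((γ j).re : ℝ) : ℂ) (fun s ↦ l s + g s) t) +
        ∫ s in Ioi t, (‖l s‖ + ‖g s‖)) := by
  set c : ℝ := ∑ j, ‖1 / (Gam γ j * γ j)‖ with hc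
  have hc0 : 0 ≤ c := Finset.sum_nonneg fun _ _ ↦ norm_nonneg _
  have hlg := hl.add hg
  -- Rate `β = 0`: the kernel is at most `1`, and the `L¹` norm bounds the Green integrals uniformly
  -- in `t`.
  have hE := ExpIntegrable.of_integrableOn le_rfl hlg
  have hn : IntegrableOn (fun s ↦ ‖l s‖ + ‖g s‖) (Ici T) := hl.norm.add hg.norm
  have hcj : ∀ j, ‖1 / (Gam γ j * γ j)‖ ≤ c := fun j ↦
    Finset.single_le_sum (f := fun j ↦ ‖1 / (Gam γ j * γ j)‖) (fun _ _ ↦ norm_nonneg _)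
      (Finset.mem_univ j)
  have htail : ∀ t, T ≤ t → ‖∫ s in Ioi t, (l s + g s)‖ ≤ ∫ s in Ioi t, (‖l s‖ + ‖g s‖) := by
    intro t ht
    exact norm_integral_le_of_norm_le (hn.mono_set (Ioi_subset_Ici ht))
      (Eventually.of_forall fun s ↦ norm_add_le _ _)
  have hmain : ∀ (t : ℝ) (D : Fin m → ℝ),
      (∀ j, ‖greenG T (γ j) (fun s ↦ l s + g s) t‖ ≤ D j) →
      ‖(-∑ j, 1 / (Gam γ j * γ j) * greenG T (γ j) (fun s ↦ l s + g s) t) -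
        κ * ∫ s in Ioi t, (l s + g s)‖ ≤
      c * (∑ j, D j) + ‖κ‖ * ‖∫ s in Ioi t, (l s + g s)‖ := by
    intro t D hD
    refine (norm_sub_le _ _).trans ?_
    rw [norm_neg, norm_mul]
    refine add_le_add ((norm_sum_le _ _).trans ?_) le_rfl
    rw [Finset.mul_sum]
    refine Finset.sum_le_sum fun j _ ↦ ?_
    rw [norm_mul]
    exact mul_le_mul (hcj j) (hD j) (norm_nonneg _) hc0
  refine ⟨c * (∑ _j : Fin m, ∫ s in Ici T, ‖l s + g s‖) +
    ‖κ‖ * ∫ s in Ici T, (‖l s‖ + ‖g s‖), c + ‖κ‖, by positivity, fun t ht ↦ ⟨?_, ?_⟩⟩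
  · refine (hmain t _ fun j ↦ ?_).trans (add_le_add le_rfl
      (mul_le_mul_of_nonneg_left ((htail t ht).trans ?_) (norm_nonneg _)))
    · refine (norm_greenG_le le_rfl hE (hγ0 j) (abs_nonneg _) t).trans (le_of_eq ?_)
      simp
    · exact setIntegral_mono_set hn (Eventually.of_forall fun s ↦ by positivity)
        (LE.le.eventuallyLE (Ioi_subset_Ici ht))
  · refine (hmain t _ fun j ↦ norm_greenG_le_greenI T (γ j) _ t).trans ?_
    have h1 : 0 ≤ ∑ j, greenI T (((γ j).re : ℝ) : ℂ) (fun s ↦ l s + g s) t :=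
      Finset.sum_nonneg fun j _ ↦ greenI_nonneg _ _ _ _
    have h2 := htail t ht
    have h3 : 0 ≤ ∫ s in Ioi t, (‖l s‖ + ‖g s‖) := (norm_nonneg _).trans h2
    have h4 := mul_le_mul_of_nonneg_left h2 (norm_nonneg κ)
    nlinarith [norm_nonneg κ, mul_nonneg hc0 h3, mul_nonneg (norm_nonneg κ) h1]

end PoincarePerron

/-! ### The main theorem. -/

theorem mainTheorem6 (n : ℕ) (hn : 2 ≤ n) (t₀ : ℝ) (a : Fin n → ℂ) (r : Fin n → ℝ → ℂ)
    (lam : ℂ) (lams : Fin (n - 1) → ℂ)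
    (hroots : charPoly a =
      (Polynomial.X - Polynomial.C lam) * ∏ j, (Polynomial.X - Polynomial.C (lams j)))
    (hre : ∀ j, (lams j).re ≠ lam.re)
    (hre' : ∀ j k, j ≠ k → (lams j).re ≠ (lams k).re)
    (p : ENNReal) (hp : 1 < p ∧ p ≤ 2)
    (pk : ℕ → ENNReal) (hpk : ∀ k ∈ Finset.Icc 1 (n - 1), 1 < pk k ∧ pk k ≤ 2)
    (hP : MemLp (pertDeriv r lam 0) p (volume.restrict (Ici t₀)))
    (hPk : ∀ k ∈ Finset.Icc 1 (n - 1),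
      MemLp (pertDeriv r lam k) (pk k) (volume.restrict (Ici t₀))) :
    ∃ y : ℝ → ℂ, IsSolution t₀ a r y ∧
      (∀ i ∈ Finset.Icc 1 (n - 1),
        Tendsto (fun t => iteratedDerivWithin i y (Ici t₀) t / y t) atTop (𝓝 (lam ^ i))) ∧
      ∃ T : ℝ, t₀ ≤ T ∧ (∀ t, T ≤ t → y t ≠ 0) ∧
      ∃ z : ℝ → ℂ, (∀ t, T ≤ t → z t = derivWithin y (Ici t₀) t / y t - lam) ∧
        IntegrableOn (fun s => linPart r lam s (jet T z s)) (Ici T) ∧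
        IntegrableOn (fun s => nonlinPart a r lam s (jet T z s)) (Ici T) ∧
        ∃ ε : ℝ → ℂ,
          (∀ t, t₀ ≤ t → y t = (1 + ε t) * Complex.exp (lam * ((t - t₀ : ℝ) : ℂ)) *
            Complex.exp
              (-(∑ j, 1 / (Gam (fun i => lams i - lam) j * (lams j - lam)) *
                  greenG t₀ (lams j - lam) (pertDeriv r lam 0) t) +
                (-1) ^ n * (∏ k, (lams k - lam)⁻¹) * ∫ s in t₀..t, pertDeriv r lam 0 s)) ∧
          ε =O[atTop] (fun t =>
            (∑ j, greenI T (((lams j - lam).re : ℝ) : ℂ)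
                (fun s => linPart r lam s (jet T z s) + nonlinPart a r lam s (jet T z s)) t) +
              ∫ s in Ioi t, (‖linPart r lam s (jet T z s)‖ + ‖nonlinPart a r lam s (jet T z s)‖)) := by
  set γ : Fin (n - 1) → ℂ := fun j ↦ lams j - lam with hγdef
  have hγre : ∀ j, (γ j).re ≠ 0 := fun j ↦ by
    simpa [hγdef, sub_eq_zero] using hre j
  have hγ0 : ∀ j, γ j ≠ 0 := fun j h ↦ hγre j (by rw [h]; rfl)
  have hγinj : Function.Injective γ := fun j k hjk ↦ by
    by_contra hne
    exact hre' j k hne (by rw [sub_left_injective hjk])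
  obtain ⟨b, hb, hbγ⟩ := exists_pos_two_mul_le_abs_re (by omega) hγre
  -- the weight dominating all coefficients
  obtain ⟨w, hw, hw0, hsplit⟩ := exists_weight (N := n + 1) (t₀ := t₀) (c := pertDeriv r lam)
    (p := fun k ↦ if k = 0 then p else if k = n then 2 else pk k)
    (fun k hk ↦ by
      have := Finset.mem_range.1 hk
      split_ifs with h1 h2
      · exact hp
      · exact ⟨by norm_num, le_rfl⟩
      · exact hpk k (Finset.mem_Icc.2 ⟨by omega, by omega⟩))
    (fun k hk ↦ by
      have := Finset.mem_range.1 hk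
      split_ifs with h1 h2
      · rw [h1]; exact hP
      · have : pertDeriv r lam k = fun _ ↦ 0 := by
          funext t; rw [h2, pertDeriv_self]
        rw [this]; exact MemLp.zero'
      · exact hPk k (Finset.mem_Icc.2 ⟨by omega, by omega⟩))
  have hmeas : ∀ k ∈ Finset.range (n + 1),
      AEStronglyMeasurable (pertDeriv r lam k) (volume.restrict (Ici t₀)) := by
    intro k hk
    have := Finset.mem_range.1 hk
    rcases Nat.eq_zero_or_pos k with h1 | h1
    · rw [h1]; exact hP.1
    · rcases Nat.lt_or_ge k n with h2 | h2
      · exact (hPk k (Finset.mem_Icc.2 ⟨h1, by omega⟩)).1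
      · have : pertDeriv r lam k = fun _ ↦ 0 := by
          funext t; rw [show k = n by omega, pertDeriv_self]
        rw [this]; exact aestronglyMeasurable_const
  have h0mem : 0 ∈ Finset.range (n + 1) := Finset.mem_range.2 (by omega)
  have hloc : ∀ k ∈ Finset.range (n + 1), ∀ b, IntegrableOn (pertDeriv r lam k) (Icc t₀ b) :=
    fun k hk c ↦ ((hsplit k hk).expIntegrable one_pos hw (hmeas k hk)).integrableOn_Icc
      zero_le_one c
  have hr : ∀ i c, IntegrableOn (r i) (Icc t₀ c) := by
    intro i c
    have h1 : r i = fun t ↦ ∑ k ∈ Finset.range (n + 1), pertDeriv r lam k t *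
        (1 / (k.factorial : ℂ) * ((k.choose i : ℂ) * (-lam) ^ (k - i))) := by
      funext t; exact coeff_eq_sum_pertDeriv r lam t i
    rw [h1]
    exact integrable_finsetSum _ fun k hk ↦ (hloc k hk c).mul_const _
  have hq : SplitBound t₀ w fun s ↦ pertSum r lam s / ((n + 1 : ℕ) : ℝ) :=
    splitBound_average (by omega) hsplit
  have hqm : AEStronglyMeasurable (fun s ↦ pertSum r lam s / ((n + 1 : ℕ) : ℝ))
      (volume.restrict (Ici t₀)) := by
    simp only [div_eq_mul_inv]
    exact (Finset.aestronglyMeasurable_fun_sum _ fun k hk ↦ (hmeas k hk).norm).mul_const _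
  -- the modes
  obtain ⟨C, μ₀, hC, hμ₀, hlip⟩ := exists_perturbation_lipschitz (a := a) (r := r) (lam := lam) hn γ
  obtain ⟨T, R, hT, hR, hRμ, u, huc, hub, hueq, huint⟩ := exists_modes (γ := γ) hb hbγ hw hw0
    (hsplit 0 h0mem) (hmeas 0 h0mem) hq hqm
    (h := fun s v ↦ linPart r lam s (modeJet γ v) + nonlinPart a r lam s (modeJet γ v)) hC hμ₀
    (fun s _ ↦ hlip s)
    (fun s ↦ by rw [modeJet_zero, linPart_zero, nonlinPart_zero, add_zero])
    (fun v hv ↦ (aestronglyMeasurable_linPart hmeas fun k ↦ continuous_modeJet γ hv k).add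
      (aestronglyMeasurable_nonlinPart hmeas fun k ↦ continuous_modeJet γ hv k))
  set H : ℝ → ℂ := fun s ↦ linPart r lam s (modeJet γ fun j ↦ u j s) +
    nonlinPart a r lam s (modeJet γ fun j ↦ u j s) with hH
  set f : ℝ → ℂ := pertDeriv r lam 0 with hf
  set g : ℝ → ℂ := fun s ↦ f s + H s with hg
  have hb2 : 0 < 2 * b := by linarith
  have hfE : ExpIntegrable t₀ (2 * b) f := (hsplit 0 h0mem).expIntegrable hb2 hw (hmeas 0 h0mem)
  have hHE : ExpIntegrable T (2 * b) H := ExpIntegrable.of_integrableOn hb2.le huint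
  have hfi : ∀ c d, t₀ ≤ c → t₀ ≤ d → IntervalIntegrable f volume c d := by
    intro c d hc hd
    have hle : t₀ ≤ max c d := hc.trans (le_max_left _ _)
    refine ((intervalIntegrable_iff_integrableOn_Icc_of_le hle).2
      (hloc 0 h0mem (max c d))).mono_set ?_
    rw [uIcc_of_le hle]
    exact Icc_subset_Icc (le_min hc hd) le_rfl
  have hHi : ∀ t, T ≤ t → IntervalIntegrable H volume T t := fun t ht ↦
    (intervalIntegrable_iff_integrableOn_Icc_of_le ht).2 (huint.mono_set Icc_subset_Ici_self)
  have hgi : ∀ t, T ≤ t → IntervalIntegrable g volume T t := fun t ht ↦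
    (hfi T t hT (hT.trans ht)).add (hHi t ht)
  have hode : ∀ j t, T ≤ t → u j t = u j T + ∫ s in T..t, (γ j * u j s + g s) := by
    intro j t ht
    have e1 := greenG_eq_add_integral hb2.le hfE (hγre j) (hbγ j) hT ht
    have e2 := greenG_eq_add_integral hb2.le hHE (hγre j) (hbγ j) le_rfl ht
    have i1 : IntervalIntegrable (fun s ↦ γ j * greenG t₀ (γ j) f s + f s) volume T t :=
      (((continuous_greenG hb2.le hfE (hγre j) (hbγ j)).const_mul (γ j)).intervalIntegrable
        _ _).add (hfi T t hT (hT.trans ht))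
    have i2 : IntervalIntegrable (fun s ↦ γ j * greenG T (γ j) H s + H s) volume T t :=
      (((continuous_greenG hb2.le hHE (hγre j) (hbγ j)).const_mul (γ j)).intervalIntegrable
        _ _).add (hHi t ht)
    rw [hueq j t, hueq j T, e1, e2, add_add_add_comm, ← intervalIntegral.integral_add i1 i2]
    congr 1
    refine intervalIntegral.integral_congr fun s _ ↦ ?_
    simp only [hueq j s, hg]
    ring
  set x : ℕ → ℝ → ℂ := fullJet γ u g with hx
  have hxlt : ∀ k < n - 1, ∀ t, x k t = modeJet γ (fun j ↦ u j t) k :=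
    fun k hk t ↦ fullJet_of_lt hk t
  have hxc : ∀ k < n - 1, Continuous (x k) := by
    intro k hk
    rw [show x k = fun t ↦ modeJet γ (fun j ↦ u j t) k from funext (hxlt k hk)]
    exact continuous_modeJet γ huc k
  -- Integrating `H` from `t` to infinity, rather than from `t₀` to `t`, fixes the free constant
  -- factor of `y` so that what `H` adds to the exponent is controlled by the error terms.
  set Q : ℝ → ℂ := fun t ↦ (-∑ j, 1 / (Gam γ j * γ j) * u j t) +
    (-1) ^ (n - 1 + 1) * (∏ k, (γ k)⁻¹) * ((∫ s in t₀..t, f s) - ∫ s in Ioi t, H s) with hQ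
  have hQi : ∀ t, T ≤ t → Q t = Q T + ∫ s in T..t, x 0 s := by
    intro t ht
    have h1 := exponent_eq_integral (by omega) hγinj hγ0 huc hfi huint hT ht
      fun j ↦ hode j t ht
    simp only [hQ]
    rw [h1]
    congr 1
    exact intervalIntegral.integral_congr fun s _ ↦ (hxlt 0 (by omega) s).symm
  obtain ⟨hYc, hYi, hYl⟩ := exp_mul_shiftBell_eq_integral (a := a) hn hT hr (lam := lam) (x := x)
    (Q := Q) (fun k hk ↦ (hxc k hk).continuousOn)
    (fun k _ t ht ↦ intervalIntegrable_fullJet huc (hgi t ht) (k + 1))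
    (fun k hk t ht ↦ fullJet_eq_integral hγinj huc (hgi t ht) (fun j ↦ hode j t ht) hk) hQi
    (fun t _ ↦ sum_mul_shiftBell_fullJet hn hroots rfl) (fun _ _ ↦ rfl)
  obtain ⟨y, hy, hyY⟩ := exists_isSolution_extension (by omega) hT hr hYc hYi hYl
  have hy0 : ∀ t, T ≤ t → y t = Complex.exp (lam * ((t - t₀ : ℝ) : ℂ) + Q t) := by
    intro t ht
    have := hyY 0 (by omega) t ht
    simpa [shiftBell_zero] using this
  have hratio : ∀ i < n, ∀ t, T ≤ t →
      iteratedDerivWithin i y (Ici t₀) t / y t = shiftBell lam (fun k ↦ x k t) i := by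
    intro i hi t ht
    rw [hyY i hi t ht, hy0 t ht, mul_div_cancel_left₀ _ (Complex.exp_ne_zero _)]
  have hut : ∀ j, Tendsto (u j) atTop (𝓝 0) := by
    intro j
    refine squeeze_zero_norm (hub j) ?_
    simpa using ((tendsto_expConv hb2 hw).sqrt).const_mul R
  have hxt : ∀ k < n - 1, Tendsto (x k) atTop (𝓝 0) := by
    intro k hk
    rw [show x k = fun t ↦ modeJet γ (fun j ↦ u j t) k from funext (hxlt k hk)]
    have h1 : Tendsto (fun t ↦ ∑ j, γ j ^ k / Gam γ j * u j t) atTop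
        (𝓝 (∑ j, γ j ^ k / Gam γ j * 0)) :=
      tendsto_finsetSum _ fun j _ ↦ (hut j).const_mul _
    simpa [modeJet] using h1.neg
  have hjet : ∀ k < n - 1, ∀ t, T ≤ t → jet T (x 0) t k = modeJet γ (fun j ↦ u j t) k :=
    fun k hk t ht ↦ (jet_fullJet hγinj huc hgi hode hk ht).trans (hxlt k hk t)
  have hlin : ∀ s, T ≤ s → linPart r lam s (jet T (x 0) s) =
      linPart r lam s (modeJet γ fun j ↦ u j s) :=
    fun s hs ↦ linPart_congr r lam s fun k hk ↦ hjet k hk s hs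
  have hnonlin : ∀ s, T ≤ s → nonlinPart a r lam s (jet T (x 0) s) =
      nonlinPart a r lam s (modeJet γ fun j ↦ u j s) :=
    fun s hs ↦ nonlinPart_congr a r lam s fun k hk ↦ hjet k hk s hs
  have hsub : Ici T ⊆ Ici t₀ := Ici_subset_Ici.2 hT
  -- Only the sum `ℒ + ℱ` is known to be integrable so far. For `ℒ` it follows from `|ℒ| ≤ const · q
  -- e`, and for `ℱ` then by difference.
  have hLi : IntegrableOn (fun s ↦ linPart r lam s (modeJet γ fun j ↦ u j s)) (Ici T) := by
    obtain ⟨M, -, hM⟩ := exists_norm_modeJet_le γ (n - 1)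
    have h1 := (integrableOn_mul_sqrt_expConv hb2 hw hw0 hq hqm).mono_set hsub
    refine (h1.const_mul (((n + 1 : ℕ) : ℝ) * (M * R))).mono'
      ((aestronglyMeasurable_linPart hmeas fun k ↦ continuous_modeJet γ huc k).mono_measure
        (Measure.restrict_mono hsub le_rfl)) (Eventually.of_forall fun s ↦ ?_)
    have h2 := norm_linPart_sub_le hn r lam s (x' := fun _ ↦ 0) fun k hk ↦
      (congrArg norm (sub_zero _)).trans_le
        (hM _ _ (by positivity) (fun j ↦ hub j s) k hk)
    rw [linPart_zero, sub_zero] at h2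
    refine h2.trans (le_of_eq ?_)
    field_simp
  have hNi : IntegrableOn (fun s ↦ nonlinPart a r lam s (modeJet γ fun j ↦ u j s)) (Ici T) := by
    refine (huint.sub hLi).congr (Eventually.of_forall fun s ↦ ?_)
    simp [hH]
  refine ⟨y, hy, fun i hi ↦ ?_, T, hT, fun t ht ↦ ?_, x 0, fun t ht ↦ ?_, ?_, ?_, ?_⟩
  · have hi' := Finset.mem_Icc.1 hi
    have h1 := tendsto_shiftBell (lam := lam) (x := x) (x₀ := fun _ ↦ 0) (l := atTop) (i := i)
      fun k hk ↦ hxt k (by omega)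
    rw [shiftBell_const_zero] at h1
    refine h1.congr' ?_
    filter_upwards [eventually_ge_atTop T] with t ht
    exact (hratio i (by omega) t ht).symm
  · rw [hy0 t ht]; exact Complex.exp_ne_zero _
  · have h1 := hratio 1 (by omega) t ht
    rw [iteratedDerivWithin_one, shiftBell_one] at h1
    rw [h1]; ring
  · exact hLi.congr_fun (fun s hs ↦ (hlin s hs).symm) measurableSet_Ici
  · exact hNi.congr_fun (fun s hs ↦ (hnonlin s hs).symm) measurableSet_Ici
  · set P : ℝ → ℂ := fun t ↦ -(∑ j, 1 / (Gam γ j * γ j) * greenG t₀ (γ j) f t) +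
      (-1) ^ n * (∏ k, (γ k)⁻¹) * ∫ s in t₀..t, f s with hPdef
    obtain ⟨B, K, hK, hBK⟩ := exists_norm_error_exponent_le hγre hLi hNi
      ((-1) ^ n * (∏ k, (γ k)⁻¹))
    -- Defined as a quotient by exponentials, `ε` satisfies the formula on all of `[t₀, ∞)`, even
    -- where `y` may vanish; only its bound needs `t ≥ T`.
    refine ⟨fun t ↦ y t / (Complex.exp (lam * ((t - t₀ : ℝ) : ℂ)) * Complex.exp (P t)) - 1,
      fun t _ ↦ ?_, ?_⟩
    · rw [add_sub_cancel, mul_assoc, div_mul_cancel₀]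
      exact mul_ne_zero (Complex.exp_ne_zero _) (Complex.exp_ne_zero _)
    · refine IsBigO.of_bound (Real.exp B * K) ?_
      filter_upwards [eventually_ge_atTop T] with t ht
      obtain ⟨h1, h2⟩ := hBK t ht
      set v := (-∑ j, 1 / (Gam γ j * γ j) * greenG T (γ j) (fun s ↦
        linPart r lam s (modeJet γ fun j ↦ u j s) +
        nonlinPart a r lam s (modeJet γ fun j ↦ u j s)) t) - (-1) ^ n * (∏ k, (γ k)⁻¹) *
        ∫ s in Ioi t, (linPart r lam s (modeJet γ fun j ↦ u j s) +
        nonlinPart a r lam s (modeJet γ fun j ↦ u j s)) with hv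
      have h3 : y t / (Complex.exp (lam * ((t - t₀ : ℝ) : ℂ)) * Complex.exp (P t)) =
          Complex.exp v := by
        rw [hy0 t ht, ← Complex.exp_add, ← Complex.exp_sub]
        congr 1
        -- Each mode splits into its Green integrals of `f` and of `H`; the former give `P`, the
        -- latter `v`.
        have h4 : Q t = P t + v := by
          simp only [hQ, hPdef, hv, hueq _ t, mul_add, Finset.sum_add_distrib,
            show n - 1 + 1 = n by omega]
          ring
        rw [h4]; ring
      have hI : ∀ j, greenI T (((γ j).re : ℝ) : ℂ) (fun s ↦ linPart r lam s (jet T (x 0) s) +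
          nonlinPart a r lam s (jet T (x 0) s)) t = greenI T (((γ j).re : ℝ) : ℂ) (fun s ↦
          linPart r lam s (modeJet γ fun j ↦ u j s) +
          nonlinPart a r lam s (modeJet γ fun j ↦ u j s)) t := fun j ↦
        setIntegral_congr_fun measurableSet_Ici fun s hs ↦ by
          simp only [hlin s hs, hnonlin s hs]
      have hT2 : ∫ s in Ioi t, (‖linPart r lam s (jet T (x 0) s)‖ +
          ‖nonlinPart a r lam s (jet T (x 0) s)‖) =
          ∫ s in Ioi t, (‖linPart r lam s (modeJet γ fun j ↦ u j s)‖ +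
          ‖nonlinPart a r lam s (modeJet γ fun j ↦ u j s)‖) :=
        setIntegral_congr_fun measurableSet_Ioi fun s hs ↦ by
          have hs' : T ≤ s := ht.trans (mem_Ioi.1 hs).le
          simp only [hlin s hs', hnonlin s hs']
      rw [h3, hT2, Finset.sum_congr rfl fun j _ ↦ hI j]
      refine (norm_exp_sub_one_le_mul h1).trans ?_
      rw [mul_assoc]
      refine mul_le_mul_of_nonneg_left (h2.trans ?_) (Real.exp_pos _).le
      exact mul_le_mul_of_nonneg_left (le_abs_self _) hK
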